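/- Work over $\mathbb{C}$ and let $S=\mathbb{C}[x,y,z]$. For a reduced plane curve $C: f=0$ of degree $d$ in $\mathbb{P}^2_{\mathbb{C}}$ let $\mathrm{mdr}(f)$ be the minimal degree of a nonzero triple $(a,b,c)\in S^3$ of homogeneous polynomials of the same degree with $af_x+bf_y+cf_z=0$, and let $\tau(C)$ be the total Tjurina number of $C$ (the sum of the local Tjurina numbers over all singular points of $C$). With $r=\mathrm{mdr}(f)$, the curve $C$ is called free if $r\le (d-1)/2$ and $\tau(C)=(d-1)^2-r(d-r-1)$; its exponents are then $(r,d-1-r)$. A nodal cubic is an irreducible plane cubic with a node (every such cubic is projectively equivalent to $x^3+y^3-xyz=0$). An inflectional line of a curve $E$ is the tangent line $T_pE$ at a smooth point $p$ of $E$ with local intersection multiplicity $(E,T_pE)_p\ge 3$. A hyperosculating conic of $E$ is an irreducible conic $Q$ for which there is a smooth point $p$ of $E$ with $(E,Q)_p\ge 6$. **Theorem 3.1.** Let $E$ be a nodal cubic. 1) If $\mathcal{C}$ is the arrangement (union) of $E$, one hyperosculating conic of $E$ and one inflectional line of $E$, then $\mathcal{C}$ is a free curve of degree $6$ with exponents $(2,3)$.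 2) If $\mathcal{C}$ is the arrangement of $E$, one hyperosculating conic of $E$ and two distinct inflectional lines of $E$, then $\mathcal{C}$ is a free curve of degree $7$ with exponents $(3,3)$. -/

import Mathlib

open MvPolynomial LinearAlgebra.Projectivization

noncomputable section

namespace PlaneCurve

/-- The homogeneous coordinate ring `ℂ[x, y, z]` of the complex projective plane.  Plane curves are
given by nonzero homogeneous elements of this ring, up to nonzero constant factors. -/
abbrev S : Type := MvPolynomial (Fin 3) ℂ

/-- The complex projective plane. -/
abbrev P2 : Type := ℙ ℂ (Fin 3 → ℂ)

/-- The homogeneous prime ideal of a point `p = (p₀ : p₁ : p₂)`: the polynomials that vanish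
identically on the line `ℂ · (p₀, p₁, p₂)`, i.e. the kernel of `F ↦ F (p₀ T, p₁ T, p₂ T) ∈ ℂ[T]`. -/
def pointIdeal (p : P2) : Ideal S :=
  RingHom.ker (aeval (fun i => Polynomial.C (p.rep i) * Polynomial.X) : S →ₐ[ℂ] Polynomial ℂ)

instance (p : P2) : (pointIdeal p).IsPrime := RingHom.ker_isPrime _

/-- The localization of `ℂ[x, y, z]` at the homogeneous prime ideal of the point `p`. -/
abbrev LocalRingAt (p : P2) : Type := Localization.AtPrime (pointIdeal p)

/-- The multiplicity at `p` of the closed subscheme of the projective plane defined by a homogeneous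
ideal `I`: the length of `(S ⧸ I)_𝔭` over `S_𝔭`, where `𝔭` is the homogeneous prime of `p`.
In an affine chart around `p` with local ring `𝒪_p`, in which `I` becomes the ideal `I_p`, one has
`S_𝔭 = 𝒪_p(t)`, so this is the length of `𝒪_p ⧸ I_p`, that is, its dimension over `ℂ`. -/
def localMultiplicity (I : Ideal S) (p : P2) : ℕ∞ :=
  Module.length (LocalRingAt p)
    (LocalRingAt p ⧸ I.map (algebraMap S (LocalRingAt p)))

/-- The local intersection multiplicity `(C, D)_p` of the curves `C : f = 0` and `D : g = 0`. -/
def intersectionMultiplicity (f g : S) (p : P2) : ℕ∞ :=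
  localMultiplicity (Ideal.span {f, g}) p

/-- The Jacobian ideal `⟨f_x, f_y, f_z⟩`. -/
def jacobianIdeal (f : S) : Ideal S := Ideal.span (Set.range fun i => pderiv i f)

/-- The point `p` lies on the curve `f = 0`. -/
def LiesOn (f : S) (p : P2) : Prop := eval p.rep f = 0

/-- `p` is a singular point of the curve `f = 0`. -/
def IsSingularPoint (f : S) (p : P2) : Prop :=
  LiesOn f p ∧ ∀ i, eval p.rep (pderiv i f) = 0

/-- `p` is a smooth point of the curve `f = 0`. -/
def IsSmoothPoint (f : S) (p : P2) : Prop :=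
  LiesOn f p ∧ ∃ i, eval p.rep (pderiv i f) ≠ 0

/-- The local Tjurina number at `p`, the multiplicity of the Jacobian scheme at `p`.  If `g` is a local
equation of the curve in affine coordinates `s, t`, then by Euler's formula the Jacobian ideal of `f`
becomes `(g, g_s, g_t)` in the local ring at `p`, so this is `dim_ℂ 𝒪_p ⧸ (g, g_s, g_t)`. -/
def tjurinaNumber (f : S) (p : P2) : ℕ∞ := localMultiplicity (jacobianIdeal f) p

/-- The total Tjurina number of the curve `f = 0`: the sum of the local Tjurina numbers over the
singular points (finitely many if `f` is squarefree). -/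
def totalTjurinaNumber (f : S) : ℕ∞ :=
  ∑ᶠ (p : P2) (_ : IsSingularPoint f p), tjurinaNumber f p

/-- The module `AR(f)` of Jacobian syzygies: triples `(a, b, c)` with `a f_x + b f_y + c f_z = 0`. -/
def AR (f : S) : Submodule S (Fin 3 → S) where
  carrier := {a | ∑ i, a i * pderiv i f = 0}
  add_mem' {a b} ha hb := by
    simp only [Set.mem_ofPred_eq, Pi.add_apply, add_mul, Finset.sum_add_distrib] at *
    rw [ha, hb, add_zero]
  zero_mem' := by simp
  smul_mem' c a ha := by
    simp only [Set.mem_ofPred_eq, Pi.smul_apply, smul_eq_mul, mul_assoc] at *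
    rw [← Finset.mul_sum, ha, mul_zero]

/-- The minimal degree `mdr(f)` of a nonzero Jacobian syzygy (one always exists). -/
def mdr (f : S) : ℕ :=
  sInf {k | ∃ a ∈ AR f, a ≠ 0 ∧ ∀ i, (a i).IsHomogeneous k}

/-- The curve `f = 0` is a free (reduced) plane curve of degree `d`: with `r = mdr(f)`,
one has `r ≤ (d - 1) / 2` and `τ = (d - 1)² - r (d - r - 1)`.
Under the first inequality none of the subtractions in the second is truncated. -/
structure IsFree (f : S) (d : ℕ) : Prop where
  isHomogeneous : f.IsHomogeneous d
  reduced : Squarefree f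
  mdr_le : 2 * mdr f + 1 ≤ d
  tjurina_eq : totalTjurinaNumber f = (((d - 1) ^ 2 - mdr f * (d - 1 - mdr f) : ℕ) : ℕ∞)

/-- The exponents `(r, d - 1 - r)`, `r = mdr(f)`, of a free curve `f = 0` of degree `d`. -/
def exponents (f : S) (d : ℕ) : ℕ × ℕ := (mdr f, d - 1 - mdr f)

/-- The Hessian matrix of `f`. -/
def hessian (f : S) : Matrix (Fin 3) (Fin 3) S := Matrix.of fun i j => pderiv i (pderiv j f)

/-- `p` is a node (ordinary double point, `A₁`) of the curve `f = 0`: a singular point at which the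
Hessian matrix has rank two.  At a singular point the kernel of the Hessian contains the vector `p`,
so this says that the quadratic part of a local equation at `p` is nondegenerate. -/
def IsNode (f : S) (p : P2) : Prop :=
  IsSingularPoint f p ∧ ((hessian f).map (eval p.rep)).rank = 2

/-- A nodal cubic: an irreducible plane cubic with a node. -/
structure IsNodalCubic (f : S) : Prop where
  isHomogeneous : f.IsHomogeneous 3
  irreducible : Irreducible f
  exists_node : ∃ p, IsNode f p

/-- The equation of the projective tangent line `T_p C` of `C : f = 0` at a smooth point `p`. -/
def tangentLine (f : S) (p : P2) : S := ∑ i, C (eval p.rep (pderiv i f)) * X i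

/-- The inflection order `ι_p(C) = (C, T_p C)_p - 2` at a smooth point `p`. -/
def inflectionOrder (f : S) (p : P2) : ℕ∞ :=
  intersectionMultiplicity f (tangentLine f p) p - 2

/-- `p` is an inflection point of the curve `f = 0`. -/
def IsInflectionPoint (f : S) (p : P2) : Prop := IsSmoothPoint f p ∧ 0 < inflectionOrder f p

/-- `l = 0` is an inflectional line of the curve `f = 0`: the tangent line at an inflection point. -/
def IsInflectionalLine (f l : S) : Prop :=
  ∃ p, IsInflectionPoint f p ∧ Associated l (tangentLine f p)

/-- `q = 0` is a hyperosculating conic of the curve `f = 0`: an irreducible conic that meets the curve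
at some smooth point of it with intersection multiplicity at least six. -/
structure IsHyperosculatingConic (f q : S) : Prop where
  isHomogeneous : q.IsHomogeneous 2
  irreducible : Irreducible q
  exists_contact : ∃ p, IsSmoothPoint f p ∧ 6 ≤ intersectionMultiplicity f q p

end PlaneCurve

end

/-!
All the arrangements in question are projectively equivalent to one of four explicit ones, for
which freeness is a computation.

*Classification.* A nodal cubic has the normal form `x³ + y³ = xyz`
(`IsNodalCubic.exists_pullback_eq`), the smooth points of which are `(t : t² : 1 + t³)`, `t ≠ 0`.
The contact of a curve `G` with the cubic at such a point is at most the order of vanishing at `t`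
of `G` along the parametrization (`pow_dvd_of_le_intersectionMultiplicity`). A line with threefold
contact therefore restricts to a multiple of `(s - t)³`, which forces `t³ = -1`, and a conic with
sixfold contact restricts to a multiple of `(s - t)⁶`, which forces `t⁶ = 1`, where `t³ = -1`
belongs to the double inflectional line. So there are three inflectional lines and three
hyperosculating conics, all with explicit equations. In coordinates adapted to the conic
(`nodalFrame`), the cubic is `modelCubic`, the conic `modelConic` and the lines are `modelLine`,
`modelLinePos`, `modelLineNeg`, where the last two are interchanged by the sign of a square root
of `-3`. This leaves two cases for one line (`exists_pullback_eq_model_of_line`) and two for two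
lines (`exists_pullback_eq_model_of_lines`).

*Total Tjurina numbers.* The singularities of the model arrangements are nodes (`τ = 1`), the
tangency of the cubic and an inflectional line (`A₅`, `τ = 5`) and the sixfold contact of the
cubic and the conic (`A₁₁`, `τ = 11`). In the first case the total is `1 + 11 + 5 + 2 = 19`; a
second line adds `5 + 2 + 1` and makes it `27`.

*Minimal degree of a syzygy.* For each of the four arrangements there are two Jacobian syzygies of
degrees `r` and `d - 1 - r` whose cross product is a nonzero constant multiple of the gradient. As
the partial derivatives of a squarefree form have no common factor, the cross product of any two
syzygies is a polynomial multiple of the gradient. For degree reasons, a syzygy of degree less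
than `r` would then be proportional to both given ones, which are independent
(`mdr_eq_of_crossProduct`).
-/

noncomputable section

namespace PlaneCurve

/-! ### Linear changes of coordinates -/

/-- Substitution of a linear map into a polynomial: `linSubst A f = f ∘ A` as functions on `ℂ³`. -/
def linSubst (A : (Fin 3 → ℂ) →ₗ[ℂ] (Fin 3 → ℂ)) : S →ₐ[ℂ] S :=
  aeval fun i => ∑ j, C (A (Pi.single j 1) i) * X j

lemma eval_linSubst (A : (Fin 3 → ℂ) →ₗ[ℂ] (Fin 3 → ℂ)) (f : S) (v : Fin 3 → ℂ) :
    eval v (linSubst A f) = eval (A v) f := by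
  have h : ∀ i, A v i = ∑ j, A (Pi.single j 1) i * v j := by
    intro i
    have hv : v = ∑ j, v j • (Pi.single j 1 : Fin 3 → ℂ) := by
      ext k; simp [Finset.sum_apply, Pi.single_apply]
    conv_lhs => rw [hv]
    simp only [map_sum, map_smul, Finset.sum_apply, Pi.smul_apply, smul_eq_mul, mul_comm]
  induction f using MvPolynomial.induction_on with
  | C a => simp [linSubst]
  | add p q hp hq => simp [hp, hq]
  | mul_X p i hp => rw [map_mul, map_mul, hp, map_mul, eval_X, h i]; simp [linSubst]

/-- The automorphism `f ↦ f ∘ A` of `ℂ[x, y, z]` defined by a linear automorphism `A` of `ℂ³`. -/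
def pullback (A : (Fin 3 → ℂ) ≃ₗ[ℂ] (Fin 3 → ℂ)) : S ≃ₐ[ℂ] S :=
  AlgEquiv.ofAlgHom (linSubst A) (linSubst A.symm)
    (AlgHom.ext fun f => MvPolynomial.funext fun v => by simp [eval_linSubst])
    (AlgHom.ext fun f => MvPolynomial.funext fun v => by simp [eval_linSubst])

section Pullback

variable (A : (Fin 3 → ℂ) ≃ₗ[ℂ] (Fin 3 → ℂ))

@[simp] lemma eval_pullback (f : S) (v : Fin 3 → ℂ) :
    eval v (pullback A f) = eval (A v) f := eval_linSubst A f v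

@[simp] lemma pullback_C (a : ℂ) : pullback A (C a) = C a := (pullback A).commutes a

lemma pullback_X (i : Fin 3) :
    pullback A (X i) = ∑ j, C (A (Pi.single j 1) i) * X j :=
  aeval_X _ i

@[simp] lemma pullback_pullback_symm (f : S) : pullback A (pullback A.symm f) = f :=
  (pullback A).apply_symm_apply f

@[simp] lemma pullback_symm_pullback (f : S) : pullback A.symm (pullback A f) = f :=
  (pullback A).symm_apply_apply f

lemma pullback_trans (B : (Fin 3 → ℂ) ≃ₗ[ℂ] (Fin 3 → ℂ)) (f : S) :
    pullback (B.trans A) f = pullback B (pullback A f) :=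
  MvPolynomial.funext fun v => by simp

lemma _root_.MvPolynomial.IsHomogeneous.pullback {f : S} {d : ℕ} (hf : f.IsHomogeneous d) :
    (pullback A f).IsHomogeneous d := by
  have := hf.aeval (fun i => ∑ j, C (A (Pi.single j 1) i) * (X j : S)) (n := 1) fun i =>
    IsHomogeneous.sum _ _ _ fun j _ => by
      simpa using (isHomogeneous_C (Fin 3) _).mul (isHomogeneous_X ℂ j)
  rw [one_mul] at this
  exact this

/-- The chain rule. -/
lemma pderiv_pullback (f : S) (j : Fin 3) :
    pderiv j (pullback A f) = ∑ i, C (A (Pi.single j 1) i) * pullback A (pderiv i f) := by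
  induction f using MvPolynomial.induction_on with
  | C a => simp
  | add p q hp hq => simp [hp, hq, mul_add, Finset.sum_add_distrib]
  | mul_X p i hp =>
    simp only [map_mul, pderiv_mul, hp, map_add, pderiv_X]
    have h1 : pderiv j (pullback A (X i)) = C (A (Pi.single j 1) i) := by
      rw [pullback_X, map_sum]
      simp only [pderiv_C_mul, pderiv_X]
      rw [Finset.sum_eq_single j]
      · simp
      · intro k _ hk; simp [Ne.symm hk]
      · simp
    rw [h1, Finset.sum_mul]
    simp only [mul_add, Finset.sum_add_distrib]
    refine congrArg₂ _ (Finset.sum_congr rfl fun k _ => mul_assoc _ _ _) ?_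
    rw [Finset.sum_eq_single i]
    · rw [Pi.single_eq_same, map_one, mul_one, mul_comm]
    · intro k _ hk
      rw [Pi.single_eq_of_ne hk.symm, map_zero, mul_zero, mul_zero]
    · exact fun h => absurd (Finset.mem_univ i) h

lemma jacobianIdeal_pullback_le (f : S) :
    jacobianIdeal (pullback A f) ≤ (jacobianIdeal f).map (pullback A : S →+* S) := by
  rw [jacobianIdeal, Ideal.span_le]
  rintro _ ⟨j, rfl⟩
  simp only [pderiv_pullback]
  refine Ideal.sum_mem _ fun i _ => Ideal.mul_mem_left _ _ (Ideal.mem_map_of_mem _ ?_)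
  exact Ideal.subset_span ⟨i, rfl⟩

lemma jacobianIdeal_pullback (f : S) :
    jacobianIdeal (pullback A f) = (jacobianIdeal f).map (pullback A : S →+* S) := by
  refine le_antisymm (jacobianIdeal_pullback_le A f) ?_
  have h := jacobianIdeal_pullback_le A.symm (pullback A f)
  rw [pullback_symm_pullback] at h
  refine (Ideal.map_mono h).trans ?_
  rw [Ideal.map_map]
  have : (pullback A : S →+* S).comp (pullback A.symm : S →+* S) = RingHom.id S :=
    RingHom.ext fun f => pullback_pullback_symm A f
  rw [this, Ideal.map_id]

/-! ### Points of the plane -/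

lemma eval_smul_of_isHomogeneous {f : S} {d : ℕ} (hf : f.IsHomogeneous d) (t : ℂ)
    (v : Fin 3 → ℂ) : eval (t • v) f = t ^ d * eval v f := by
  rw [eval_eq, eval_eq, Finset.mul_sum]
  refine Finset.sum_congr rfl fun m hm => ?_
  have hd : ∑ i, m i = d := by
    have := hf (mem_support_iff.mp hm)
    rw [← this, Finsupp.weight_apply, Finsupp.sum_fintype _ _ (by simp)]
    simp
  simp only [Pi.smul_apply, smul_eq_mul, mul_pow, Finset.prod_mul_distrib]
  have h2 : ∏ i ∈ m.support, t ^ m i = t ^ d := by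
    rw [Finset.prod_pow_eq_pow_sum, ← hd]
    congr 1
    exact Finset.sum_subset (Finset.subset_univ _) fun i _ hi => by simpa using hi
  rw [h2]; ring

lemma mem_pointIdeal_iff_rep {f : S} {p : P2} :
    f ∈ pointIdeal p ↔ ∀ t : ℂ, eval (t • p.rep) f = 0 := by
  have key : ∀ t : ℂ, Polynomial.eval t
      (aeval (fun i => Polynomial.C (p.rep i) * Polynomial.X) f) = eval (t • p.rep) f := by
    intro t
    induction f using MvPolynomial.induction_on with
    | C a => simp
    | add p q hp hq => simp only [map_add, Polynomial.eval_add, hp, hq]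
    | mul_X q i hq =>
      rw [map_mul, map_mul, Polynomial.eval_mul, hq, aeval_X, eval_X, Polynomial.eval_mul,
        Polynomial.eval_C, Polynomial.eval_X, Pi.smul_apply, smul_eq_mul, mul_comm t]
  rw [pointIdeal, RingHom.mem_ker]
  constructor
  · intro h t
    have h2 := key t
    rw [← h2]
    exact (congrArg (Polynomial.eval t) h).trans Polynomial.eval_zero
  · intro h
    refine Polynomial.funext fun t => ?_
    rw [Polynomial.eval_zero, ← h t, ← key t]

lemma mem_pointIdeal_mk_iff {f : S} {v : Fin 3 → ℂ} (hv : v ≠ 0) :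
    f ∈ pointIdeal (Projectivization.mk ℂ v hv) ↔ ∀ t : ℂ, eval (t • v) f = 0 := by
  rw [mem_pointIdeal_iff_rep]
  obtain ⟨a, ha⟩ := Projectivization.exists_smul_eq_mk_rep ℂ v hv
  rw [← ha]
  constructor
  · intro h t
    have := h (t * (a⁻¹ : ℂˣ))
    simpa [smul_smul, mul_assoc, Units.smul_def] using this
  · intro h t
    simpa [smul_smul, Units.smul_def] using h (t * a)

lemma eval_rep_mk_eq_zero_iff {f : S} {d : ℕ} (hf : f.IsHomogeneous d) {v : Fin 3 → ℂ}
    (hv : v ≠ 0) : eval (Projectivization.mk ℂ v hv).rep f = 0 ↔ eval v f = 0 := by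
  obtain ⟨a, ha⟩ := Projectivization.exists_smul_eq_mk_rep ℂ v hv
  rw [← ha, Units.smul_def, eval_smul_of_isHomogeneous hf]
  simp

lemma mem_pointIdeal_iff_of_isHomogeneous {f : S} {d : ℕ} (hf : f.IsHomogeneous d) {p : P2} :
    f ∈ pointIdeal p ↔ eval p.rep f = 0 := by
  rw [mem_pointIdeal_iff_rep]
  refine ⟨fun h => by simpa using h 1, fun h t => ?_⟩
  rw [eval_smul_of_isHomogeneous hf, h, mul_zero]

lemma mem_pointIdeal_smul_iff {f : S} {p : P2} :
    f ∈ pointIdeal (A • p) ↔ pullback A f ∈ pointIdeal p := by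
  induction p using Projectivization.ind with
  | h v hv =>
    rw [Projectivization.smul_mk, mem_pointIdeal_mk_iff, mem_pointIdeal_mk_iff]
    simp [LinearEquiv.smul_def]

lemma eval_smul_rep_eq_zero_iff {f : S} {d : ℕ} (hf : f.IsHomogeneous d) (p : P2) :
    eval (A • p).rep f = 0 ↔ eval p.rep (pullback A f) = 0 := by
  rw [← mem_pointIdeal_iff_of_isHomogeneous hf, mem_pointIdeal_smul_iff,
    mem_pointIdeal_iff_of_isHomogeneous (hf.pullback A)]

/-! ### Transport of multiplicities -/

lemma length_quotient_map_ringEquiv {R R' : Type*} [CommRing R] [CommRing R'] (e : R ≃+* R')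
    (I : Ideal R) : Module.length R' (R' ⧸ I.map (e : R →+* R')) = Module.length R (R ⧸ I) := by
  rw [Module.length_quotient, Module.length_quotient]
  have := Order.coheight_orderIso (e.idealComapOrderIso) (I.map (e : R →+* R'))
  rw [← this]
  congr 1
  exact Ideal.comap_map_of_bijective (e : R →+* R') e.bijective

lemma localMultiplicity_map_pullback (I : Ideal S) (p : P2) :
    localMultiplicity (I.map (pullback A : S →+* S)) p = localMultiplicity I (A • p) := by
  have hM : Submonoid.map (pullback A).toRingEquiv.toMonoidHom (pointIdeal (A • p)).primeCompl
      = (pointIdeal p).primeCompl := by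
    ext f
    constructor
    · rintro ⟨g, hg, rfl⟩
      exact fun h => hg ((mem_pointIdeal_smul_iff A).2 h)
    · intro hf
      refine ⟨pullback A.symm f, fun h => hf ?_, pullback_pullback_symm A f⟩
      simpa using (mem_pointIdeal_smul_iff A).1 h
  let e : LocalRingAt (A • p) ≃+* LocalRingAt p :=
    IsLocalization.ringEquivOfRingEquiv (M := (pointIdeal (A • p)).primeCompl)
      (T := (pointIdeal p).primeCompl) _ _ (pullback A).toRingEquiv hM
  rw [localMultiplicity, localMultiplicity, ← length_quotient_map_ringEquiv e]
  have : (e : LocalRingAt (A • p) →+* LocalRingAt p).comp (algebraMap S (LocalRingAt (A • p))) =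
      (algebraMap S (LocalRingAt p)).comp (pullback A : S →+* S) :=
    RingHom.ext fun f => IsLocalization.ringEquivOfRingEquiv_eq hM f
  rw [Ideal.map_map, Ideal.map_map, this]

lemma tjurinaNumber_pullback (f : S) (p : P2) :
    tjurinaNumber (pullback A f) p = tjurinaNumber f (A • p) := by
  rw [tjurinaNumber, jacobianIdeal_pullback, localMultiplicity_map_pullback, tjurinaNumber]

lemma intersectionMultiplicity_pullback (f g : S) (p : P2) :
    intersectionMultiplicity (pullback A f) (pullback A g) p =
      intersectionMultiplicity f g (A • p) := by
  rw [intersectionMultiplicity, intersectionMultiplicity, ← localMultiplicity_map_pullback,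
    Ideal.map_span, Set.image_pair]
  rfl

end Pullback

/-! ### Transport of curves and their invariants -/

section Transport

variable (A : (Fin 3 → ℂ) ≃ₗ[ℂ] (Fin 3 → ℂ))

lemma isSingularPoint_iff_mem_pointIdeal {f : S} {d : ℕ} (hf : f.IsHomogeneous d) {p : P2} :
    IsSingularPoint f p ↔ f ∈ pointIdeal p ∧ jacobianIdeal f ≤ pointIdeal p := by
  rw [IsSingularPoint, LiesOn, mem_pointIdeal_iff_of_isHomogeneous hf, jacobianIdeal,
    Ideal.span_le, Set.range_subset_iff]
  refine and_congr_right fun _ => forall_congr' fun i => ?_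
  exact (mem_pointIdeal_iff_of_isHomogeneous hf.pderiv).symm

lemma isSingularPoint_pullback_iff {f : S} {d : ℕ} (hf : f.IsHomogeneous d) {p : P2} :
    IsSingularPoint (pullback A f) p ↔ IsSingularPoint f (A • p) := by
  rw [isSingularPoint_iff_mem_pointIdeal (hf.pullback A), isSingularPoint_iff_mem_pointIdeal hf,
    mem_pointIdeal_smul_iff, jacobianIdeal_pullback, Ideal.map_le_iff_le_comap]
  refine and_congr_right fun _ => ⟨fun h g hg => ?_, fun h g hg => ?_⟩
  · exact (mem_pointIdeal_smul_iff A).2 (Ideal.mem_comap.1 (h hg))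
  · exact Ideal.mem_comap.2 ((mem_pointIdeal_smul_iff A).1 (h hg))

lemma liesOn_pullback_iff {f : S} {d : ℕ} (hf : f.IsHomogeneous d) {p : P2} :
    LiesOn (pullback A f) p ↔ LiesOn f (A • p) :=
  (eval_smul_rep_eq_zero_iff A hf p).symm

lemma isSmoothPoint_iff {f : S} {p : P2} :
    IsSmoothPoint f p ↔ LiesOn f p ∧ ¬ IsSingularPoint f p := by
  rw [IsSmoothPoint, IsSingularPoint, not_and, not_forall]
  exact and_congr_right fun h => by simp [h]

lemma isSmoothPoint_pullback_iff {f : S} {d : ℕ} (hf : f.IsHomogeneous d) {p : P2} :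
    IsSmoothPoint (pullback A f) p ↔ IsSmoothPoint f (A • p) := by
  rw [isSmoothPoint_iff, isSmoothPoint_iff, liesOn_pullback_iff A hf,
    isSingularPoint_pullback_iff A hf]

lemma totalTjurinaNumber_pullback {f : S} {d : ℕ} (hf : f.IsHomogeneous d) :
    totalTjurinaNumber (pullback A f) = totalTjurinaNumber f := by
  refine finsum_mem_eq_of_bijOn (s := {p | IsSingularPoint (pullback A f) p})
    (t := {p | IsSingularPoint f p}) (fun p => A • p) ⟨?_, ?_, ?_⟩ ?_
  · exact fun p hp => (isSingularPoint_pullback_iff A hf).1 hp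
  · exact (MulAction.injective A).injOn
  · intro p hp
    refine ⟨A⁻¹ • p, (isSingularPoint_pullback_iff A hf).2 ?_, smul_inv_smul A p⟩
    rwa [smul_inv_smul]
  · exact fun p _ => tjurinaNumber_pullback A f p

lemma exists_syzygy_pullback {f : S} {k : ℕ}
    (h : ∃ a ∈ AR f, a ≠ 0 ∧ ∀ i, (a i).IsHomogeneous k) :
    ∃ a ∈ AR (pullback A f), a ≠ 0 ∧ ∀ i, (a i).IsHomogeneous k := by
  obtain ⟨a, ha, ha0, hk⟩ := h
  have hinv : ∀ i k, ∑ j, A (Pi.single j 1) k * A.symm (Pi.single i 1) j =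
      (Pi.single i 1 : Fin 3 → ℂ) k := by
    intro i k
    have h1 : A.symm (Pi.single i 1) = ∑ j, A.symm (Pi.single i 1) j •
        (Pi.single j 1 : Fin 3 → ℂ) := by
      ext k; simp [Finset.sum_apply, Pi.single_apply]
    have h2 := congrArg (fun v => A v k) h1
    simp only [LinearEquiv.apply_symm_apply, map_sum, map_smul, Finset.sum_apply, Pi.smul_apply,
      smul_eq_mul] at h2
    rw [h2]
    exact Finset.sum_congr rfl fun j _ => mul_comm _ _
  refine ⟨fun j => ∑ i, C (A.symm (Pi.single i 1) j) * pullback A (a i), ?_, ?_, ?_⟩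
  · have hder : ∀ i, pullback A (pderiv i f) =
        ∑ j, C (A.symm (Pi.single i 1) j) * pderiv j (pullback A f) := by
      intro i
      have := pderiv_pullback A.symm (pullback A f) i
      rw [pullback_symm_pullback] at this
      rw [this]
      simp
    have h0 : ∑ i, pullback A (a i) * pullback A (pderiv i f) = 0 := by
      have : ∑ i, a i * pderiv i f = 0 := ha
      rw [← map_zero (pullback A), ← this, map_sum]
      simp only [map_mul]
    change ∑ j, (∑ i, _) * _ = 0
    simp only [hder, Finset.mul_sum] at h0
    rw [← h0, Finset.sum_comm]
    refine Finset.sum_congr rfl fun j _ => ?_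
    rw [Finset.sum_mul]
    exact Finset.sum_congr rfl fun i _ => by ring
  · intro hb
    refine ha0 (funext fun k => ?_)
    have hb' : ∀ j, ∑ i, C (A.symm (Pi.single i 1) j) * pullback A (a i) = 0 :=
      fun j => congrFun hb j
    have h3 : pullback A (a k) = ∑ j, C (A (Pi.single j 1) k) *
        ∑ i, C (A.symm (Pi.single i 1) j) * pullback A (a i) := by
      simp only [Finset.mul_sum]
      rw [Finset.sum_comm]
      have : ∀ i, ∑ j, C (A (Pi.single j 1) k) * (C (A.symm (Pi.single i 1) j) * pullback A (a i))
          = C ((Pi.single i 1 : Fin 3 → ℂ) k) * pullback A (a i) := by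
        intro i
        rw [← hinv i k, map_sum, Finset.sum_mul]
        exact Finset.sum_congr rfl fun j _ => by rw [map_mul, mul_assoc]
      simp only [this]
      rw [Finset.sum_eq_single k]
      · simp
      · intro i _ hi; simp [Pi.single_eq_of_ne hi.symm]
      · simp
    have h4 : pullback A (a k) = 0 := by rw [h3]; simp only [hb', mul_zero, Finset.sum_const_zero]
    simpa using h4
  · intro j
    refine IsHomogeneous.sum _ _ _ fun i _ => ?_
    simpa using (isHomogeneous_C (Fin 3) _).mul ((hk i).pullback A)

lemma mdr_pullback (f : S) : mdr (pullback A f) = mdr f := by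
  have : {k | ∃ a ∈ AR (pullback A f), a ≠ 0 ∧ ∀ i, (a i).IsHomogeneous k} =
      {k | ∃ a ∈ AR f, a ≠ 0 ∧ ∀ i, (a i).IsHomogeneous k} :=
    Set.ext fun k => ⟨fun h => by simpa using exists_syzygy_pullback A.symm h,
      fun h => exists_syzygy_pullback A h⟩
  rw [mdr, mdr, this]

lemma jacobianIdeal_C_mul {c : ℂ} (hc : c ≠ 0) (f : S) :
    jacobianIdeal (C c * f) = jacobianIdeal f := by
  have key : ∀ {c : ℂ} (f : S), jacobianIdeal (C c * f) ≤ jacobianIdeal f := by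
    intro c f
    rw [jacobianIdeal, Ideal.span_le]
    rintro _ ⟨i, rfl⟩
    simp only [pderiv_C_mul]
    exact Ideal.mul_mem_left _ _ (Ideal.subset_span ⟨i, rfl⟩)
  refine le_antisymm (key f) ?_
  conv_lhs => rw [show f = C c⁻¹ * (C c * f) by rw [← mul_assoc, ← map_mul]; simp [hc]]
  exact key _

lemma AR_C_mul {c : ℂ} (hc : c ≠ 0) (f : S) : AR (C c * f) = AR f := by
  ext a
  change ∑ i, a i * pderiv i (C c * f) = 0 ↔ ∑ i, a i * pderiv i f = 0
  have : ∑ i, a i * pderiv i (C c * f) = C c * ∑ i, a i * pderiv i f := by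
    rw [Finset.mul_sum]
    exact Finset.sum_congr rfl fun i _ => by rw [pderiv_C_mul]; ring
  rw [this]
  simp [hc]

lemma mdr_C_mul {c : ℂ} (hc : c ≠ 0) (f : S) : mdr (C c * f) = mdr f := by
  rw [mdr, mdr, AR_C_mul hc]

lemma tjurinaNumber_C_mul {c : ℂ} (hc : c ≠ 0) (f : S) (p : P2) :
    tjurinaNumber (C c * f) p = tjurinaNumber f p := by
  rw [tjurinaNumber, jacobianIdeal_C_mul hc, tjurinaNumber]

lemma isSingularPoint_C_mul_iff {c : ℂ} (hc : c ≠ 0) {f : S} {p : P2} :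
    IsSingularPoint (C c * f) p ↔ IsSingularPoint f p := by
  simp [IsSingularPoint, LiesOn, hc]

lemma totalTjurinaNumber_C_mul {c : ℂ} (hc : c ≠ 0) (f : S) :
    totalTjurinaNumber (C c * f) = totalTjurinaNumber f := by
  simp only [totalTjurinaNumber, isSingularPoint_C_mul_iff hc, tjurinaNumber_C_mul hc]

lemma exists_C_mul_of_associated {f g : S} (h : Associated f g) :
    ∃ c : ℂ, c ≠ 0 ∧ g = C c * f := by
  obtain ⟨u, rfl⟩ := h
  obtain ⟨c, hc, hu⟩ := (MvPolynomial.isUnit_iff_eq_C_of_isReduced).1 u.isUnit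
  exact ⟨c, hc.ne_zero, by rw [hu, mul_comm]⟩

lemma associated_C_mul {c : ℂ} (hc : c ≠ 0) (f : S) : Associated f (C c * f) :=
  associated_unit_mul_right f _ ((isUnit_iff_ne_zero.2 hc).map C)

lemma intersectionMultiplicity_congr {f g g' : S} (h : Associated g g') (p : P2) :
    intersectionMultiplicity f g p = intersectionMultiplicity f g' p := by
  rw [intersectionMultiplicity, intersectionMultiplicity, Ideal.span_insert, Ideal.span_insert,
    Ideal.span_singleton_eq_span_singleton.2 h]

lemma tangentLine_pullback {f : S} {d : ℕ} (hf : f.IsHomogeneous d) (p : P2) :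
    Associated (tangentLine (pullback A f) p) (pullback A (tangentLine f (A • p))) := by
  obtain ⟨a, ha⟩ : ∃ a : ℂˣ, a • A p.rep = (A • p).rep := by
    conv => enter [1, a]; rw [← p.mk_rep]
    rw [Projectivization.smul_mk]
    obtain ⟨a, ha⟩ := Projectivization.exists_smul_eq_mk_rep ℂ (A • p.rep)
      ((smul_ne_zero_iff_ne A).2 p.rep_nonzero)
    exact ⟨a, by rw [← ha, p.mk_rep]; rfl⟩
  have h1 : ∀ i, eval (A • p).rep (pderiv i f) =
      (a : ℂ) ^ (d - 1) * eval (A p.rep) (pderiv i f) := fun i => by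
    rw [← ha, Units.smul_def, eval_smul_of_isHomogeneous hf.pderiv]
  have h2 : pullback A (tangentLine f (A • p)) =
      C ((a : ℂ) ^ (d - 1)) * tangentLine (pullback A f) p := by
    simp only [tangentLine, map_sum, map_mul, pullback_C, pullback_X, h1, pderiv_pullback,
      eval_C, eval_pullback]
    simp only [Finset.mul_sum, Finset.sum_mul]
    rw [Finset.sum_comm]
    refine Finset.sum_congr rfl fun j _ => Finset.sum_congr rfl fun i _ => by ring
  rw [h2]
  exact associated_C_mul (pow_ne_zero _ a.ne_zero) _

lemma IsInflectionalLine.pullback {f l : S} {d : ℕ} (hf : f.IsHomogeneous d)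
    (h : IsInflectionalLine f l) :
    IsInflectionalLine (pullback A f) (PlaneCurve.pullback A l) := by
  obtain ⟨p, ⟨hs, hi⟩, hl⟩ := h
  obtain ⟨p, rfl⟩ := MulAction.surjective A p
  refine ⟨p, ⟨(isSmoothPoint_pullback_iff A hf).2 hs, ?_⟩, ?_⟩
  · rwa [inflectionOrder, intersectionMultiplicity_congr (tangentLine_pullback A hf p),
      intersectionMultiplicity_pullback]
  · exact (hl.map (PlaneCurve.pullback A)).trans (tangentLine_pullback A hf p).symm

lemma irreducible_pullback_iff {f : S} : Irreducible (pullback A f) ↔ Irreducible f :=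
  MulEquiv.irreducible_iff (pullback A)

lemma IsHyperosculatingConic.pullback {f q : S} {d : ℕ} (hf : f.IsHomogeneous d)
    (h : IsHyperosculatingConic f q) :
    IsHyperosculatingConic (pullback A f) (PlaneCurve.pullback A q) := by
  obtain ⟨hq, hirr, p, hs, h6⟩ := h
  obtain ⟨p, rfl⟩ := MulAction.surjective A p
  refine ⟨hq.pullback A, (irreducible_pullback_iff A).2 hirr, p,
    (isSmoothPoint_pullback_iff A hf).2 hs, ?_⟩
  rwa [intersectionMultiplicity_pullback]

end Transport

/-! ### Lengths of quotients with principal maximal ideal -/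

section Length

variable {R : Type*} [CommRing R]

lemma length_quotient_le_one [IsLocalRing R] {J : Ideal R} (h : IsLocalRing.maximalIdeal R ≤ J) :
    Module.length R (R ⧸ J) ≤ 1 := by
  by_cases hJ : J = ⊤
  · have : Subsingleton (R ⧸ J) := Submodule.Quotient.subsingleton_iff.2 hJ
    simp
  · have : J = IsLocalRing.maximalIdeal R := le_antisymm (IsLocalRing.le_maximalIdeal hJ) h
    have hs : IsSimpleModule R (R ⧸ J) := by
      rw [isSimpleModule_iff_isCoatom, this]
      exact (IsLocalRing.maximalIdeal.isMaximal R).out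
    rw [Module.length_eq_one]

/-- `0 → R ⧸ (I : w) → R ⧸ I → R ⧸ (I + (w)) → 0` is exact. -/
lemma length_quotient_eq_comap_add (I : Ideal R) (w : R) :
    Module.length R (R ⧸ I) =
      Module.length R (R ⧸ (Submodule.comap (LinearMap.mulLeft R w) I : Ideal R)) +
        Module.length R (R ⧸ (I ⊔ Ideal.span {w})) := by
  refine Module.length_eq_add_of_exact
    (Submodule.mapQ (Submodule.comap (LinearMap.mulLeft R w) I) I (LinearMap.mulLeft R w) le_rfl)
    (Submodule.mapQ I (I ⊔ Ideal.span {w}) LinearMap.id le_sup_left) ?_ ?_ ?_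
  · rw [← LinearMap.ker_eq_bot, Submodule.ker_mapQ, Submodule.mkQ_map_self]
  · rw [← LinearMap.range_eq_top, Submodule.range_mapQ]
    simp
  · rw [LinearMap.exact_iff, Submodule.ker_mapQ, Submodule.range_mapQ]
    ext x
    obtain ⟨x, rfl⟩ := Submodule.mkQ_surjective _ x
    simp only [Submodule.mem_map, Submodule.mem_comap, LinearMap.mem_range, LinearMap.id_coe, id_eq]
    constructor
    · rintro ⟨y, hy, hxy⟩
      obtain ⟨a, ha, b, hb, rfl⟩ := Submodule.mem_sup.1 hy
      obtain ⟨c, rfl⟩ := Ideal.mem_span_singleton'.1 hb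
      refine ⟨w * c, ⟨c, rfl⟩, ?_⟩
      rw [← hxy, map_add, (Submodule.mkQ_apply I a).trans ((Submodule.Quotient.mk_eq_zero I).2 ha),
        zero_add, mul_comm]
    · rintro ⟨y, ⟨c, rfl⟩, hxy⟩
      exact ⟨_, Submodule.mem_sup_right (Ideal.mem_span_singleton.2 ⟨c, rfl⟩), hxy⟩

lemma length_quotient_le_of_pow_mem [IsLocalRing R] {w : R} (n : ℕ) {I : Ideal R}
    (hm : IsLocalRing.maximalIdeal R ≤ I ⊔ Ideal.span {w}) (hw : w ^ n ∈ I) :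
    Module.length R (R ⧸ I) ≤ n := by
  induction n generalizing I with
  | zero =>
    have : Subsingleton (R ⧸ I) := Submodule.Quotient.subsingleton_iff.2
      ((Ideal.eq_top_iff_one I).2 (by simpa using hw))
    simp
  | succ n ih =>
    rw [length_quotient_eq_comap_add I w, Nat.cast_add, Nat.cast_one]
    refine add_le_add (ih (hm.trans (sup_le_sup_right ?_ _)) ?_) (length_quotient_le_one hm)
    · exact fun x hx => Ideal.mul_mem_left _ _ hx
    · simpa [pow_succ'] using hw

/-- A quotient `R ⧸ I` of a local ring whose maximal ideal is generated by the class of `w` has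
length the order of nilpotency of that class. -/
lemma length_quotient_eq_of_pow_mem [IsLocalRing R] {w : R}
    (hw0 : w ∈ IsLocalRing.maximalIdeal R) (n : ℕ) {I : Ideal R}
    (hm : IsLocalRing.maximalIdeal R ≤ I ⊔ Ideal.span {w}) (hw : w ^ n ∈ I)
    (hw' : ∀ k < n, w ^ k ∉ I) :
    Module.length R (R ⧸ I) = n := by
  induction n generalizing I with
  | zero =>
    have : Subsingleton (R ⧸ I) := Submodule.Quotient.subsingleton_iff.2
      ((Ideal.eq_top_iff_one I).2 (by simpa using hw))
    simp
  | succ n ih =>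
    rw [length_quotient_eq_comap_add I w, Nat.cast_add, Nat.cast_one]
    congr 1
    · refine ih (hm.trans (sup_le_sup_right ?_ _)) ?_ fun k hk => ?_
      · exact fun x hx => Ideal.mul_mem_left _ _ hx
      · simpa [pow_succ'] using hw
      · simpa [pow_succ'] using hw' (k + 1) (by omega)
    · have hI : I ≤ IsLocalRing.maximalIdeal R := IsLocalRing.le_maximalIdeal fun h =>
        hw' 0 (Nat.succ_pos n) (by simp [h])
      refine le_antisymm (length_quotient_le_one hm) (Order.one_le_iff_pos.2 ?_)
      rw [Module.length_pos_iff, Submodule.Quotient.nontrivial_iff]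
      intro h
      refine (IsLocalRing.maximalIdeal.isMaximal R).ne_top (top_le_iff.1 ?_)
      rw [← h]
      exact sup_le hI ((Ideal.span_singleton_le_iff_mem _).2 hw0)

end Length

/-! ### Multiplicities in the local rings of the plane -/

lemma aeval_mul_of_isHomogeneous {K : Type*} [CommRing K] [Algebra ℂ K] {f : S} {d : ℕ}
    (hf : f.IsHomogeneous d) (t : K) (x : Fin 3 → K) :
    aeval (fun i => t * x i) f = t ^ d * aeval x f := by
  simp only [aeval_def, eval₂_eq, Finset.mul_sum]
  refine Finset.sum_congr rfl fun m hm => ?_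
  have hd : ∑ i, m i = d := by
    have := hf (mem_support_iff.mp hm)
    rw [← this, Finsupp.weight_apply, Finsupp.sum_fintype _ _ (by simp)]
    simp
  simp only [mul_pow, Finset.prod_mul_distrib]
  have h2 : ∏ i ∈ m.support, t ^ m i = t ^ d := by
    rw [Finset.prod_pow_eq_pow_sum, ← hd]
    congr 1
    exact Finset.sum_subset (Finset.subset_univ _) fun i _ hi => by simpa using hi
  rw [h2]; ring

/-- The extension of an ideal of `ℂ[x, y, z]` to the local ring at `p`. -/
abbrev localIdeal (I : Ideal S) (p : P2) : Ideal (LocalRingAt p) :=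
  I.map (algebraMap S (LocalRingAt p))

lemma pderiv_mem_jacobianIdeal (f : S) (i : Fin 3) : pderiv i f ∈ jacobianIdeal f :=
  Ideal.subset_span ⟨i, rfl⟩

lemma jacobianIdeal_le_iff {f : S} {I : Ideal S} :
    jacobianIdeal f ≤ I ↔ ∀ i, pderiv i f ∈ I := by
  rw [jacobianIdeal, Ideal.span_le, Set.range_subset_iff]
  rfl

lemma localIdeal_jacobianIdeal_le_iff {f : S} {p : P2} {I : Ideal (LocalRingAt p)} :
    localIdeal (jacobianIdeal f) p ≤ I ↔ ∀ i, algebraMap S (LocalRingAt p) (pderiv i f) ∈ I := by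
  rw [localIdeal, Ideal.map_le_iff_le_comap, jacobianIdeal_le_iff]
  rfl

lemma isUnit_algebraMap {p : P2} {u : S} (hu : u ∉ pointIdeal p) :
    IsUnit (algebraMap S (LocalRingAt p) u) :=
  IsLocalization.map_units (LocalRingAt p) (⟨u, hu⟩ : (pointIdeal p).primeCompl)

lemma mem_localIdeal_of_mul_mem {I : Ideal S} {p : P2} {u x : S} (hu : u ∉ pointIdeal p)
    (h : algebraMap S (LocalRingAt p) (u * x) ∈ localIdeal I p) :
    algebraMap S (LocalRingAt p) x ∈ localIdeal I p := by
  rw [map_mul] at h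
  exact ((localIdeal I p).unit_mul_mem_iff_mem (isUnit_algebraMap hu)).1 h

lemma maximalIdeal_localRingAt (p : P2) :
    IsLocalRing.maximalIdeal (LocalRingAt p) = localIdeal (pointIdeal p) p :=
  (Localization.AtPrime.map_eq_maximalIdeal).symm

lemma maximalIdeal_le_of_pointIdeal_eq_span {p : P2} {l l' : S}
    (hp : pointIdeal p = Ideal.span {l, l'}) {I : Ideal (LocalRingAt p)}
    (hl : algebraMap S (LocalRingAt p) l ∈ I) (hl' : algebraMap S (LocalRingAt p) l' ∈ I) :
    IsLocalRing.maximalIdeal (LocalRingAt p) ≤ I := by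
  rw [maximalIdeal_localRingAt, localIdeal, Ideal.map_le_iff_le_comap]
  refine hp.le.trans (Ideal.span_le.2 ?_)
  rintro x (rfl | rfl) <;> assumption

lemma localIdeal_ne_top {I : Ideal S} {p : P2} (h : I ≤ pointIdeal p) : localIdeal I p ≠ ⊤ := by
  intro ht
  refine (IsLocalRing.maximalIdeal.isMaximal (LocalRingAt p)).ne_top (top_le_iff.1 ?_)
  rw [maximalIdeal_localRingAt, ← ht]
  exact Ideal.map_mono h

/-- If `n` is a form that, modulo the forms `l` and `l'` vanishing at `p`, generates the coordinates
`x, y, z` over `ℂ`, then `l` and `l'` generate the ideal of `p`. -/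
lemma pointIdeal_eq_span {p : P2} {l l' n : S} (c : Fin 3 → ℂ)
    (hl : l ∈ pointIdeal p) (hl' : l' ∈ pointIdeal p)
    (h : ∀ i, X i - C (c i) * n ∈ Ideal.span {l, l'}) :
    pointIdeal p = Ideal.span {l, l'} := by
  have hle : Ideal.span {l, l'} ≤ pointIdeal p := by
    rw [Ideal.span_le]
    rintro x (rfl | rfl) <;> assumption
  refine le_antisymm (fun f hf => ?_) hle
  -- modulo `l, l'` the polynomial `f` is `f(c₀ n, c₁ n, c₂ n)`
  have key : ∀ f : S, f - aeval (fun i => C (c i) * n) f ∈ Ideal.span {l, l'} := by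
    intro f
    rw [← Ideal.Quotient.eq_zero_iff_mem, map_sub, sub_eq_zero]
    induction f using MvPolynomial.induction_on with
    | C a => simp
    | add p q hp hq => rw [map_add, hp, hq, map_add, map_add]
    | mul_X q i hq =>
      rw [map_mul, hq, map_mul (aeval _), map_mul, aeval_X]
      congr 1
      rw [← sub_eq_zero, ← map_sub, Ideal.Quotient.eq_zero_iff_mem]
      exact h i
  have hrep : ∀ i, p.rep i = c i * eval p.rep n := by
    intro i
    have h1 := mem_pointIdeal_iff_rep.1 (hle (h i)) 1
    simpa [sub_eq_zero] using h1
  have hn : eval p.rep n ≠ 0 := fun hn => p.rep_nonzero (funext fun i => by simp [hrep i, hn])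
  have h0 : aeval (fun i => C (c i) * n) f = 0 := by
    refine MvPolynomial.funext fun v => ?_
    have h2 := mem_pointIdeal_iff_rep.1 hf (eval v n / eval p.rep n)
    rw [map_zero, ← h2]
    have h3 : ((eval v).comp (aeval fun i => C (c i) * n : S →ₐ[ℂ] S).toRingHom) =
        eval (((eval v n / eval p.rep n) • p.rep : Fin 3 → ℂ)) := by
      refine MvPolynomial.ringHom_ext (fun a => by simp) fun i => ?_
      simp only [AlgHom.toRingHom_eq_coe, RingHom.coe_comp, RingHom.coe_coe, Function.comp_apply,
        aeval_X, map_mul, eval_C, eval_X, Pi.smul_apply, smul_eq_mul]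
      rw [hrep i]
      field_simp
    exact congrArg (fun φ : S →+* ℂ => φ f) h3
  have h1 := key f
  rwa [h0, sub_zero] at h1

lemma exists_eval_smul_ne_zero {f : S} {v : Fin 3 → ℂ} (hv : v ≠ 0)
    (hf : f ∉ pointIdeal (Projectivization.mk ℂ v hv)) : ∃ t : ℂ, t ≠ 0 ∧ eval (t • v) f ≠ 0 := by
  obtain ⟨k, hk⟩ := Function.ne_iff.1 hv
  have hX : (X k : S) ∉ pointIdeal (Projectivization.mk ℂ v hv) := fun h =>
    hk (by simpa using (mem_pointIdeal_mk_iff hv).1 h 1)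
  have := fun h => ((inferInstance : (pointIdeal (Projectivization.mk ℂ v hv)).IsPrime).mem_or_mem
    h).elim hf hX
  obtain ⟨t, ht⟩ := not_forall.1 (mt (mem_pointIdeal_mk_iff hv).2 this)
  rw [map_mul, eval_X, Pi.smul_apply, smul_eq_mul] at ht
  exact ⟨t, fun h => ht (by simp [h]), fun h => ht (by simp [h])⟩

/-- A curve germ `ε ↦ c(ε)` through `p` along which the partial derivatives of `f` vanish to
order `n`, while the linear form `w` vanishes to order one, shows that no power `w ^ k` with `k < n`
lies in the Jacobian ideal at `p`. -/
lemma pow_notMem_localIdeal_jacobianIdeal {f w : S} {d n : ℕ} (hf : f.IsHomogeneous d)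
    (hw : w.IsHomogeneous 1) {v : Fin 3 → ℂ} (hv : v ≠ 0) (c : Fin 3 → Polynomial ℂ)
    (hc : ∀ i, (c i).eval 0 = v i) {a : ℂ} (ha : a ≠ 0)
    (hcw : aeval c w = Polynomial.C a * Polynomial.X)
    (hcf : ∀ i, Polynomial.X ^ n ∣ aeval c (pderiv i f)) (k : ℕ) (hk : k < n) :
    algebraMap S (LocalRingAt (Projectivization.mk ℂ v hv)) w ^ k ∉
      localIdeal (jacobianIdeal f) (Projectivization.mk ℂ v hv) := by
  intro hmem
  rw [← map_pow, IsLocalization.algebraMap_mem_map_algebraMap_iff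
    (pointIdeal (Projectivization.mk ℂ v hv)).primeCompl] at hmem
  obtain ⟨F, hF, hFw⟩ := hmem
  obtain ⟨t, ht, hFt⟩ := exists_eval_smul_ne_zero hv hF
  let Φ : S →ₐ[ℂ] Polynomial ℂ := aeval fun i => Polynomial.C t * c i
  have hJ : ∀ x ∈ jacobianIdeal f, Polynomial.X ^ n ∣ Φ x := by
    intro x hx
    have : jacobianIdeal f ≤ (Ideal.span {(Polynomial.X : Polynomial ℂ) ^ n}).comap Φ := by
      refine jacobianIdeal_le_iff.2 fun i => Ideal.mem_comap.2 ?_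
      rw [Ideal.mem_span_singleton]
      simp only [Φ]
      rw [aeval_mul_of_isHomogeneous hf.pderiv]
      exact (hcf i).mul_left _
    exact Ideal.mem_span_singleton.1 (this hx)
  have h1 := hJ _ hFw
  have hΦw : Φ w = Polynomial.C (t * a) * Polynomial.X := by
    simp only [Φ]
    rw [aeval_mul_of_isHomogeneous hw, hcw, pow_one, ← mul_assoc, map_mul]
  rw [map_mul, map_pow, hΦw] at h1
  have h2 : Polynomial.X ^ (k + 1) ∣ Polynomial.X ^ k * (Φ F * Polynomial.C (t * a) ^ k) := by
    refine (pow_dvd_pow _ hk).trans ?_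
    rw [mul_pow] at h1
    convert h1 using 1; ring
  rw [pow_succ, mul_dvd_mul_iff_left (pow_ne_zero _ Polynomial.X_ne_zero), Polynomial.X_dvd_iff,
    Polynomial.coeff_zero_eq_eval_zero] at h2
  have hΦF : (Φ F).eval 0 = eval (t • v) F := by
    have : (Polynomial.evalRingHom (0 : ℂ)).comp Φ.toRingHom = eval (t • v) := by
      refine MvPolynomial.ringHom_ext (fun a => ?_) fun i => ?_
      · simp
      · simp [Φ, hc]
    exact congrArg (fun φ : S →+* ℂ => φ F) this
  rw [Polynomial.eval_mul, hΦF, ← map_pow, Polynomial.eval_C] at h2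
  exact mul_ne_zero hFt (pow_ne_zero _ (mul_ne_zero ht ha)) h2

lemma mem_jacobianIdeal_self {f : S} {d : ℕ} (hf : f.IsHomogeneous d) (hd : d ≠ 0) :
    f ∈ jacobianIdeal f := by
  have h1 : (d : S) * f ∈ jacobianIdeal f := by
    rw [← nsmul_eq_mul, ← hf.sum_X_mul_pderiv]
    exact Ideal.sum_mem _ fun i _ => Ideal.mul_mem_left _ _ (Ideal.subset_span ⟨i, rfl⟩)
  have h2 : f = C ((d : ℂ)⁻¹) * ((d : S) * f) := by
    rw [← mul_assoc, show ((d : ℕ) : S) = C (d : ℂ) by simp, ← map_mul,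
      inv_mul_cancel₀ (Nat.cast_ne_zero.2 hd), map_one, one_mul]
  have h3 := Ideal.mul_mem_left _ (C ((d : ℂ)⁻¹)) h1
  rwa [← h2] at h3

/-- Components that do not pass through `p` do not matter for the Tjurina number at `p`. -/
lemma tjurinaNumber_mul_of_notMem {f u : S} {d e : ℕ} (hf : f.IsHomogeneous d) (hd : d ≠ 0)
    (hu : u.IsHomogeneous e) {p : P2} (hup : u ∉ pointIdeal p) :
    tjurinaNumber (f * u) p = tjurinaNumber f p := by
  have : localIdeal (jacobianIdeal (f * u)) p = localIdeal (jacobianIdeal f) p := by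
    apply le_antisymm
    · refine Ideal.map_mono (jacobianIdeal_le_iff.2 fun i => ?_)
      rw [pderiv_mul]
      exact Ideal.add_mem _ (Ideal.mul_mem_right _ _ (pderiv_mem_jacobianIdeal f i))
        (Ideal.mul_mem_right _ _ (mem_jacobianIdeal_self hf hd))
    · have hfm : algebraMap S (LocalRingAt p) f ∈ localIdeal (jacobianIdeal (f * u)) p := by
        refine mem_localIdeal_of_mul_mem hup (Ideal.mem_map_of_mem _ ?_)
        rw [mul_comm u f]
        exact mem_jacobianIdeal_self (hf.mul hu) (by omega)
      refine localIdeal_jacobianIdeal_le_iff.2 fun i => mem_localIdeal_of_mul_mem hup ?_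
      have h1 : u * pderiv i f = pderiv i (f * u) - f * pderiv i u := by
        rw [pderiv_mul]; ring
      rw [h1, map_sub (algebraMap S _), map_mul (algebraMap S _) f]
      exact Ideal.sub_mem _ (Ideal.mem_map_of_mem _ (pderiv_mem_jacobianIdeal _ i))
        (Ideal.mul_mem_right _ _ hfm)
  exact congrArg (fun I : Ideal (LocalRingAt p) =>
    Module.length (LocalRingAt p) (LocalRingAt p ⧸ I)) this

/-- If `l, l'` generate the ideal of `p` and belong to the Jacobian ideal at `p`, then the Tjurina
number is one. -/
lemma tjurinaNumber_eq_one {f l l' : S} {p : P2} (hp : pointIdeal p = Ideal.span {l, l'})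
    (hJ : jacobianIdeal f ≤ pointIdeal p)
    (hl : algebraMap S (LocalRingAt p) l ∈ localIdeal (jacobianIdeal f) p)
    (hl' : algebraMap S (LocalRingAt p) l' ∈ localIdeal (jacobianIdeal f) p) :
    tjurinaNumber f p = 1 := by
  have hm : IsLocalRing.maximalIdeal (LocalRingAt p) ≤ localIdeal (jacobianIdeal f) p :=
    maximalIdeal_le_of_pointIdeal_eq_span hp hl hl'
  refine length_quotient_eq_of_pow_mem (w := 0) (Ideal.zero_mem _) 1 (hm.trans le_sup_left)
    (by simp) fun k hk h => localIdeal_ne_top hJ ((Ideal.eq_top_iff_one _).2 ?_)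
  obtain rfl : k = 0 := by omega
  simpa using h

/-- At a transversal intersection point of two curves, both of their equations belong to the
Jacobian ideal of the union. -/
lemma mem_localIdeal_jacobianIdeal_mul {g h : S} {p : P2} {i j : Fin 3}
    (hgrad : pderiv i g * pderiv j h - pderiv j g * pderiv i h ∉ pointIdeal p) :
    algebraMap S (LocalRingAt p) g ∈ localIdeal (jacobianIdeal (g * h)) p ∧
      algebraMap S (LocalRingAt p) h ∈ localIdeal (jacobianIdeal (g * h)) p := by
  have hd : ∀ i, pderiv i (g * h) ∈ jacobianIdeal (g * h) :=
    pderiv_mem_jacobianIdeal _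
  constructor
  · refine mem_localIdeal_of_mul_mem hgrad (Ideal.mem_map_of_mem _ ?_)
    have : (pderiv i g * pderiv j h - pderiv j g * pderiv i h) * g =
        pderiv i g * pderiv j (g * h) - pderiv j g * pderiv i (g * h) := by
      simp only [pderiv_mul]; ring
    rw [this]
    exact Ideal.sub_mem _ (Ideal.mul_mem_left _ _ (hd j)) (Ideal.mul_mem_left _ _ (hd i))
  · refine mem_localIdeal_of_mul_mem hgrad (Ideal.mem_map_of_mem _ ?_)
    have : (pderiv i g * pderiv j h - pderiv j g * pderiv i h) * h =
        pderiv j h * pderiv i (g * h) - pderiv i h * pderiv j (g * h) := by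
      simp only [pderiv_mul]; ring
    rw [this]
    exact Ideal.sub_mem _ (Ideal.mul_mem_left _ _ (hd i)) (Ideal.mul_mem_left _ _ (hd j))

lemma jacobianIdeal_mul_le {g h : S} {p : P2} (hg : g ∈ pointIdeal p) (hh : h ∈ pointIdeal p) :
    jacobianIdeal (g * h) ≤ pointIdeal p := by
  refine jacobianIdeal_le_iff.2 fun i => ?_
  rw [pderiv_mul]
  exact Ideal.add_mem _ (Ideal.mul_mem_left _ _ hh) (Ideal.mul_mem_right _ _ hg)

/-- The Tjurina number is `n` if the maximal ideal of the Jacobian quotient at `p` is generated by a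
linear form `w`, the power `w ^ n` belongs to the Jacobian ideal, and a curve germ as in
`pow_notMem_localIdeal_jacobianIdeal` exists. -/
lemma tjurinaNumber_eq {f w l l' : S} {d n : ℕ} (hf : f.IsHomogeneous d)
    (hw : w.IsHomogeneous 1) {v : Fin 3 → ℂ} (hv : v ≠ 0)
    (hp : pointIdeal (Projectivization.mk ℂ v hv) = Ideal.span {l, l'}) (c : Fin 3 → Polynomial ℂ)
    (hc : ∀ i, (c i).eval 0 = v i) {a : ℂ} (ha : a ≠ 0)
    (hcw : aeval c w = Polynomial.C a * Polynomial.X)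
    (hcf : ∀ i, Polynomial.X ^ n ∣ aeval c (pderiv i f))
    (hl : algebraMap S (LocalRingAt (Projectivization.mk ℂ v hv)) l ∈
      localIdeal (jacobianIdeal f) (Projectivization.mk ℂ v hv) ⊔ Ideal.span {algebraMap S _ w})
    (hl' : algebraMap S (LocalRingAt (Projectivization.mk ℂ v hv)) l' ∈
      localIdeal (jacobianIdeal f) (Projectivization.mk ℂ v hv) ⊔ Ideal.span {algebraMap S _ w})
    (hn : algebraMap S (LocalRingAt (Projectivization.mk ℂ v hv)) w ^ n ∈
      localIdeal (jacobianIdeal f) (Projectivization.mk ℂ v hv)) :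
    tjurinaNumber f (Projectivization.mk ℂ v hv) = n := by
  refine length_quotient_eq_of_pow_mem (w := algebraMap S _ w) ?_ n ?_ hn
    (pow_notMem_localIdeal_jacobianIdeal hf hw hv c hc ha hcw hcf)
  · rw [maximalIdeal_localRingAt]
    refine Ideal.mem_map_of_mem _ ?_
    have h0 : eval v w = 0 := by
      have : (Polynomial.evalRingHom (0 : ℂ)).comp (aeval c : S →ₐ[ℂ] Polynomial ℂ).toRingHom =
          eval v := by
        refine MvPolynomial.ringHom_ext (fun a => by simp) fun i => by simp [hc]
      have h1 := congrArg (fun φ : S →+* ℂ => φ w) this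
      simp only [RingHom.comp_apply] at h1
      rw [← h1]
      change Polynomial.eval 0 (aeval c w) = 0
      rw [hcw, Polynomial.eval_mul, Polynomial.eval_X, mul_zero]
    rw [mem_pointIdeal_mk_iff]
    intro t
    rw [eval_smul_of_isHomogeneous hw, h0, mul_zero]
  · exact maximalIdeal_le_of_pointIdeal_eq_span hp hl hl'

/-! ### Tjurina numbers of unions -/

lemma eq_mk_of_rep_eq {p : P2} {v : Fin 3 → ℂ} (hv : v ≠ 0) {t : ℂ} (h : p.rep = t • v) :
    p = Projectivization.mk ℂ v hv := by
  rw [← p.mk_rep, Projectivization.mk_eq_mk_iff']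
  exact ⟨t, h.symm⟩

lemma liesOn_mk_iff {f : S} {d : ℕ} (hf : f.IsHomogeneous d) {v : Fin 3 → ℂ} (hv : v ≠ 0) :
    LiesOn f (Projectivization.mk ℂ v hv) ↔ eval v f = 0 :=
  eval_rep_mk_eq_zero_iff hf hv

lemma liesOn_mul_iff {f g : S} {p : P2} : LiesOn (f * g) p ↔ LiesOn f p ∨ LiesOn g p := by
  simp [LiesOn]

lemma isSingularPoint_mul_iff {f g : S} {p : P2} :
    IsSingularPoint (f * g) p ↔
      IsSingularPoint f p ∨ IsSingularPoint g p ∨ (LiesOn f p ∧ LiesOn g p) := by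
  simp only [IsSingularPoint, liesOn_mul_iff, pderiv_mul, map_add, map_mul]
  constructor
  · rintro ⟨h, hd⟩
    by_cases hf : LiesOn f p <;> by_cases hg : LiesOn g p
    · exact Or.inr (Or.inr ⟨hf, hg⟩)
    · refine Or.inl ⟨hf, fun i => ?_⟩
      have hf' : eval p.rep f = 0 := hf
      have := hd i
      rw [hf', zero_mul, add_zero] at this
      exact (mul_eq_zero.1 this).resolve_right hg
    · refine Or.inr (Or.inl ⟨hg, fun i => ?_⟩)
      have hg' : eval p.rep g = 0 := hg
      have := hd i
      rw [hg', mul_zero, zero_add] at this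
      exact (mul_eq_zero.1 this).resolve_left hf
    · exact absurd h (by simp [hf, hg])
  · rintro (⟨h, hd⟩ | ⟨h, hd⟩ | ⟨h, h'⟩)
    · exact ⟨Or.inl h, fun i => by rw [hd i, show eval p.rep f = 0 from h]; ring⟩
    · exact ⟨Or.inr h, fun i => by rw [hd i, show eval p.rep g = 0 from h]; ring⟩
    · exact ⟨Or.inl h, fun i => by
        rw [show eval p.rep f = 0 from h, show eval p.rep g = 0 from h']; ring⟩

/-- Adding a smooth component `g` that avoids the singular points of `f` adds to the total Tjurina
number the contributions of the points of `f ∩ g`. -/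
lemma totalTjurinaNumber_mul {f g : S} {d e : ℕ} (hf : f.IsHomogeneous d) (hd : d ≠ 0)
    (hg : g.IsHomogeneous e) (hgs : ∀ p, ¬ IsSingularPoint g p)
    (hfin : {p | IsSingularPoint f p}.Finite) (hfg : ∀ p, LiesOn g p → ¬ IsSingularPoint f p)
    {s : Finset P2} (hs : ∀ p, LiesOn f p ∧ LiesOn g p ↔ p ∈ s) :
    {p | IsSingularPoint (f * g) p}.Finite ∧
    totalTjurinaNumber (f * g) = totalTjurinaNumber f + ∑ p ∈ s, tjurinaNumber (f * g) p := by
  have hset : {p | IsSingularPoint (f * g) p} = {p | IsSingularPoint f p} ∪ (s : Set P2) := by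
    ext p
    simp only [Set.mem_ofPred_eq, isSingularPoint_mul_iff, hgs, false_or, hs, Set.mem_union,
      Finset.mem_coe]
  refine ⟨by rw [hset]; exact hfin.union s.finite_toSet, ?_⟩
  have hdisj : Disjoint {p | IsSingularPoint f p} (s : Set P2) := by
    rw [Set.disjoint_left]
    exact fun p hp hps => hfg p ((hs p).2 hps).2 hp
  have h1 : ∀ p ∈ {p | IsSingularPoint f p}, tjurinaNumber (f * g) p = tjurinaNumber f p := by
    intro p hp
    refine tjurinaNumber_mul_of_notMem hf hd hg fun h => ?_
    have hgp : LiesOn g p := (mem_pointIdeal_iff_of_isHomogeneous hg).1 h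
    exact hfg p hgp hp
  have h2 : ∑ᶠ p ∈ {p | IsSingularPoint (f * g) p}, tjurinaNumber (f * g) p =
      ∑ᶠ p ∈ {p | IsSingularPoint f p}, tjurinaNumber f p + ∑ p ∈ s, tjurinaNumber (f * g) p := by
    rw [hset, finsum_mem_union hdisj hfin s.finite_toSet, finsum_mem_coe_finset,
      finsum_mem_congr rfl h1]
  exact h2

/-- Two curves meeting transversally at `p`, with `h, l'` generating the ideal of `p`, form a node.
-/
lemma tjurinaNumber_mul_eq_one {g h l' k m : S} {p : P2} (hg : g ∈ pointIdeal p)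
    (hp : pointIdeal p = Ideal.span {h, l'}) (hk : k ∉ pointIdeal p) (hkl : k * l' = g - h * m)
    {i j : Fin 3} (hgrad : pderiv i g * pderiv j h - pderiv j g * pderiv i h ∉ pointIdeal p) :
    tjurinaNumber (g * h) p = 1 := by
  obtain ⟨h1, h2⟩ := mem_localIdeal_jacobianIdeal_mul hgrad
  have hh : h ∈ pointIdeal p := hp ▸ Ideal.subset_span (by simp)
  refine tjurinaNumber_eq_one hp (jacobianIdeal_mul_le hg hh) h2 (mem_localIdeal_of_mul_mem hk ?_)
  rw [hkl, map_sub (algebraMap S _), map_mul (algebraMap S _) h]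
  exact Ideal.sub_mem _ h1 (Ideal.mul_mem_right _ _ h2)

/-! ### The model curves -/

@[simp] lemma pderiv_ofNat (i : Fin 3) (n : ℕ) [n.AtLeastTwo] :
    pderiv i (ofNat(n) : S) = 0 := by
  rw [← Nat.cast_ofNat (n := n)]; exact Derivation.map_natCast _ _

/-- The nodal cubic `x²(y + 4z) + 3yz² = 0`.  In these coordinates the node is `(0 : 1 : 0)`, one
hyperosculating conic touches at `(0 : 0 : 1)` and all inflectional lines are rational. -/
def modelCubic : S := X 0 ^ 2 * (X 1 + 4 * X 2) + 3 * X 1 * X 2 ^ 2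

/-- The hyperosculating conic of `modelCubic` at `(0 : 0 : 1)`. -/
def modelConic : S := 16 * X 0 ^ 2 - 3 * X 1 ^ 2 + 12 * X 1 * X 2

/-- The inflectional line of `modelCubic` at `(1 : 0 : 0)`. -/
def modelLine : S := X 1 + 4 * X 2

/-- The inflectional line of `modelCubic` at `(1 : -1 : 1)`. -/
def modelLinePos : S := 3 * X 0 + 2 * X 1 - X 2

/-- The inflectional line of `modelCubic` at `(-1 : -1 : 1)`. -/
def modelLineNeg : S := -3 * X 0 + 2 * X 1 - X 2

lemma isHomogeneous_ofNat_mul {f : S} {d : ℕ} (hf : f.IsHomogeneous d) (n : ℕ) [n.AtLeastTwo] :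
    ((OfNat.ofNat n : S) * f).IsHomogeneous d := by
  have h : (OfNat.ofNat n : S) = C (OfNat.ofNat n) := (map_ofNat C n).symm
  rw [h]
  simpa using (isHomogeneous_C (Fin 3) (OfNat.ofNat n : ℂ)).mul hf

lemma modelCubic_isHomogeneous : modelCubic.IsHomogeneous 3 := by
  refine IsHomogeneous.add ?_ ?_
  · exact (((isHomogeneous_X ℂ 0).pow 2).mul ((isHomogeneous_X ℂ 1).add
      (isHomogeneous_ofNat_mul (isHomogeneous_X ℂ 2) 4)))
  · exact (isHomogeneous_ofNat_mul (isHomogeneous_X ℂ 1) 3).mul ((isHomogeneous_X ℂ 2).pow 2)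

lemma modelConic_isHomogeneous : modelConic.IsHomogeneous 2 := by
  refine IsHomogeneous.add (IsHomogeneous.sub ?_ ?_) ?_
  · exact isHomogeneous_ofNat_mul ((isHomogeneous_X ℂ 0).pow 2) 16
  · exact isHomogeneous_ofNat_mul ((isHomogeneous_X ℂ 1).pow 2) 3
  · exact (isHomogeneous_ofNat_mul (isHomogeneous_X ℂ 1) 12).mul (isHomogeneous_X ℂ 2)

lemma modelLine_isHomogeneous : modelLine.IsHomogeneous 1 :=
  (isHomogeneous_X ℂ 1).add (isHomogeneous_ofNat_mul (isHomogeneous_X ℂ 2) 4)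

lemma modelLinePos_isHomogeneous : modelLinePos.IsHomogeneous 1 :=
  ((isHomogeneous_ofNat_mul (isHomogeneous_X ℂ 0) 3).add
    (isHomogeneous_ofNat_mul (isHomogeneous_X ℂ 1) 2)).sub (isHomogeneous_X ℂ 2)

lemma modelLineNeg_isHomogeneous : modelLineNeg.IsHomogeneous 1 := by
  rw [modelLineNeg, neg_mul]
  exact ((isHomogeneous_ofNat_mul (isHomogeneous_X ℂ 0) 3).neg.add
    (isHomogeneous_ofNat_mul (isHomogeneous_X ℂ 1) 2)).sub (isHomogeneous_X ℂ 2)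

lemma eval_modelCubic (v : Fin 3 → ℂ) :
    eval v modelCubic = v 0 ^ 2 * (v 1 + 4 * v 2) + 3 * v 1 * v 2 ^ 2 := by simp [modelCubic]

lemma eval_modelConic (v : Fin 3 → ℂ) :
    eval v modelConic = 16 * v 0 ^ 2 - 3 * v 1 ^ 2 + 12 * v 1 * v 2 := by simp [modelConic]

lemma eval_modelLine (v : Fin 3 → ℂ) : eval v modelLine = v 1 + 4 * v 2 := by simp [modelLine]

lemma eval_modelLinePos (v : Fin 3 → ℂ) :
    eval v modelLinePos = 3 * v 0 + 2 * v 1 - v 2 := by simp [modelLinePos]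

lemma eval_modelLineNeg (v : Fin 3 → ℂ) :
    eval v modelLineNeg = -3 * v 0 + 2 * v 1 - v 2 := by simp [modelLineNeg]

lemma pderiv_modelCubic : (fun i => pderiv i modelCubic) =
    ![2 * X 0 * (X 1 + 4 * X 2), X 0 ^ 2 + 3 * X 2 ^ 2, 4 * X 0 ^ 2 + 6 * X 1 * X 2] := by
  funext i
  fin_cases i <;> simp [modelCubic, pderiv_X] <;> ring

lemma pderiv_modelConic : (fun i => pderiv i modelConic) =
    ![32 * X 0, -6 * X 1 + 12 * X 2, 12 * X 1] := by
  funext i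
  fin_cases i <;> simp [modelConic, pderiv_X] <;> ring

lemma pderiv_modelLine : (fun i => pderiv i modelLine) = ![0, 1, 4] := by
  funext i
  fin_cases i <;> simp [modelLine, pderiv_X]

lemma pderiv_modelLinePos : (fun i => pderiv i modelLinePos) = ![3, 2, -1] := by
  funext i
  fin_cases i <;> simp [modelLinePos, pderiv_X]

lemma pderiv_modelLineNeg : (fun i => pderiv i modelLineNeg) = ![-3, 2, -1] := by
  funext i
  fin_cases i <;> simp [modelLineNeg, pderiv_X]

/-! ### Local Tjurina numbers of the model curves -/

lemma vec_ne_zero {v : Fin 3 → ℂ} (i : Fin 3) (h : v i ≠ 0) : v ≠ 0 := fun h0 => h (by simp [h0])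

/-- The point `(a : b : c)` of the plane, provided that one of the coordinates is nonzero. -/
abbrev point (v : Fin 3 → ℂ) (hv : v ≠ 0) : P2 := Projectivization.mk ℂ v hv

/-- The node of `modelCubic`. -/
def modelNode : P2 := point ![0, 1, 0] (vec_ne_zero 1 (by simp))

/-- The point of contact of `modelConic` and `modelCubic`. -/
def modelContact : P2 := point ![0, 0, 1] (vec_ne_zero 2 (by simp))

/-- The inflection point of `modelCubic` on `modelLine`. -/
def modelFlex : P2 := point ![1, 0, 0] (vec_ne_zero 0 (by simp))

/-- The inflection point of `modelCubic` on `modelLinePos`. -/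
def modelFlexPos : P2 := point ![1, -1, 1] (vec_ne_zero 0 (by simp))

/-- The inflection point of `modelCubic` on `modelLineNeg`. -/
def modelFlexNeg : P2 := point ![-1, -1, 1] (vec_ne_zero 0 (by simp))

lemma pderiv_modelCubic_apply (i : Fin 3) : pderiv i modelCubic =
    (![2 * X 0 * (X 1 + 4 * X 2), X 0 ^ 2 + 3 * X 2 ^ 2, 4 * X 0 ^ 2 + 6 * X 1 * X 2] :
      Fin 3 → S) i := congrFun pderiv_modelCubic i

lemma pderiv_modelConic_apply (i : Fin 3) : pderiv i modelConic =
    (![32 * X 0, -6 * X 1 + 12 * X 2, 12 * X 1] : Fin 3 → S) i := congrFun pderiv_modelConic i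

lemma pderiv_modelLine_apply (i : Fin 3) : pderiv i modelLine =
    (![0, 1, 4] : Fin 3 → S) i := congrFun pderiv_modelLine i

lemma pderiv_modelLinePos_apply (i : Fin 3) : pderiv i modelLinePos =
    (![3, 2, -1] : Fin 3 → S) i := congrFun pderiv_modelLinePos i

lemma pderiv_modelLineNeg_apply (i : Fin 3) : pderiv i modelLineNeg =
    (![-3, 2, -1] : Fin 3 → S) i := congrFun pderiv_modelLineNeg i

lemma notMem_pointIdeal {f : S} {v : Fin 3 → ℂ} (hv : v ≠ 0) (h : eval v f ≠ 0) :
    f ∉ pointIdeal (point v hv) := fun hf => h (by simpa using (mem_pointIdeal_mk_iff hv).1 hf 1)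

lemma mem_pointIdeal_of_isHomogeneous {f : S} {d : ℕ} (hf : f.IsHomogeneous d) {v : Fin 3 → ℂ}
    (hv : v ≠ 0) (h : eval v f = 0) : f ∈ pointIdeal (point v hv) := by
  rw [mem_pointIdeal_mk_iff]
  intro t
  rw [eval_smul_of_isHomogeneous hf, h, mul_zero]

lemma pointIdeal_modelNode : pointIdeal modelNode = Ideal.span {X 0, X 2} := by
  refine pointIdeal_eq_span (n := X 1) ![0, 1, 0]
    (mem_pointIdeal_of_isHomogeneous (isHomogeneous_X ℂ 0) _ (by simp))
    (mem_pointIdeal_of_isHomogeneous (isHomogeneous_X ℂ 2) _ (by simp)) fun i => ?_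
  fin_cases i
  · exact Ideal.subset_span (by simp)
  · simp
  · exact Ideal.subset_span (by simp)

lemma pointIdeal_modelContact : pointIdeal modelContact = Ideal.span {X 0, X 1} := by
  refine pointIdeal_eq_span (n := X 2) ![0, 0, 1]
    (mem_pointIdeal_of_isHomogeneous (isHomogeneous_X ℂ 0) _ (by simp))
    (mem_pointIdeal_of_isHomogeneous (isHomogeneous_X ℂ 1) _ (by simp)) fun i => ?_
  fin_cases i
  · exact Ideal.subset_span (by simp)
  · exact Ideal.subset_span (by simp)
  · simp

lemma pointIdeal_modelFlex : pointIdeal modelFlex = Ideal.span {modelLine, X 2} := by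
  refine pointIdeal_eq_span (n := X 0) ![1, 0, 0]
    (mem_pointIdeal_of_isHomogeneous modelLine_isHomogeneous _ (by simp [eval_modelLine]))
    (mem_pointIdeal_of_isHomogeneous (isHomogeneous_X ℂ 2) _ (by simp)) fun i => ?_
  fin_cases i
  · simp
  · refine Ideal.mem_span_pair.2 ⟨1, -4, ?_⟩
    simp [modelLine]
  · exact Ideal.subset_span (by simp)

/-- The node of the cubic. -/
lemma tjurinaNumber_modelCubic : tjurinaNumber modelCubic modelNode = 1 := by
  have hd := pderiv_modelCubic_apply
  have h0 : algebraMap S (LocalRingAt modelNode) (X 0) ∈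
      localIdeal (jacobianIdeal modelCubic) modelNode := by
    refine mem_localIdeal_of_mul_mem (u := 2 * (X 1 + 4 * X 2))
      (notMem_pointIdeal _ (by simp)) (Ideal.mem_map_of_mem _ ?_)
    have := pderiv_mem_jacobianIdeal modelCubic 0
    rw [hd] at this
    convert this using 1
    simp; ring
  refine tjurinaNumber_eq_one pointIdeal_modelNode (jacobianIdeal_le_iff.2 fun i =>
    mem_pointIdeal_of_isHomogeneous modelCubic_isHomogeneous.pderiv _ ?_) h0 ?_
  · rw [hd]
    fin_cases i <;> simp
  · refine mem_localIdeal_of_mul_mem (u := 6 * X 1) (notMem_pointIdeal _ (by simp)) ?_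
    have h2 := Ideal.mem_map_of_mem (algebraMap S (LocalRingAt modelNode))
      (pderiv_mem_jacobianIdeal modelCubic 2)
    rw [hd] at h2
    have h3 : (6 * X 1 * X 2 : S) = (4 * X 0 ^ 2 + 6 * X 1 * X 2) - 4 * X 0 * X 0 := by ring
    rw [h3, map_sub (algebraMap S _), map_mul (algebraMap S _) (4 * X 0)]
    exact Ideal.sub_mem _ h2 (Ideal.mul_mem_left _ _ h0)

/-- An inflectional line and the cubic form an `A₅` singularity. -/
lemma tjurinaNumber_modelCubic_mul_modelLine :
    tjurinaNumber (modelCubic * modelLine) modelFlex = 5 := by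
  have hd : ∀ i, pderiv i (modelCubic * modelLine) =
      (![2 * X 0 * modelLine ^ 2,
        2 * modelLine * (X 0 ^ 2 + 3 * X 2 ^ 2) - 12 * X 2 ^ 3,
        4 * (2 * modelLine * (X 0 ^ 2 + 3 * X 2 ^ 2) - 12 * X 2 ^ 3) + 6 * X 2 * modelLine ^ 2
          - 36 * modelLine * X 2 ^ 2] : Fin 3 → S) i := by
    intro i
    rw [pderiv_mul, pderiv_modelCubic_apply, pderiv_modelLine_apply]
    fin_cases i <;> simp [modelCubic, modelLine] <;> ring
  have hunit : ∀ {u : S}, eval ![1, 0, 0] u ≠ 0 → u ∉ pointIdeal modelFlex := fun h =>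
    notMem_pointIdeal _ h
  have hJ : ∀ i, algebraMap S (LocalRingAt modelFlex) (pderiv i (modelCubic * modelLine)) ∈
      localIdeal (jacobianIdeal (modelCubic * modelLine)) modelFlex := fun i =>
    Ideal.mem_map_of_mem _ (pderiv_mem_jacobianIdeal _ i)
  set J := localIdeal (jacobianIdeal (modelCubic * modelLine)) modelFlex with hJdef
  set φ := algebraMap S (LocalRingAt modelFlex) with hφ
  have h0 := hJ 0
  have h1 := hJ 1
  have h2 := hJ 2
  rw [hd] at h0 h1 h2
  have hLL : φ (modelLine ^ 2) ∈ J := by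
    refine mem_localIdeal_of_mul_mem (u := 2 * X 0) (hunit (by simp)) h0
  have hLz : φ (modelLine * X 2 ^ 2) ∈ J := by
    refine mem_localIdeal_of_mul_mem (u := 36) (hunit (by simp)) ?_
    have : (36 * (modelLine * X 2 ^ 2) : S) =
        4 * (2 * modelLine * (X 0 ^ 2 + 3 * X 2 ^ 2) - 12 * X 2 ^ 3) + 6 * X 2 * modelLine ^ 2
          - (4 * (2 * modelLine * (X 0 ^ 2 + 3 * X 2 ^ 2) - 12 * X 2 ^ 3) + 6 * X 2 * modelLine ^ 2
          - 36 * modelLine * X 2 ^ 2) := by ring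
    rw [this, map_sub, map_add, map_mul φ 4, map_mul φ (6 * X 2)]
    exact J.sub_mem (J.add_mem (J.mul_mem_left _ h1) (J.mul_mem_left _ hLL)) h2
  have hz : φ (X 2) ^ 5 ∈ J := by
    rw [← map_pow]
    refine mem_localIdeal_of_mul_mem (u := 12) (hunit (by simp)) ?_
    have : (12 * X 2 ^ 5 : S) = 2 * (X 0 ^ 2 + 3 * X 2 ^ 2) * (modelLine * X 2 ^ 2) -
        X 2 ^ 2 * (2 * modelLine * (X 0 ^ 2 + 3 * X 2 ^ 2) - 12 * X 2 ^ 3) := by ring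
    rw [this, map_sub, map_mul φ (2 * (X 0 ^ 2 + 3 * X 2 ^ 2)), map_mul φ (X 2 ^ 2)]
    exact J.sub_mem (J.mul_mem_left _ hLz) (J.mul_mem_left _ h1)
  have hl : φ modelLine ∈ J ⊔ Ideal.span {φ (X 2)} := by
    have hu := isUnit_algebraMap (hunit (u := 2 * (X 0 ^ 2 + 3 * X 2 ^ 2)) (by simp))
    refine (Ideal.unit_mul_mem_iff_mem _ hu).1 ?_
    rw [← map_mul]
    have : (2 * (X 0 ^ 2 + 3 * X 2 ^ 2) * modelLine : S) =
      (2 * modelLine * (X 0 ^ 2 + 3 * X 2 ^ 2) - 12 * X 2 ^ 3) + 12 * X 2 ^ 2 * X 2 := by ring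
    rw [this, map_add, map_mul _ (12 * X 2 ^ 2)]
    exact Ideal.add_mem _ (Ideal.mem_sup_left h1)
      (Ideal.mul_mem_left _ _ (Ideal.mem_sup_right (Ideal.mem_span_singleton_self _)))
  refine tjurinaNumber_eq (modelCubic_isHomogeneous.mul modelLine_isHomogeneous)
    (isHomogeneous_X ℂ 2) _ pointIdeal_modelFlex
    ![1, 6 * Polynomial.X ^ 3 - 4 * Polynomial.X, Polynomial.X] (fun i => ?_) one_ne_zero (by simp)
    (fun i => ?_) hl (Ideal.mem_sup_right (Ideal.mem_span_singleton_self _)) hz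
  · fin_cases i <;> simp
  · rw [hd]
    fin_cases i
    · exact ⟨72 * Polynomial.X, by simp [modelLine]; ring⟩
    · exact ⟨36, by simp [modelLine]; ring⟩
    · exact ⟨-72 + 216 * Polynomial.X ^ 2, by simp [modelLine]; ring⟩

/-- Relations in the Jacobian quotient at the point of contact of the cubic `E` and the conic `Q`.
They come from `16 E = Q L + 3 y³`, where `L = y + 4z`: up to units, the partial derivatives of `E
Q` are combinations of `Q²`, `Q y²` and `P = 2 Q L + 3 y³`. They force `Q ∼ y³`, then `x y⁵ = 0`
and `y ∼ x²`, hence `x¹¹ = 0`. -/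
lemma contact_relations {R : Type*} [CommRing R] {x y z q P v u : R}
    (hq : q = 16 * x ^ 2 - 3 * y ^ 2 + 12 * y * z)
    (hPdef : P = 2 * q * (y + 4 * z) + 3 * y ^ 3)
    (h0 : x * P = 0)
    (h1 : (12 * z - 6 * y) * P + q ^ 2 + 9 * q * y ^ 2 = 0)
    (h2 : 3 * y * P + q ^ 2 = 0)
    (hv : v * (12 * z - 9 * y) = 1) (hu : u * (2 * (y + 4 * z) + 9 * v * y ^ 2) = 1) :
    y * (12 * z - 3 * y + 3 * u * y ^ 2) = -16 * x ^ 2 ∧ 27 * 16 ^ 5 * x ^ 11 = 0 := by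
  have hP : P = -9 * v * q * y ^ 2 := by linear_combination v * (h1 - h2) - P * hv
  have hM : q * (2 * (y + 4 * z) + 9 * v * y ^ 2) = -3 * y ^ 3 := by
    linear_combination hP - hPdef
  have hqu : q = -3 * u * y ^ 3 := by linear_combination u * hM - q * hu
  have hxq : 9 * x * q * y ^ 2 = 0 := by
    linear_combination (12 * z - 9 * y) * x * hP - (12 * z - 9 * y) * h0 - 9 * x * q * y ^ 2 * hv
  have hxy : 27 * x * y ^ 5 = 0 := by
    linear_combination -(2 * (y + 4 * z) + 9 * v * y ^ 2) * hxq + 9 * x * y ^ 2 * hM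
  have hy : y * (12 * z - 3 * y + 3 * u * y ^ 2) = -16 * x ^ 2 := by
    linear_combination hqu - hq
  refine ⟨hy, ?_⟩
  have hy5 : (y * (12 * z - 3 * y + 3 * u * y ^ 2)) ^ 5 = (-16 * x ^ 2) ^ 5 := by rw [hy]
  linear_combination 27 * x * hy5 - (12 * z - 3 * y + 3 * u * y ^ 2) ^ 5 * hxy

lemma isUnit_add_of_mem_maximalIdeal {R : Type*} [CommRing R] [IsLocalRing R] {a b : R}
    (ha : IsUnit a) (hb : b ∈ IsLocalRing.maximalIdeal R) : IsUnit (a + b) := by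
  by_contra h
  have h1 : a + b ∈ IsLocalRing.maximalIdeal R := h
  have h2 := Ideal.sub_mem _ h1 hb
  rw [add_sub_cancel_right] at h2
  exact h2 ha

lemma pderiv_modelCubic_mul_modelConic (i : Fin 3) : pderiv i (modelCubic * modelConic) =
    (![2 * X 0 * (X 1 + 4 * X 2) * modelConic + modelCubic * (32 * X 0),
      (X 0 ^ 2 + 3 * X 2 ^ 2) * modelConic + modelCubic * (-6 * X 1 + 12 * X 2),
      (4 * X 0 ^ 2 + 6 * X 1 * X 2) * modelConic + modelCubic * (12 * X 1)] : Fin 3 → S) i := by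
  rw [pderiv_mul, pderiv_modelCubic_apply, pderiv_modelConic_apply]
  fin_cases i <;> simp

/-- In a local ring of the plane at `(0 : 0 : 1)`, the Jacobian ideal of the cubic and the conic
contains `x¹¹`, and `y` modulo `x`. -/
lemma contact_mem {R : Type*} [CommRing R] [IsLocalRing R] (ψ : S →+* R) (J : Ideal R)
    (hy : ψ (X 1) ∈ IsLocalRing.maximalIdeal R) (hz : IsUnit (ψ (X 2)))
    (hJ : ∀ i, ψ (pderiv i (modelCubic * modelConic)) ∈ J) :
    ψ (X 0) ^ 11 ∈ J ∧ ψ (X 1) ∈ J ⊔ Ideal.span {ψ (X 0)} := by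
  have hnat : ∀ n : ℕ, n ≠ 0 → IsUnit (n : R) := by
    intro n hn
    have h := ((isUnit_iff_ne_zero.2 (Nat.cast_ne_zero.2 hn : (n : ℂ) ≠ 0)).map
      (C : ℂ →+* S)).map ψ
    simpa using h
  have h0 := hJ 0
  have h1 := hJ 1
  have h2 := hJ 2
  rw [pderiv_modelCubic_mul_modelConic, ← Ideal.Quotient.eq_zero_iff_mem] at h0 h1 h2
  simp only [Fin.isValue, Matrix.cons_val_zero, Matrix.cons_val_one, Matrix.cons_val, map_add,
    map_mul, map_pow, map_neg, map_sub, map_ofNat, modelCubic, modelConic] at h0 h1 h2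
  set x := ψ (X 0)
  set y := ψ (X 1)
  set z := ψ (X 2)
  have hmul : ∀ {a : R}, a * y ∈ IsLocalRing.maximalIdeal R := fun {a} => Ideal.mul_mem_left _ a hy
  have h12 : IsUnit (12 * z) := by simpa using (hnat 12 (by norm_num)).mul hz
  have h8 : IsUnit (8 * z) := by simpa using (hnat 8 (by norm_num)).mul hz
  obtain ⟨v, hv⟩ := (isUnit_add_of_mem_maximalIdeal h12 (hmul (a := -9))).exists_left_inv
  obtain ⟨u, hu⟩ := (isUnit_add_of_mem_maximalIdeal h8
    (hmul (a := 2 + 9 * v * y))).exists_left_inv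
  have hw := isUnit_add_of_mem_maximalIdeal h12 (hmul (a := -3 + 3 * u * y))
  have hv' := congrArg (Ideal.Quotient.mk J) hv
  have hu' := congrArg (Ideal.Quotient.mk J) hu
  simp only [map_add, map_mul, map_neg, map_ofNat, map_one] at hv' hu'
  obtain ⟨k32, hk32⟩ := (hnat 32 (by norm_num)).exists_left_inv
  obtain ⟨k4, hk4⟩ := (hnat 4 (by norm_num)).exists_left_inv
  have hk32' := congrArg (Ideal.Quotient.mk J) hk32
  have hk4' := congrArg (Ideal.Quotient.mk J) hk4
  simp only [Nat.cast_ofNat, map_mul, map_ofNat, map_one] at hk32' hk4'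
  generalize hX : Ideal.Quotient.mk J x = a at *
  generalize hY : Ideal.Quotient.mk J y = b at *
  generalize hZ : Ideal.Quotient.mk J z = c at *
  have hrel := contact_relations (x := a) (y := b) (z := c) (v := Ideal.Quotient.mk J v)
    (u := Ideal.Quotient.mk J u) rfl rfl
    (by linear_combination 16 * Ideal.Quotient.mk J k32 * h0 -
      a * (2 * (16 * a ^ 2 - 3 * b ^ 2 + 12 * b * c) * (b + 4 * c) + 3 * b ^ 3) * hk32')
    (by linear_combination 16 * h1)
    (by linear_combination 16 * Ideal.Quotient.mk J k4 * h2 -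
      (3 * b * (2 * (16 * a ^ 2 - 3 * b ^ 2 + 12 * b * c) * (b + 4 * c) + 3 * b ^ 3) +
        (16 * a ^ 2 - 3 * b ^ 2 + 12 * b * c) ^ 2) * hk4')
    (by linear_combination hv') (by linear_combination hu')
  obtain ⟨hyx, hx⟩ := hrel
  constructor
  · have hN := hnat (27 * 16 ^ 5) (by norm_num)
    refine (Ideal.unit_mul_mem_iff_mem _ hN).1 ?_
    rw [← Ideal.Quotient.eq_zero_iff_mem, ← hx, map_mul, map_pow, hX, map_natCast]
    push_cast
    ring
  · refine (Ideal.mul_unit_mem_iff_mem _ hw).1 ?_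
    have h5 : y * (12 * z + (-3 + 3 * u * y) * y) + 16 * x ^ 2 ∈ J := by
      rw [← Ideal.Quotient.eq_zero_iff_mem]
      simp only [map_add, map_mul, map_neg, map_pow, map_ofNat, hX, hY, hZ]
      linear_combination hyx
    have h6 := Ideal.sub_mem _ (Ideal.mem_sup_left h5 : _ ∈ J ⊔ Ideal.span {x})
      (Ideal.mul_mem_left _ (16 * x) (Ideal.mem_sup_right (Ideal.mem_span_singleton_self x)))
    convert h6 using 1
    ring

lemma aeval_modelCubic {K : Type*} [CommRing K] [Algebra ℂ K] (c : Fin 3 → K) :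
    aeval c modelCubic = c 0 ^ 2 * (c 1 + 4 * c 2) + 3 * c 1 * c 2 ^ 2 := by simp [modelCubic]

lemma aeval_modelConic {K : Type*} [CommRing K] [Algebra ℂ K] (c : Fin 3 → K) :
    aeval c modelConic = 16 * c 0 ^ 2 - 3 * c 1 ^ 2 + 12 * c 1 * c 2 := by simp [modelConic]

/-- The germ of the polar curve `∂f/∂y = 0` of the cubic and the conic, to order eleven in the
parameter `x = 3 ε`. -/
def contactGerm : Fin 3 → Polynomial ℂ :=
  ![3 * Polynomial.X, -12 * Polynomial.X ^ 2 + 36 * Polynomial.X ^ 4 - 162 * Polynomial.X ^ 6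
      + 972 * Polynomial.X ^ 8 - 7290 * Polynomial.X ^ 10, 1]

lemma pow_eleven_dvd_aeval_contactGerm (i : Fin 3) :
    Polynomial.X ^ 11 ∣ aeval contactGerm (pderiv i (modelCubic * modelConic)) := by
  rw [pderiv_modelCubic_mul_modelConic]
  have h0 : contactGerm 0 = 3 * Polynomial.X := rfl
  have h1 : contactGerm 1 = -12 * Polynomial.X ^ 2 + 36 * Polynomial.X ^ 4 -
    162 * Polynomial.X ^ 6 + 972 * Polynomial.X ^ 8 - 7290 * Polynomial.X ^ 10 := rfl
  have h2 : contactGerm 2 = 1 := rfl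
  fin_cases i
  · refine ⟨-419904 - 28553472 * Polynomial.X ^ 2 + 130380192 * Polynomial.X ^ 4
      - 663238368 * Polynomial.X ^ 6 + 3341701008 * Polynomial.X ^ 8
      - 16989105888 * Polynomial.X ^ 10 + 80583461712 * Polynomial.X ^ 12
      - 243816627744 * Polynomial.X ^ 14 + 836828256240 * Polynomial.X ^ 16
      - 2789427520800 * Polynomial.X ^ 18 + 6973568802000 * Polynomial.X ^ 20, ?_⟩
    simp only [Fin.zero_eta, Fin.isValue, Matrix.cons_val_zero, map_add, map_mul, map_ofNat,
      aeval_X, aeval_modelCubic, aeval_modelConic, h0, h1, h2]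
    ring
  · refine ⟨-4487724 * Polynomial.X + 708588 * Polynomial.X ^ 3 - 21257640 * Polynomial.X ^ 5
      + 114791256 * Polynomial.X ^ 7 - 286978140 * Polynomial.X ^ 9
      - 4304672100 * Polynomial.X ^ 11, ?_⟩
    simp only [Fin.mk_one, Fin.isValue, Matrix.cons_val_one, Matrix.cons_val_zero, map_add,
      map_neg, map_pow, map_mul, map_ofNat, aeval_X, aeval_modelCubic, aeval_modelConic, h0, h1, h2]
    ring
  · refine ⟨734832 * Polynomial.X + 39680928 * Polynomial.X ^ 3 - 306110016 * Polynomial.X ^ 5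
      + 1811150928 * Polynomial.X ^ 7 - 11249543088 * Polynomial.X ^ 9
      + 80583461712 * Polynomial.X ^ 11 - 243816627744 * Polynomial.X ^ 13
      + 836828256240 * Polynomial.X ^ 15 - 2789427520800 * Polynomial.X ^ 17
      + 6973568802000 * Polynomial.X ^ 19, ?_⟩
    simp only [Fin.reduceFinMk, Fin.isValue, Matrix.cons_val, map_add, map_pow, map_mul, map_ofNat,
      aeval_X, aeval_modelCubic, aeval_modelConic, h0, h1, h2]
    ring

/-- The hyperosculating conic and the cubic form an `A₁₁` singularity. -/
lemma tjurinaNumber_modelCubic_mul_modelConic :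
    tjurinaNumber (modelCubic * modelConic) modelContact = 11 := by
  have hmem := contact_mem (algebraMap S (LocalRingAt modelContact))
    (localIdeal (jacobianIdeal (modelCubic * modelConic)) modelContact)
    (by
      rw [maximalIdeal_localRingAt]
      exact Ideal.mem_map_of_mem _
        (mem_pointIdeal_of_isHomogeneous (isHomogeneous_X ℂ 1) _ (by simp)))
    (isUnit_algebraMap (notMem_pointIdeal _ (by simp)))
    fun i => Ideal.mem_map_of_mem _ (pderiv_mem_jacobianIdeal _ i)
  refine tjurinaNumber_eq (modelCubic_isHomogeneous.mul modelConic_isHomogeneous)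
    (isHomogeneous_X ℂ 0) _ pointIdeal_modelContact contactGerm (fun i => ?_)
    (three_ne_zero : (3 : ℂ) ≠ 0) ?_ pow_eleven_dvd_aeval_contactGerm
    (Ideal.mem_sup_right (Ideal.mem_span_singleton_self _)) hmem.2 hmem.1
  · fin_cases i <;> simp [contactGerm]
  · rw [aeval_X, map_ofNat]
    rfl

/-! ### Symmetries of the model -/

/-- The linear automorphism of `ℂ³` given by an invertible matrix. -/
def linAut (M : Matrix (Fin 3) (Fin 3) ℂ) (h : M.det ≠ 0) : (Fin 3 → ℂ) ≃ₗ[ℂ] (Fin 3 → ℂ) :=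
  LinearMap.equivOfDetNeZero (Matrix.toLin' M) (by rwa [LinearMap.det_toLin'])

@[simp] lemma linAut_apply (M : Matrix (Fin 3) (Fin 3) ℂ) (h : M.det ≠ 0) (v : Fin 3 → ℂ) :
    linAut M h v = M.mulVec v := rfl

/-- The automorphism of order three of `modelCubic`, which permutes the inflectional lines. -/
def modelRotation : (Fin 3 → ℂ) ≃ₗ[ℂ] (Fin 3 → ℂ) :=
  linAut !![-1/2, 0, -3/2; -1/2, 1, 3/2; 1/2, 0, -1/2]
    (by rw [Matrix.det_fin_three]; simp; norm_num)

/-- The reflection `(x : y : z) ↦ (-x : y : z)`. -/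
def modelReflection : (Fin 3 → ℂ) ≃ₗ[ℂ] (Fin 3 → ℂ) :=
  linAut !![-1, 0, 0; 0, 1, 0; 0, 0, 1] (by rw [Matrix.det_fin_three]; simp)

lemma modelRotation_apply (v : Fin 3 → ℂ) : modelRotation v =
    ![-(v 0 + 3 * v 2) / 2, v 1 + (3 * v 2 - v 0) / 2, (v 0 - v 2) / 2] := by
  ext i
  fin_cases i <;> simp [modelRotation, Matrix.mulVec, dotProduct, Fin.sum_univ_three] <;> ring

lemma modelReflection_apply (v : Fin 3 → ℂ) : modelReflection v = ![-v 0, v 1, v 2] := by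
  ext i
  fin_cases i <;> simp [modelReflection, Matrix.mulVec, dotProduct, Fin.sum_univ_three]

lemma pullback_modelRotation_modelCubic : pullback modelRotation modelCubic = modelCubic := by
  refine MvPolynomial.funext fun v => ?_
  simp only [eval_pullback, eval_modelCubic, modelRotation_apply, Matrix.cons_val_zero,
    Matrix.cons_val_one, Matrix.cons_val]
  ring

lemma pullback_modelRotation_modelLine :
    pullback modelRotation modelLine = C (1 / 2) * modelLinePos := by
  refine MvPolynomial.funext fun v => ?_
  simp only [eval_pullback, eval_modelLine, modelRotation_apply, Matrix.cons_val_zero,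
    Matrix.cons_val_one, Matrix.cons_val, map_mul, eval_C, eval_modelLinePos]
  ring

lemma pullback_modelReflection_modelCubic : pullback modelReflection modelCubic = modelCubic := by
  refine MvPolynomial.funext fun v => ?_
  simp only [eval_pullback, eval_modelCubic, modelReflection_apply, Matrix.cons_val_zero,
    Matrix.cons_val_one, Matrix.cons_val]
  ring

lemma pullback_modelReflection_modelConic : pullback modelReflection modelConic = modelConic := by
  refine MvPolynomial.funext fun v => ?_
  simp only [eval_pullback, eval_modelConic, modelReflection_apply, Matrix.cons_val_zero,
    Matrix.cons_val_one, Matrix.cons_val]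
  ring

lemma pullback_modelReflection_modelLinePos :
    pullback modelReflection modelLinePos = modelLineNeg := by
  refine MvPolynomial.funext fun v => ?_
  simp only [eval_pullback, eval_modelLinePos, modelReflection_apply, Matrix.cons_val_zero,
    Matrix.cons_val_one, Matrix.cons_val, eval_modelLineNeg]
  ring

lemma tjurinaNumber_modelCubic_mul_modelLinePos :
    tjurinaNumber (modelCubic * modelLinePos) modelFlexPos = 5 := by
  have h1 : pullback modelRotation (modelCubic * modelLine) =
      C (1 / 2) * (modelCubic * modelLinePos) := by
    rw [map_mul, pullback_modelRotation_modelCubic, pullback_modelRotation_modelLine]; ring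
  have h2 : modelRotation • modelFlexPos = modelFlex := by
    rw [modelFlexPos, modelFlex, Projectivization.smul_mk, Projectivization.mk_eq_mk_iff']
    refine ⟨-2, ?_⟩
    rw [LinearEquiv.smul_def, modelRotation_apply]
    ext i
    fin_cases i <;> simp <;> norm_num
  rw [← tjurinaNumber_C_mul (c := 1 / 2) (by norm_num), ← h1, tjurinaNumber_pullback, h2,
    tjurinaNumber_modelCubic_mul_modelLine]

lemma tjurinaNumber_modelCubic_mul_modelLineNeg :
    tjurinaNumber (modelCubic * modelLineNeg) modelFlexNeg = 5 := by
  have h1 : pullback modelReflection (modelCubic * modelLinePos) = modelCubic * modelLineNeg := by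
    rw [map_mul, pullback_modelReflection_modelCubic, pullback_modelReflection_modelLinePos]
  have h2 : modelReflection • modelFlexNeg = modelFlexPos := by
    rw [modelFlexPos, modelFlexNeg, Projectivization.smul_mk, Projectivization.mk_eq_mk_iff']
    refine ⟨1, ?_⟩
    rw [LinearEquiv.smul_def, modelReflection_apply]
    ext i
    fin_cases i <;> simp
  rw [← h1, tjurinaNumber_pullback, h2, tjurinaNumber_modelCubic_mul_modelLinePos]

/-! ### Nodes of the model arrangements -/

/-- The points of `modelConic` on `modelLine`, for `r² = 6`. -/
def conicLinePoint (r : ℂ) : P2 := point ![r, -4, 1] (vec_ne_zero 1 (by simp))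

/-- The points of `modelConic` on `modelLinePos`, for `r² = -3`. -/
def conicLinePosPoint (r : ℂ) : P2 := point ![9 + r, -8, 11 + 3 * r] (vec_ne_zero 1 (by simp))

/-- The points of `modelConic` on `modelLineNeg`, for `r² = -3`. -/
def conicLineNegPoint (r : ℂ) : P2 := point ![-(9 + r), -8, 11 + 3 * r] (vec_ne_zero 1 (by simp))

/-- The intersection point of `modelLine` and `modelLinePos`. -/
def lineLinePosPoint : P2 := point ![3, -4, 1] (vec_ne_zero 0 (by simp))

/-- The intersection point of `modelLinePos` and `modelLineNeg`. -/
def linePosLineNegPoint : P2 := point ![0, 1, 2] (vec_ne_zero 1 (by simp))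

lemma tjurinaNumber_modelConic_mul_modelLine {r : ℂ} (hr : r ^ 2 = 6) :
    tjurinaNumber (modelConic * modelLine) (conicLinePoint r) = 1 := by
  have hr0 : r ≠ 0 := by rintro rfl; norm_num at hr
  have hC : (C r : S) ^ 2 = 6 := by rw [← map_pow, hr, map_ofNat]
  refine tjurinaNumber_mul_eq_one (l' := X 0 - C r * X 2) (k := 16 * (X 0 + C r * X 2))
    (m := -3 * (X 1 - 8 * X 2)) (i := 0) (j := 1)
    (mem_pointIdeal_of_isHomogeneous modelConic_isHomogeneous _ ?_)
    (pointIdeal_eq_span (n := X 2) ![r, -4, 1]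
      (mem_pointIdeal_of_isHomogeneous modelLine_isHomogeneous _ ?_)
      (mem_pointIdeal_of_isHomogeneous (d := 1) ?_ _ ?_) fun i => ?_)
    (notMem_pointIdeal _ ?_) ?_ (notMem_pointIdeal _ ?_)
  · simp [eval_modelConic]; linear_combination 16 * hr
  · simp [eval_modelLine]
  · exact (isHomogeneous_X ℂ 0).sub
      (by simpa using (isHomogeneous_C (Fin 3) r).mul (isHomogeneous_X ℂ 2))
  · simp
  · fin_cases i
    · exact Ideal.subset_span (by simp)
    · refine Ideal.subset_span (Or.inl (MvPolynomial.funext fun v => ?_))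
      simp [modelLine]
    · simp
  · simpa using hr0
  · simp only [modelConic, modelLine]
    linear_combination (-16 * X 2 ^ 2) * hC
  · rw [pderiv_modelConic_apply, pderiv_modelConic_apply, pderiv_modelLine_apply,
      pderiv_modelLine_apply]
    simpa using hr0

lemma tjurinaNumber_modelConic_mul_modelLinePos {r : ℂ} (hr : r ^ 2 = -3) :
    tjurinaNumber (modelConic * modelLinePos) (conicLinePosPoint r) = 1 := by
  have hr0 : r ≠ 0 := by rintro rfl; norm_num at hr
  have hC : (C r : S) ^ 2 = -3 := by rw [← map_pow, hr, map_neg, map_ofNat]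
  have h4 : (C (1 / 4) : S) * 4 = 1 := by
    rw [show (4 : S) = C 4 from (map_ofNat C 4).symm, ← map_mul]; norm_num
  refine tjurinaNumber_mul_eq_one (l' := 8 * X 0 + 9 * X 1 + C r * X 1)
    (k := C (1 / 4) * (8 * X 0 + 9 * X 1 - C r * X 1))
    (m := -12 * X 1) (i := 0) (j := 2)
    (mem_pointIdeal_of_isHomogeneous modelConic_isHomogeneous _ ?_)
    (pointIdeal_eq_span (n := X 1) ![-(9 + r) / 8, 1, -(11 + 3 * r) / 8]
      (mem_pointIdeal_of_isHomogeneous modelLinePos_isHomogeneous _ ?_)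
      (mem_pointIdeal_of_isHomogeneous (d := 1) ?_ _ ?_) fun i => ?_)
    (notMem_pointIdeal _ ?_) ?_ (notMem_pointIdeal _ ?_)
  · simp [eval_modelConic]; linear_combination 16 * hr
  · simp [eval_modelLinePos]; ring
  · exact ((isHomogeneous_ofNat_mul (isHomogeneous_X ℂ 0) 8).add
      (isHomogeneous_ofNat_mul (isHomogeneous_X ℂ 1) 9)).add
      (by simpa using (isHomogeneous_C (Fin 3) r).mul (isHomogeneous_X ℂ 1))
  · simp; ring
  · rw [Ideal.mem_span_pair]
    fin_cases i
    · refine ⟨0, C (1 / 8), MvPolynomial.funext fun v => ?_⟩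
      simp; ring
    · exact ⟨0, 0, by simp⟩
    · refine ⟨-1, C (3 / 8), MvPolynomial.funext fun v => ?_⟩
      simp [modelLinePos]; ring
  · simp only [map_mul, map_add, map_sub, map_ofNat, eval_C, eval_X, Matrix.cons_val_zero,
      Matrix.cons_val_one]
    intro h
    exact hr0 (by linear_combination h / 4)
  · simp only [modelConic, modelLinePos]
    linear_combination (-C (1 / 4) * X 1 ^ 2) * hC +
      (16 * X 0 ^ 2 + 36 * X 0 * X 1 + 21 * X 1 ^ 2) * h4
  · rw [pderiv_modelConic_apply, pderiv_modelConic_apply, pderiv_modelLinePos_apply,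
      pderiv_modelLinePos_apply]
    simp
    intro h
    exact hr0 (by linear_combination -h / 32)

lemma tjurinaNumber_modelConic_mul_modelLineNeg {r : ℂ} (hr : r ^ 2 = -3) :
    tjurinaNumber (modelConic * modelLineNeg) (conicLineNegPoint r) = 1 := by
  have h1 : pullback modelReflection (modelConic * modelLinePos) = modelConic * modelLineNeg := by
    rw [map_mul, pullback_modelReflection_modelConic, pullback_modelReflection_modelLinePos]
  have h2 : modelReflection • conicLineNegPoint r = conicLinePosPoint r := by
    rw [conicLineNegPoint, conicLinePosPoint, Projectivization.smul_mk,
      Projectivization.mk_eq_mk_iff']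
    refine ⟨1, ?_⟩
    rw [LinearEquiv.smul_def, modelReflection_apply]
    ext i
    fin_cases i <;> simp
  rw [← h1, tjurinaNumber_pullback, h2, tjurinaNumber_modelConic_mul_modelLinePos hr]

lemma tjurinaNumber_modelLine_mul_modelLinePos :
    tjurinaNumber (modelLine * modelLinePos) lineLinePosPoint = 1 := by
  refine tjurinaNumber_mul_eq_one (l' := X 0 - 3 * X 2) (k := C (-3 / 2))
    (m := C (1 / 2)) (i := 0) (j := 1)
    (mem_pointIdeal_of_isHomogeneous modelLine_isHomogeneous _ ?_)
    (pointIdeal_eq_span (n := X 2) ![3, -4, 1]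
      (mem_pointIdeal_of_isHomogeneous modelLinePos_isHomogeneous _ ?_)
      (mem_pointIdeal_of_isHomogeneous (d := 1) ?_ _ ?_) fun i => ?_)
    (notMem_pointIdeal _ ?_) ?_ (notMem_pointIdeal _ ?_)
  · simp [eval_modelLine]
  · simp [eval_modelLinePos]; norm_num
  · exact (isHomogeneous_X ℂ 0).sub (isHomogeneous_ofNat_mul (isHomogeneous_X ℂ 2) 3)
  · simp
  · rw [Ideal.mem_span_pair]
    fin_cases i
    · refine ⟨0, 1, MvPolynomial.funext fun v => ?_⟩
      simp
    · refine ⟨C (1 / 2), C (-3 / 2), MvPolynomial.funext fun v => ?_⟩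
      simp [modelLinePos]; ring
    · exact ⟨0, 0, by simp⟩
  · simp
  · refine MvPolynomial.funext fun v => ?_
    simp [modelLine, modelLinePos]; ring
  · rw [pderiv_modelLine_apply, pderiv_modelLine_apply, pderiv_modelLinePos_apply,
      pderiv_modelLinePos_apply]
    simp

lemma tjurinaNumber_modelLinePos_mul_modelLineNeg :
    tjurinaNumber (modelLinePos * modelLineNeg) linePosLineNegPoint = 1 := by
  refine tjurinaNumber_mul_eq_one (l' := X 0) (k := 6)
    (m := 1) (i := 0) (j := 1)
    (mem_pointIdeal_of_isHomogeneous modelLinePos_isHomogeneous _ ?_)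
    (pointIdeal_eq_span (n := X 1) ![0, 1, 2]
      (mem_pointIdeal_of_isHomogeneous modelLineNeg_isHomogeneous _ ?_)
      (mem_pointIdeal_of_isHomogeneous (isHomogeneous_X ℂ 0) _ ?_) fun i => ?_)
    (notMem_pointIdeal _ ?_) ?_ (notMem_pointIdeal _ ?_)
  · simp [eval_modelLinePos]
  · simp [eval_modelLineNeg]
  · simp
  · rw [Ideal.mem_span_pair]
    fin_cases i
    · exact ⟨0, 1, by simp⟩
    · exact ⟨0, 0, by simp⟩
    · refine ⟨-1, -3, MvPolynomial.funext fun v => ?_⟩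
      simp [modelLineNeg]
      ring
  · simp
  · simp [modelLinePos, modelLineNeg]; ring
  · rw [pderiv_modelLinePos_apply, pderiv_modelLinePos_apply, pderiv_modelLineNeg_apply,
      pderiv_modelLineNeg_apply]
    simp; norm_num

/-! ### Total Tjurina numbers of the model arrangements -/

lemma rep_eq_zero_elim {p : P2} (h0 : p.rep 0 = 0) (h1 : p.rep 1 = 0) (h2 : p.rep 2 = 0) :
    False :=
  p.rep_nonzero (by ext i; fin_cases i <;> assumption)

lemma isSingularPoint_modelCubic_iff {p : P2} :
    IsSingularPoint modelCubic p ↔ p.rep 0 = 0 ∧ p.rep 2 = 0 := by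
  simp only [IsSingularPoint, LiesOn, pderiv_modelCubic_apply, Fin.forall_fin_succ, eval_modelCubic]
  simp only [Fin.isValue, Matrix.cons_val_zero, map_mul, map_ofNat, eval_X, map_add,
    Matrix.cons_val_succ, map_pow, IsEmpty.forall_iff, and_true]
  constructor
  · rintro ⟨-, h0, h1, h2⟩
    have hx : p.rep 0 = 0 := by
      by_contra hx
      have hy : p.rep 1 + 4 * p.rep 2 = 0 := by
        have := mul_ne_zero (two_ne_zero : (2 : ℂ) ≠ 0) hx
        exact (mul_eq_zero.1 h0).resolve_left this
      have hx2 : p.rep 0 ^ 2 = 0 := by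
        linear_combination (2 / 3) * h1 + (1 / 12) * h2 - (1 / 2) * p.rep 2 * hy
      exact hx (pow_eq_zero_iff two_ne_zero |>.1 hx2)
    rw [hx] at h1
    exact ⟨hx, pow_eq_zero_iff two_ne_zero |>.1 (by linear_combination h1 / 3)⟩
  · rintro ⟨hx, hz⟩
    simp [hx, hz]

lemma liesOn_modelCubic_modelConic_iff {p : P2} :
    LiesOn modelCubic p ∧ LiesOn modelConic p ↔ p.rep 0 = 0 ∧ p.rep 1 = 0 := by
  rw [LiesOn, LiesOn, eval_modelCubic, eval_modelConic]
  constructor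
  · rintro ⟨h1, h2⟩
    have hy : p.rep 1 = 0 := by
      refine pow_eq_zero_iff three_ne_zero |>.1 ?_
      linear_combination (16 / 3) * h1 - (p.rep 1 + 4 * p.rep 2) / 3 * h2
    rw [hy] at h2
    exact ⟨pow_eq_zero_iff two_ne_zero |>.1 (by linear_combination h2 / 16), hy⟩
  · rintro ⟨hx, hy⟩
    simp [hx, hy]

lemma liesOn_modelCubic_modelLine_iff {p : P2} :
    LiesOn modelCubic p ∧ LiesOn modelLine p ↔ p.rep 1 = 0 ∧ p.rep 2 = 0 := by
  rw [LiesOn, LiesOn, eval_modelCubic, eval_modelLine]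
  constructor
  · rintro ⟨h1, h2⟩
    have hz : p.rep 2 = 0 := by
      refine pow_eq_zero_iff three_ne_zero |>.1 ?_
      linear_combination (-1 / 12) * h1 + (p.rep 0 ^ 2 + 3 * p.rep 2 ^ 2) / 12 * h2
    rw [hz] at h2
    exact ⟨by linear_combination h2, hz⟩
  · rintro ⟨hx, hy⟩
    simp [hx, hy]

lemma liesOn_modelCubic_modelLinePos_iff {p : P2} :
    LiesOn modelCubic p ∧ LiesOn modelLinePos p ↔ p.rep 1 = -p.rep 0 ∧ p.rep 2 = p.rep 0 := by
  rw [LiesOn, LiesOn, eval_modelCubic, eval_modelLinePos]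
  constructor
  · rintro ⟨h1, h2⟩
    have hz : p.rep 2 = 3 * p.rep 0 + 2 * p.rep 1 := by linear_combination -h2
    have hxy : p.rep 0 + p.rep 1 = 0 := by
      refine pow_eq_zero_iff three_ne_zero |>.1 ?_
      rw [hz] at h1
      linear_combination h1 / 12
    exact ⟨by linear_combination hxy, by linear_combination hz + 2 * hxy⟩
  · rintro ⟨hy, hz⟩
    rw [hy, hz]
    constructor <;> ring

lemma liesOn_modelCubic_modelLineNeg_iff {p : P2} :
    LiesOn modelCubic p ∧ LiesOn modelLineNeg p ↔ p.rep 1 = p.rep 0 ∧ p.rep 2 = -p.rep 0 := by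
  rw [LiesOn, LiesOn, eval_modelCubic, eval_modelLineNeg]
  constructor
  · rintro ⟨h1, h2⟩
    have hz : p.rep 2 = -3 * p.rep 0 + 2 * p.rep 1 := by linear_combination -h2
    have hxy : p.rep 1 - p.rep 0 = 0 := by
      refine pow_eq_zero_iff three_ne_zero |>.1 ?_
      rw [hz] at h1
      linear_combination h1 / 12
    exact ⟨by linear_combination hxy, by linear_combination hz + 2 * hxy⟩
  · rintro ⟨hy, hz⟩
    rw [hy, hz]
    constructor <;> ring

lemma liesOn_modelConic_modelLine_iff {r : ℂ} (hr : r ^ 2 = 6) {p : P2} :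
    LiesOn modelConic p ∧ LiesOn modelLine p ↔
      p = conicLinePoint r ∨ p = conicLinePoint (-r) := by
  constructor
  · rintro ⟨h1, h2⟩
    rw [LiesOn, eval_modelConic] at h1
    rw [LiesOn, eval_modelLine] at h2
    have hy : p.rep 1 = -4 * p.rep 2 := by linear_combination h2
    have h : (p.rep 0 - r * p.rep 2) * (p.rep 0 + r * p.rep 2) = 0 := by
      rw [hy] at h1
      linear_combination h1 / 16 - p.rep 2 ^ 2 * hr
    rcases mul_eq_zero.1 h with h | h
    · refine Or.inl (eq_mk_of_rep_eq _ (t := p.rep 2) ?_)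
      ext i
      fin_cases i <;> simp [hy, mul_comm]
      linear_combination h
    · refine Or.inr (eq_mk_of_rep_eq _ (t := p.rep 2) ?_)
      ext i
      fin_cases i <;> simp [hy, mul_comm]
      linear_combination h
  · rintro (rfl | rfl) <;> rw [conicLinePoint, liesOn_mk_iff modelConic_isHomogeneous,
      liesOn_mk_iff modelLine_isHomogeneous, eval_modelConic, eval_modelLine] <;> simp <;>
      linear_combination 16 * hr

lemma liesOn_modelConic_modelLinePos_iff {r : ℂ} (hr : r ^ 2 = -3) {p : P2} :
    LiesOn modelConic p ∧ LiesOn modelLinePos p ↔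
      p = conicLinePosPoint r ∨ p = conicLinePosPoint (-r) := by
  constructor
  · rintro ⟨h1, h2⟩
    rw [LiesOn, eval_modelConic] at h1
    rw [LiesOn, eval_modelLinePos] at h2
    have hz : p.rep 2 = 3 * p.rep 0 + 2 * p.rep 1 := by linear_combination -h2
    have h : (8 * p.rep 0 + 9 * p.rep 1 + r * p.rep 1) *
        (8 * p.rep 0 + 9 * p.rep 1 - r * p.rep 1) = 0 := by
      rw [hz] at h1
      linear_combination 4 * h1 - p.rep 1 ^ 2 * hr
    rcases mul_eq_zero.1 h with h | h
    · refine Or.inl (eq_mk_of_rep_eq _ (t := -p.rep 1 / 8) ?_)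
      ext i
      fin_cases i <;> simp [hz]
      · linear_combination h / 8
      · linear_combination 3 * h / 8
    · refine Or.inr (eq_mk_of_rep_eq _ (t := -p.rep 1 / 8) ?_)
      ext i
      fin_cases i <;> simp [hz]
      · linear_combination h / 8
      · linear_combination 3 * h / 8
  · rintro (rfl | rfl) <;> rw [conicLinePosPoint, liesOn_mk_iff modelConic_isHomogeneous,
      liesOn_mk_iff modelLinePos_isHomogeneous, eval_modelConic, eval_modelLinePos] <;> simp <;>
      constructor <;> first | linear_combination 16 * hr | ring

lemma liesOn_modelConic_modelLineNeg_iff {r : ℂ} (hr : r ^ 2 = -3) {p : P2} :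
    LiesOn modelConic p ∧ LiesOn modelLineNeg p ↔
      p = conicLineNegPoint r ∨ p = conicLineNegPoint (-r) := by
  constructor
  · rintro ⟨h1, h2⟩
    rw [LiesOn, eval_modelConic] at h1
    rw [LiesOn, eval_modelLineNeg] at h2
    have hz : p.rep 2 = -3 * p.rep 0 + 2 * p.rep 1 := by linear_combination -h2
    have h : (-8 * p.rep 0 + 9 * p.rep 1 + r * p.rep 1) *
        (-8 * p.rep 0 + 9 * p.rep 1 - r * p.rep 1) = 0 := by
      rw [hz] at h1
      linear_combination 4 * h1 - p.rep 1 ^ 2 * hr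
    rcases mul_eq_zero.1 h with h | h
    · refine Or.inl (eq_mk_of_rep_eq _ (t := -p.rep 1 / 8) ?_)
      ext i
      fin_cases i <;> simp [hz]
      · linear_combination -h / 8
      · linear_combination 3 * h / 8
    · refine Or.inr (eq_mk_of_rep_eq _ (t := -p.rep 1 / 8) ?_)
      ext i
      fin_cases i <;> simp [hz]
      · linear_combination -h / 8
      · linear_combination 3 * h / 8
  · rintro (rfl | rfl) <;> rw [conicLineNegPoint, liesOn_mk_iff modelConic_isHomogeneous,
      liesOn_mk_iff modelLineNeg_isHomogeneous, eval_modelConic, eval_modelLineNeg] <;> simp <;>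
      constructor <;> first | linear_combination 16 * hr | ring

lemma liesOn_modelLine_modelLinePos_iff {p : P2} :
    LiesOn modelLine p ∧ LiesOn modelLinePos p ↔ p = lineLinePosPoint := by
  constructor
  · rintro ⟨h1, h2⟩
    rw [LiesOn, eval_modelLine] at h1
    rw [LiesOn, eval_modelLinePos] at h2
    refine eq_mk_of_rep_eq _ (t := p.rep 2) ?_
    ext i
    fin_cases i <;> simp
    · linear_combination h2 / 3 - 2 / 3 * h1
    · linear_combination h1
  · rintro rfl
    rw [lineLinePosPoint, liesOn_mk_iff modelLine_isHomogeneous,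
      liesOn_mk_iff modelLinePos_isHomogeneous, eval_modelLine, eval_modelLinePos]
    simp; norm_num

lemma liesOn_modelLinePos_modelLineNeg_iff {p : P2} :
    LiesOn modelLinePos p ∧ LiesOn modelLineNeg p ↔ p = linePosLineNegPoint := by
  constructor
  · rintro ⟨h1, h2⟩
    rw [LiesOn, eval_modelLinePos] at h1
    rw [LiesOn, eval_modelLineNeg] at h2
    refine eq_mk_of_rep_eq _ (t := p.rep 1) ?_
    ext i
    fin_cases i <;> simp
    · linear_combination h1 / 6 - h2 / 6
    · linear_combination -h1 / 2 - h2 / 2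
  · rintro rfl
    rw [linePosLineNegPoint, liesOn_mk_iff modelLinePos_isHomogeneous,
      liesOn_mk_iff modelLineNeg_isHomogeneous, eval_modelLinePos, eval_modelLineNeg]
    simp

lemma eq_modelContact_iff {p : P2} : p = modelContact ↔ p.rep 0 = 0 ∧ p.rep 1 = 0 := by
  constructor
  · rintro rfl
    have h0 := (eval_rep_mk_eq_zero_iff (isHomogeneous_X ℂ 0) (v := ![0, 0, 1])
      (vec_ne_zero 2 (by simp))).2 (by simp)
    have h1 := (eval_rep_mk_eq_zero_iff (isHomogeneous_X ℂ 1) (v := ![0, 0, 1])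
      (vec_ne_zero 2 (by simp))).2 (by simp)
    rw [eval_X] at h0 h1
    exact ⟨h0, h1⟩
  · rintro ⟨h0, h1⟩
    refine eq_mk_of_rep_eq _ (t := p.rep 2) ?_
    ext i
    fin_cases i <;> simp [h0, h1]

lemma eq_modelNode_iff {p : P2} : p = modelNode ↔ p.rep 0 = 0 ∧ p.rep 2 = 0 := by
  constructor
  · rintro rfl
    have h0 := (eval_rep_mk_eq_zero_iff (isHomogeneous_X ℂ 0) (v := ![0, 1, 0])
      (vec_ne_zero 1 (by simp))).2 (by simp)
    have h1 := (eval_rep_mk_eq_zero_iff (isHomogeneous_X ℂ 2) (v := ![0, 1, 0])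
      (vec_ne_zero 1 (by simp))).2 (by simp)
    rw [eval_X] at h0 h1
    exact ⟨h0, h1⟩
  · rintro ⟨h0, h1⟩
    refine eq_mk_of_rep_eq _ (t := p.rep 1) ?_
    ext i
    fin_cases i <;> simp [h0, h1]

lemma liesOn_modelCubic_modelLine_iff_eq {p : P2} :
    LiesOn modelCubic p ∧ LiesOn modelLine p ↔ p = modelFlex := by
  constructor
  · intro h
    obtain ⟨h1, h2⟩ := liesOn_modelCubic_modelLine_iff.1 h
    refine eq_mk_of_rep_eq _ (t := p.rep 0) ?_
    ext i
    fin_cases i <;> simp [h1, h2]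
  · rintro rfl
    rw [modelFlex, liesOn_mk_iff modelCubic_isHomogeneous, liesOn_mk_iff modelLine_isHomogeneous,
      eval_modelCubic, eval_modelLine]
    simp

lemma liesOn_modelCubic_modelLinePos_iff_eq {p : P2} :
    LiesOn modelCubic p ∧ LiesOn modelLinePos p ↔ p = modelFlexPos := by
  constructor
  · intro h
    obtain ⟨h1, h2⟩ := liesOn_modelCubic_modelLinePos_iff.1 h
    refine eq_mk_of_rep_eq _ (t := p.rep 0) ?_
    ext i
    fin_cases i <;> simp [h1, h2]
  · rintro rfl
    rw [modelFlexPos, liesOn_mk_iff modelCubic_isHomogeneous,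
      liesOn_mk_iff modelLinePos_isHomogeneous, eval_modelCubic, eval_modelLinePos]
    simp; norm_num

lemma liesOn_modelCubic_modelLineNeg_iff_eq {p : P2} :
    LiesOn modelCubic p ∧ LiesOn modelLineNeg p ↔ p = modelFlexNeg := by
  constructor
  · intro h
    obtain ⟨h1, h2⟩ := liesOn_modelCubic_modelLineNeg_iff.1 h
    refine eq_mk_of_rep_eq _ (t := -p.rep 0) ?_
    ext i
    fin_cases i <;> simp [h1, h2]
  · rintro rfl
    rw [modelFlexNeg, liesOn_mk_iff modelCubic_isHomogeneous,
      liesOn_mk_iff modelLineNeg_isHomogeneous, eval_modelCubic, eval_modelLineNeg]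
    simp; norm_num

lemma not_isSingularPoint_modelConic (p : P2) : ¬ IsSingularPoint modelConic p := by
  rintro ⟨-, h⟩
  have h0 := h 0
  have h1 := h 1
  have h2 := h 2
  rw [pderiv_modelConic_apply] at h0 h1 h2
  simp only [Matrix.cons_val_zero, Matrix.cons_val_one, Matrix.cons_val, map_mul, map_add,
    map_neg, map_ofNat, eval_X] at h0 h1 h2
  exact rep_eq_zero_elim (by linear_combination h0 / 32) (by linear_combination h2 / 12)
    (by linear_combination h1 / 12 + h2 / 24)

lemma not_isSingularPoint_modelLine (p : P2) : ¬ IsSingularPoint modelLine p := by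
  rintro ⟨-, h⟩
  simpa [pderiv_modelLine_apply] using h 1

lemma not_isSingularPoint_modelLinePos (p : P2) : ¬ IsSingularPoint modelLinePos p := by
  rintro ⟨-, h⟩
  simpa [pderiv_modelLinePos_apply] using h 1

lemma not_isSingularPoint_modelLineNeg (p : P2) : ¬ IsSingularPoint modelLineNeg p := by
  rintro ⟨-, h⟩
  simpa [pderiv_modelLineNeg_apply] using h 1

lemma totalTjurinaNumber_modelCubic :
    {p | IsSingularPoint modelCubic p}.Finite ∧ totalTjurinaNumber modelCubic = 1 := by
  have hset : {p | IsSingularPoint modelCubic p} = {modelNode} := by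
    ext p
    rw [Set.mem_ofPred_eq, isSingularPoint_modelCubic_iff, Set.mem_singleton_iff, eq_modelNode_iff]
  refine ⟨hset ▸ Set.finite_singleton _, ?_⟩
  have h : ∑ᶠ p ∈ {p | IsSingularPoint modelCubic p}, tjurinaNumber modelCubic p = 1 := by
    rw [hset, finsum_mem_singleton, tjurinaNumber_modelCubic]
  exact h

lemma totalTjurinaNumber_modelCubic_mul_modelConic :
    {p | IsSingularPoint (modelCubic * modelConic) p}.Finite ∧
      totalTjurinaNumber (modelCubic * modelConic) = 12 := by
  obtain ⟨hfin, htot⟩ := totalTjurinaNumber_modelCubic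
  obtain ⟨hfin', htot'⟩ := totalTjurinaNumber_mul modelCubic_isHomogeneous three_ne_zero
    modelConic_isHomogeneous not_isSingularPoint_modelConic hfin
    (fun p hp hs => by
      obtain ⟨h0, h2⟩ := isSingularPoint_modelCubic_iff.1 hs
      rw [LiesOn, eval_modelConic, h0, h2] at hp
      have h1 : p.rep 1 = 0 := pow_eq_zero_iff two_ne_zero |>.1 (by linear_combination -hp / 3)
      exact rep_eq_zero_elim h0 h1 h2)
    (s := {modelContact})
    (fun p => by rw [liesOn_modelCubic_modelConic_iff, Finset.mem_singleton, eq_modelContact_iff])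
  refine ⟨hfin', ?_⟩
  rw [htot', htot, Finset.sum_singleton, tjurinaNumber_modelCubic_mul_modelConic]
  norm_num

lemma not_liesOn {f : S} {d : ℕ} (hf : f.IsHomogeneous d) {v : Fin 3 → ℂ} (hv : v ≠ 0)
    (h : eval v f ≠ 0) : ¬ LiesOn f (point v hv) := fun h' => h ((liesOn_mk_iff hf hv).1 h')

/-- Singular points of the cubic and the conic do not lie on a line that avoids the node and the
point of contact. -/
lemma not_isSingularPoint_modelCubic_mul_modelConic {l : S} (hl : l.IsHomogeneous 1)
    (h1 : eval ![0, 1, 0] l ≠ 0) (h2 : eval ![0, 0, 1] l ≠ 0) (p : P2) (hp : LiesOn l p) :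
    ¬ IsSingularPoint (modelCubic * modelConic) p := by
  rw [isSingularPoint_mul_iff]
  rintro (hs | hs | hs)
  · rw [isSingularPoint_modelCubic_iff, ← eq_modelNode_iff] at hs
    subst hs
    exact not_liesOn hl _ h1 hp
  · exact not_isSingularPoint_modelConic p hs
  · rw [liesOn_modelCubic_modelConic_iff, ← eq_modelContact_iff] at hs
    subst hs
    exact not_liesOn hl _ h2 hp

/-- Adding an inflectional line that meets the conic transversally adds `5 + 1 + 1`. -/
lemma totalTjurinaNumber_modelCubic_mul_modelConic_mul {l : S} (hl : l.IsHomogeneous 1)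
    (hls : ∀ p, ¬ IsSingularPoint l p) (h1 : eval ![0, 1, 0] l ≠ 0) (h2 : eval ![0, 0, 1] l ≠ 0)
    {q a b : P2} (hq : ∀ {p}, LiesOn modelCubic p ∧ LiesOn l p ↔ p = q)
    (hab : ∀ {p}, LiesOn modelConic p ∧ LiesOn l p ↔ p = a ∨ p = b) (hne : a ≠ b)
    (hqc : ¬ LiesOn modelConic q) (hq5 : tjurinaNumber (modelCubic * l) q = 5)
    (ha : tjurinaNumber (modelConic * l) a = 1) (hb : tjurinaNumber (modelConic * l) b = 1) :
    {p | IsSingularPoint (modelCubic * modelConic * l) p}.Finite ∧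
      totalTjurinaNumber (modelCubic * modelConic * l) = 19 := by
  have hqa : q ≠ a := by rintro rfl; exact hqc (hab.2 (Or.inl rfl)).1
  have hqb : q ≠ b := by rintro rfl; exact hqc (hab.2 (Or.inr rfl)).1
  have hac : ¬ LiesOn modelCubic a := fun h =>
    hqa (hq.1 ⟨h, (hab.2 (Or.inl rfl)).2⟩).symm
  have hbc : ¬ LiesOn modelCubic b := fun h =>
    hqb (hq.1 ⟨h, (hab.2 (Or.inr rfl)).2⟩).symm
  classical
  obtain ⟨hfin, htot⟩ := totalTjurinaNumber_modelCubic_mul_modelConic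
  obtain ⟨hfin', htot'⟩ := totalTjurinaNumber_mul
    (modelCubic_isHomogeneous.mul modelConic_isHomogeneous) (by norm_num) hl hls hfin
    (not_isSingularPoint_modelCubic_mul_modelConic hl h1 h2) (s := {q, a, b})
    (fun p => by
      rw [liesOn_mul_iff, or_and_right, hq, hab]
      simp)
  refine ⟨hfin', ?_⟩
  have e1 : modelCubic * modelConic * l = (modelCubic * l) * modelConic := by ring
  have e2 : modelCubic * modelConic * l = (modelConic * l) * modelCubic := by ring
  have hC := fun {p : P2} (h : ¬ LiesOn modelConic p) =>
    mt (mem_pointIdeal_iff_of_isHomogeneous modelConic_isHomogeneous).1 h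
  have hE := fun {p : P2} (h : ¬ LiesOn modelCubic p) =>
    mt (mem_pointIdeal_iff_of_isHomogeneous modelCubic_isHomogeneous).1 h
  have t1 : tjurinaNumber (modelCubic * modelConic * l) q = 5 := by
    rw [e1, tjurinaNumber_mul_of_notMem (modelCubic_isHomogeneous.mul hl) (by norm_num)
      modelConic_isHomogeneous (hC hqc), hq5]
  have t2 : tjurinaNumber (modelCubic * modelConic * l) a = 1 := by
    rw [e2, tjurinaNumber_mul_of_notMem (modelConic_isHomogeneous.mul hl) (by norm_num)
      modelCubic_isHomogeneous (hE hac), ha]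
  have t3 : tjurinaNumber (modelCubic * modelConic * l) b = 1 := by
    rw [e2, tjurinaNumber_mul_of_notMem (modelConic_isHomogeneous.mul hl) (by norm_num)
      modelCubic_isHomogeneous (hE hbc), hb]
  rw [htot', htot, Finset.sum_insert (by simp [hqa, hqb]), Finset.sum_pair hne, t1, t2, t3]
  norm_num

/-- Adding a second inflectional line adds `5 + 1 + 1 + 1`. -/
lemma totalTjurinaNumber_modelCubic_mul_modelConic_mul_mul {k l : S} (hk : k.IsHomogeneous 1)
    (hks : ∀ p, ¬ IsSingularPoint k p)
    (hl : l.IsHomogeneous 1)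
    (hls : ∀ p, ¬ IsSingularPoint l p) (h1 : eval ![0, 1, 0] l ≠ 0) (h2 : eval ![0, 0, 1] l ≠ 0)
    {q a b o : P2} (hq : ∀ {p}, LiesOn modelCubic p ∧ LiesOn l p ↔ p = q)
    (hab : ∀ {p}, LiesOn modelConic p ∧ LiesOn l p ↔ p = a ∨ p = b) (hne : a ≠ b)
    (ho : ∀ {p}, LiesOn k p ∧ LiesOn l p ↔ p = o)
    (hqc : ¬ LiesOn modelConic q) (hqk : ¬ LiesOn k q) (hoc : ¬ LiesOn modelConic o)
    (hq5 : tjurinaNumber (modelCubic * l) q = 5)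
    (ha : tjurinaNumber (modelConic * l) a = 1) (hb : tjurinaNumber (modelConic * l) b = 1)
    (ho1 : tjurinaNumber (k * l) o = 1)
    (hfin : {p | IsSingularPoint (modelCubic * modelConic * k) p}.Finite)
    (htot : totalTjurinaNumber (modelCubic * modelConic * k) = 19) :
    totalTjurinaNumber (modelCubic * modelConic * k * l) = 27 := by
  have hla := (hab.2 (Or.inl (rfl : a = a))).2
  have hlb := (hab.2 (Or.inr (rfl : b = b))).2
  have hqa : q ≠ a := by rintro rfl; exact hqc (hab.2 (Or.inl rfl)).1
  have hqb : q ≠ b := by rintro rfl; exact hqc (hab.2 (Or.inr rfl)).1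
  have hqo : q ≠ o := by rintro rfl; exact hqk (ho.2 rfl).1
  have hao : a ≠ o := by rintro rfl; exact hoc (hab.2 (Or.inl rfl)).1
  have hbo : b ≠ o := by rintro rfl; exact hoc (hab.2 (Or.inr rfl)).1
  have hac : ¬ LiesOn modelCubic a := fun h => hqa (hq.1 ⟨h, hla⟩).symm
  have hbc : ¬ LiesOn modelCubic b := fun h => hqb (hq.1 ⟨h, hlb⟩).symm
  have hak : ¬ LiesOn k a := fun h => hao (ho.1 ⟨h, hla⟩)
  have hbk : ¬ LiesOn k b := fun h => hbo (ho.1 ⟨h, hlb⟩)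
  have hoE : ¬ LiesOn modelCubic o := fun h => hqo (hq.1 ⟨h, (ho.2 rfl).2⟩).symm
  classical
  obtain ⟨hfin', htot'⟩ := totalTjurinaNumber_mul
    ((modelCubic_isHomogeneous.mul modelConic_isHomogeneous).mul hk) (by norm_num) hl hls hfin
    (fun p hp hs => by
      rw [isSingularPoint_mul_iff, liesOn_mul_iff] at hs
      rcases hs with hs | hs | ⟨hs | hs, hpk⟩
      · exact not_isSingularPoint_modelCubic_mul_modelConic hl h1 h2 p hp hs
      · exact hks p hs
      · obtain rfl := hq.1 ⟨hs, hp⟩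
        exact hqk hpk
      · obtain rfl := ho.1 ⟨hpk, hp⟩
        exact hoc hs) (s := {q, a, b, o})
    (fun p => by
      rw [liesOn_mul_iff, liesOn_mul_iff, or_and_right, or_and_right, hq, hab, ho]
      simp [or_assoc])
  have e1 : modelCubic * modelConic * k * l = (modelCubic * l) * (modelConic * k) := by ring
  have e2 : modelCubic * modelConic * k * l = (modelConic * l) * (modelCubic * k) := by ring
  have e3 : modelCubic * modelConic * k * l = (k * l) * (modelCubic * modelConic) := by ring
  have hmem : ∀ {f g : S} {d e : ℕ} {p : P2}, f.IsHomogeneous d → g.IsHomogeneous e →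
      ¬ LiesOn f p → ¬ LiesOn g p → f * g ∉ pointIdeal p := by
    intro f g d e p hf hg hfp hgp h
    rw [mem_pointIdeal_iff_of_isHomogeneous (hf.mul hg)] at h
    exact (liesOn_mul_iff.1 h).elim hfp hgp
  have t1 : tjurinaNumber (modelCubic * modelConic * k * l) q = 5 := by
    rw [e1, tjurinaNumber_mul_of_notMem (modelCubic_isHomogeneous.mul hl) (by norm_num)
      (modelConic_isHomogeneous.mul hk) (hmem modelConic_isHomogeneous hk hqc hqk), hq5]
  have t2 : tjurinaNumber (modelCubic * modelConic * k * l) a = 1 := by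
    rw [e2, tjurinaNumber_mul_of_notMem (modelConic_isHomogeneous.mul hl) (by norm_num)
      (modelCubic_isHomogeneous.mul hk) (hmem modelCubic_isHomogeneous hk hac hak), ha]
  have t3 : tjurinaNumber (modelCubic * modelConic * k * l) b = 1 := by
    rw [e2, tjurinaNumber_mul_of_notMem (modelConic_isHomogeneous.mul hl) (by norm_num)
      (modelCubic_isHomogeneous.mul hk) (hmem modelCubic_isHomogeneous hk hbc hbk), hb]
  have t4 : tjurinaNumber (modelCubic * modelConic * k * l) o = 1 := by
    rw [e3, tjurinaNumber_mul_of_notMem (hk.mul hl) (by norm_num)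
      (modelCubic_isHomogeneous.mul modelConic_isHomogeneous)
      (hmem modelCubic_isHomogeneous modelConic_isHomogeneous hoE hoc), ho1]
  rw [htot', htot, Finset.sum_insert (by simp [hqa, hqb, hqo]),
    Finset.sum_insert (by simp [hne, hao]), Finset.sum_pair hbo, t1, t2, t3, t4]
  norm_num

lemma conicLinePoint_ne_neg {r : ℂ} (hr : r ^ 2 = 6) : conicLinePoint r ≠ conicLinePoint (-r) := by
  intro h
  rw [conicLinePoint, conicLinePoint, Projectivization.mk_eq_mk_iff'] at h
  obtain ⟨a, ha⟩ := h
  have h0 := congrFun ha 0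
  have h2 := congrFun ha 2
  simp at h0 h2
  rw [h2] at h0
  have : r = 0 := by linear_combination -h0 / 2
  rw [this] at hr
  norm_num at hr

lemma conicLinePosPoint_ne_neg {r : ℂ} (hr : r ^ 2 = -3) :
    conicLinePosPoint r ≠ conicLinePosPoint (-r) := by
  intro h
  rw [conicLinePosPoint, conicLinePosPoint, Projectivization.mk_eq_mk_iff'] at h
  obtain ⟨a, ha⟩ := h
  have h0 := congrFun ha 0
  have h1 := congrFun ha 1
  simp at h0 h1
  rw [h1] at h0
  have : r = 0 := by linear_combination -h0 / 2
  rw [this] at hr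
  norm_num at hr

lemma conicLineNegPoint_ne_neg {r : ℂ} (hr : r ^ 2 = -3) :
    conicLineNegPoint r ≠ conicLineNegPoint (-r) := by
  intro h
  rw [conicLineNegPoint, conicLineNegPoint, Projectivization.mk_eq_mk_iff'] at h
  obtain ⟨a, ha⟩ := h
  have h0 := congrFun ha 0
  have h1 := congrFun ha 1
  simp at h0 h1
  rw [h1] at h0
  have : r = 0 := by linear_combination h0 / 2
  rw [this] at hr
  norm_num at hr

lemma totalTjurinaNumber_modelLine :
    {p | IsSingularPoint (modelCubic * modelConic * modelLine) p}.Finite ∧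
      totalTjurinaNumber (modelCubic * modelConic * modelLine) = 19 := by
  obtain ⟨r, hr⟩ := IsAlgClosed.exists_pow_nat_eq (6 : ℂ) two_pos
  exact totalTjurinaNumber_modelCubic_mul_modelConic_mul modelLine_isHomogeneous
    not_isSingularPoint_modelLine (by simp [eval_modelLine]) (by simp [eval_modelLine])
    liesOn_modelCubic_modelLine_iff_eq (liesOn_modelConic_modelLine_iff hr)
    (conicLinePoint_ne_neg hr)
    (not_liesOn modelConic_isHomogeneous _ (by simp [eval_modelConic]))
    tjurinaNumber_modelCubic_mul_modelLine (tjurinaNumber_modelConic_mul_modelLine hr)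
    (tjurinaNumber_modelConic_mul_modelLine (by rwa [neg_sq]))

lemma totalTjurinaNumber_modelLinePos :
    {p | IsSingularPoint (modelCubic * modelConic * modelLinePos) p}.Finite ∧
      totalTjurinaNumber (modelCubic * modelConic * modelLinePos) = 19 := by
  obtain ⟨r, hr⟩ := IsAlgClosed.exists_pow_nat_eq (-3 : ℂ) two_pos
  exact totalTjurinaNumber_modelCubic_mul_modelConic_mul modelLinePos_isHomogeneous
    not_isSingularPoint_modelLinePos (by simp [eval_modelLinePos]) (by simp [eval_modelLinePos])
    liesOn_modelCubic_modelLinePos_iff_eq (liesOn_modelConic_modelLinePos_iff hr)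
    (conicLinePosPoint_ne_neg hr)
    (not_liesOn modelConic_isHomogeneous _ (by simp [eval_modelConic]; norm_num))
    tjurinaNumber_modelCubic_mul_modelLinePos (tjurinaNumber_modelConic_mul_modelLinePos hr)
    (tjurinaNumber_modelConic_mul_modelLinePos (by rwa [neg_sq]))

lemma totalTjurinaNumber_modelLine_modelLinePos :
    totalTjurinaNumber (modelCubic * modelConic * modelLine * modelLinePos) = 27 := by
  obtain ⟨r, hr⟩ := IsAlgClosed.exists_pow_nat_eq (-3 : ℂ) two_pos
  exact totalTjurinaNumber_modelCubic_mul_modelConic_mul_mul modelLine_isHomogeneous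
    not_isSingularPoint_modelLine modelLinePos_isHomogeneous
    not_isSingularPoint_modelLinePos (by simp [eval_modelLinePos]) (by simp [eval_modelLinePos])
    liesOn_modelCubic_modelLinePos_iff_eq (liesOn_modelConic_modelLinePos_iff hr)
    (conicLinePosPoint_ne_neg hr) liesOn_modelLine_modelLinePos_iff
    (not_liesOn modelConic_isHomogeneous _ (by simp [eval_modelConic]; norm_num))
    (not_liesOn modelLine_isHomogeneous _ (by simp [eval_modelLine]; norm_num))
    (not_liesOn modelConic_isHomogeneous _ (by simp [eval_modelConic]; norm_num))
    tjurinaNumber_modelCubic_mul_modelLinePos (tjurinaNumber_modelConic_mul_modelLinePos hr)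
    (tjurinaNumber_modelConic_mul_modelLinePos (by rwa [neg_sq]))
    tjurinaNumber_modelLine_mul_modelLinePos
    totalTjurinaNumber_modelLine.1 totalTjurinaNumber_modelLine.2

lemma totalTjurinaNumber_modelLinePos_modelLineNeg :
    totalTjurinaNumber (modelCubic * modelConic * modelLinePos * modelLineNeg) = 27 := by
  obtain ⟨r, hr⟩ := IsAlgClosed.exists_pow_nat_eq (-3 : ℂ) two_pos
  exact totalTjurinaNumber_modelCubic_mul_modelConic_mul_mul modelLinePos_isHomogeneous
    not_isSingularPoint_modelLinePos modelLineNeg_isHomogeneous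
    not_isSingularPoint_modelLineNeg (by simp [eval_modelLineNeg]) (by simp [eval_modelLineNeg])
    liesOn_modelCubic_modelLineNeg_iff_eq (liesOn_modelConic_modelLineNeg_iff hr)
    (conicLineNegPoint_ne_neg hr) liesOn_modelLinePos_modelLineNeg_iff
    (not_liesOn modelConic_isHomogeneous _ (by simp [eval_modelConic]; norm_num))
    (not_liesOn modelLinePos_isHomogeneous _ (by simp [eval_modelLinePos]; norm_num))
    (not_liesOn modelConic_isHomogeneous _ (by simp [eval_modelConic]; norm_num))
    tjurinaNumber_modelCubic_mul_modelLineNeg (tjurinaNumber_modelConic_mul_modelLineNeg hr)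
    (tjurinaNumber_modelConic_mul_modelLineNeg (by rwa [neg_sq]))
    tjurinaNumber_modelLinePos_mul_modelLineNeg
    totalTjurinaNumber_modelLinePos.1 totalTjurinaNumber_modelLinePos.2

/-! ### The minimal degree of a Jacobian syzygy -/

lemma eq_zero_of_dvd_pderiv {g : S} {i : Fin 3} (h : g ∣ pderiv i g) : pderiv i g = 0 := by
  classical
  by_contra h0
  obtain ⟨k, hk⟩ := h
  have hg : g ≠ 0 := by rintro rfl; simp at h0
  have hk0 : k ≠ 0 := by rintro rfl; simp [hk] at h0
  have hdeg : g.degreeOf i ≤ (pderiv i g).degreeOf i := by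
    rw [hk, degreeOf_mul_eq hg hk0]; omega
  have hne : (pderiv i g).support.Nonempty := support_nonempty.2 h0
  -- a monomial of top degree in `X i` of the derivative comes from one of higher degree
  obtain ⟨m, hm, hmax⟩ := Finset.exists_mem_eq_sup _ hne (fun m => m i)
  rw [← degreeOf_eq_sup] at hmax
  rw [mem_support_iff, coeff_pderiv] at hm
  have hm' : m + Finsupp.single i 1 ∈ g.support := by
    rw [mem_support_iff]; exact left_ne_zero_of_mul hm
  have := monomial_le_degreeOf i hm'
  simp at this
  omega

lemma eq_C_of_pderiv_eq_zero {g : S} (h : ∀ i, pderiv i g = 0) : g = C (coeff 0 g) := by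
  ext m
  rw [coeff_C]
  split_ifs with hm
  · rw [hm]
  · obtain ⟨i, hi⟩ : ∃ i, m i ≠ 0 := by
      by_contra! hc
      exact hm (Finsupp.ext fun i => (hc i).symm)
    have h1 := congrArg (coeff (m - Finsupp.single i 1)) (h i)
    rw [coeff_pderiv, coeff_zero, tsub_add_cancel_of_le
      (Finsupp.single_le_iff.2 (Nat.one_le_iff_ne_zero.2 hi))] at h1
    refine (mul_eq_zero.1 h1).resolve_right ?_
    exact Nat.cast_add_one_ne_zero _

/-- The partial derivatives of a squarefree form have no common factor: by Euler's formula such a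
prime factor `g` divides `f = g h`, hence `h ∂g`, hence `∂g` as `f` is squarefree, which is absurd.
-/
lemma not_forall_dvd_pderiv {f : S} {d : ℕ} (hf : f.IsHomogeneous d) (hd : d ≠ 0)
    (hsq : Squarefree f) {g : S} (hg : Prime g) : ¬ ∀ i, g ∣ pderiv i f := by
  intro h
  have hgf : g ∣ f := by
    have h1 : g ∣ C (d : ℂ) * f := by
      have := hf.sum_X_mul_pderiv
      rw [nsmul_eq_mul, ← map_natCast (C : ℂ →+* S)] at this
      rw [← this]
      exact Finset.dvd_sum fun i _ => (h i).mul_left _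
    have hu : IsUnit (C (d : ℂ) : S) := (IsUnit.mk0 _ (Nat.cast_ne_zero.2 hd)).map C
    exact hu.dvd_mul_left.1 h1
  obtain ⟨k, rfl⟩ := hgf
  by_cases hk : g ∣ k
  · exact hg.not_isUnit (hsq g (mul_dvd_mul_left g hk))
  · have h0 : ∀ i, pderiv i g = 0 := by
      intro i
      apply eq_zero_of_dvd_pderiv
      have h1 := h i
      rw [pderiv_mul, dvd_add_left (dvd_mul_right _ _)] at h1
      exact (hg.dvd_or_dvd h1).resolve_right hk
    have h1 := eq_C_of_pderiv_eq_zero h0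
    refine hg.not_isUnit ?_
    rw [h1]
    refine (IsUnit.mk0 _ fun h2 => hg.ne_zero ?_).map C
    rw [h1, h2, C_0]

/-- If `w ≠ 0` has no common prime factor and `v` is proportional to `w`, then `w j` divides `v j`.
-/
lemma dvd_of_proportional {R : Type*} [CommRing R] [IsDomain R] [UniqueFactorizationMonoid R]
    {v w : Fin 3 → R} (h0 : w ≠ 0) (hw : ∀ g, Prime g → ¬ ∀ i, g ∣ w i)
    (h : ∀ i j, v i * w j = v j * w i) (j : Fin 3) : w j ∣ v j := by
  classical
  let : StrongNormalizationMonoid R := UniqueFactorizationMonoid.strongNormalizationMonoid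
  let := UniqueFactorizationMonoid.toStrongNormalizedGCDMonoid R
  have hu : IsUnit (Finset.univ.gcd w) := by
    by_contra hu
    have hne : Finset.univ.gcd w ≠ 0 := by
      rw [Ne, Finset.gcd_eq_zero_iff]
      intro hc
      exact h0 (funext fun i => hc i (Finset.mem_univ i))
    obtain ⟨g, hg, hgd⟩ := WfDvdMonoid.exists_irreducible_factor hu hne
    exact hw g hg.prime fun i => hgd.trans (Finset.gcd_dvd (Finset.mem_univ i))
  have h1 : w j ∣ Finset.univ.gcd (fun i => v j * w i) :=
    Finset.dvd_gcd fun i _ => by rw [← h i j]; exact dvd_mul_left _ _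
  rw [Finset.gcd_mul_left] at h1
  exact (normalize_associated (v j)).dvd_iff_dvd_right.1 (hu.dvd_mul_right.1 h1)

lemma isHomogeneous_crossProduct {a b : Fin 3 → S} {m n : ℕ} (ha : ∀ i, (a i).IsHomogeneous m)
    (hb : ∀ i, (b i).IsHomogeneous n) (i : Fin 3) : (crossProduct a b i).IsHomogeneous (m + n) := by
  rw [cross_apply]
  fin_cases i
  · exact ((ha 1).mul (hb 2)).sub ((ha 2).mul (hb 1))
  · exact ((ha 2).mul (hb 0)).sub ((ha 0).mul (hb 2))
  · exact ((ha 0).mul (hb 1)).sub ((ha 1).mul (hb 0))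

/-- The cross product of two homogeneous Jacobian syzygies is a polynomial multiple of the gradient,
so it vanishes if its degree is smaller than that of the gradient. -/
lemma crossProduct_eq_zero {f : S} {d m n : ℕ} (hf : f.IsHomogeneous d) (hsq : Squarefree f)
    {a b : Fin 3 → S} (ha : a ∈ AR f) (hb : b ∈ AR f) (ham : ∀ i, (a i).IsHomogeneous m)
    (hbn : ∀ i, (b i).IsHomogeneous n) (hd : m + n + 1 < d) : crossProduct a b = 0 := by
  have hd0 : d ≠ 0 := by omega
  have ha' : ∑ i, a i * pderiv i f = 0 := ha
  have hb' : ∑ i, b i * pderiv i f = 0 := hb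
  rw [Fin.sum_univ_three] at ha' hb'
  have hprop : ∀ i j, crossProduct a b i * pderiv j f = crossProduct a b j * pderiv i f := by
    have h01 : crossProduct a b 0 * pderiv 1 f = crossProduct a b 1 * pderiv 0 f := by
      simp only [cross_apply, Matrix.cons_val]
      linear_combination b 2 * ha' - a 2 * hb'
    have h02 : crossProduct a b 0 * pderiv 2 f = crossProduct a b 2 * pderiv 0 f := by
      simp only [cross_apply, Matrix.cons_val]
      linear_combination a 1 * hb' - b 1 * ha'
    have h12 : crossProduct a b 1 * pderiv 2 f = crossProduct a b 2 * pderiv 1 f := by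
      simp only [cross_apply, Matrix.cons_val]
      linear_combination b 0 * ha' - a 0 * hb'
    intro i j
    match i, j with
    | 0, 0 | 1, 1 | 2, 2 => rfl
    | 0, 1 => exact h01
    | 0, 2 => exact h02
    | 1, 2 => exact h12
    | 1, 0 => exact h01.symm
    | 2, 0 => exact h02.symm
    | 2, 1 => exact h12.symm
  have hw : (fun i => pderiv i f) ≠ 0 := by
    intro h
    refine hsq.ne_zero ?_
    have h1 := hf.sum_X_mul_pderiv
    rw [Finset.sum_eq_zero fun i _ => by rw [show pderiv i f = 0 from congrFun h i, mul_zero]] at h1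
    exact (smul_eq_zero.1 h1.symm).resolve_left hd0
  obtain ⟨j, hj⟩ := Function.ne_iff.1 hw
  have hv : crossProduct a b j = 0 := by
    by_contra hv
    have hdvd := dvd_of_proportional hw (fun g hg => not_forall_dvd_pderiv hf hd0 hsq hg) hprop j
    have h1 : (pderiv j f).totalDegree ≤ (crossProduct a b j).totalDegree :=
      totalDegree_le_of_dvd_of_isDomain hdvd hv
    have h2 := (isHomogeneous_crossProduct ham hbn j).totalDegree hv
    have h3 := (hf.pderiv (i := j)).totalDegree hj
    omega
  funext i
  have h1 := hprop i j
  rw [hv, zero_mul] at h1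
  exact (mul_eq_zero.1 h1).resolve_right hj

/-- A form of Saito's criterion: if the cross product of two homogeneous triples `a`, `b` of degrees
`m ≤ n`, `m + n = d - 1`, is a nonzero multiple of the gradient of the squarefree form `f` of degree
`d`, then `a` is a Jacobian syzygy of minimal degree. -/
lemma mdr_eq_of_crossProduct {f : S} {d m n : ℕ} (hf : f.IsHomogeneous d) (hsq : Squarefree f)
    {a b : Fin 3 → S} (ham : ∀ i, (a i).IsHomogeneous m) (hbn : ∀ i, (b i).IsHomogeneous n)
    (hmn : m ≤ n) (hd : m + n + 1 = d) {c : ℂ} (hc : c ≠ 0)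
    (h : ∀ i, crossProduct a b i = C c * pderiv i f) : mdr f = m := by
  have hC : (C c : S) ≠ 0 := by simpa using hc
  have hw : ∃ j, pderiv j f ≠ 0 := by
    by_contra! h0
    refine hsq.ne_zero ?_
    have h1 := hf.sum_X_mul_pderiv
    rw [Finset.sum_eq_zero fun i _ => by rw [h0 i, mul_zero]] at h1
    exact (smul_eq_zero.1 h1.symm).resolve_left (by omega)
  obtain ⟨j, hj⟩ := hw
  have hcross : crossProduct a b ≠ 0 := by
    intro h0
    have := h j
    rw [h0] at this
    exact mul_ne_zero hC hj this.symm
  have hmem : ∀ {e : Fin 3 → S}, dotProduct e (crossProduct a b) = 0 → e ∈ AR f := by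
    intro e he
    have h1 : C c * ∑ i, e i * pderiv i f = 0 := by
      rw [← he, dotProduct, Finset.mul_sum]
      exact Finset.sum_congr rfl fun i _ => by rw [h i]; ring
    exact (mul_eq_zero.1 h1).resolve_left hC
  have ha : a ∈ AR f := hmem (dot_self_cross a b)
  have hb : b ∈ AR f := hmem (dot_cross_self a b)
  refine le_antisymm (Nat.sInf_le ⟨a, ha, ?_, ham⟩) (le_csInf ⟨m, a, ha, ?_, ham⟩ ?_)
  · rintro rfl; simp at hcross
  · rintro rfl; simp at hcross
  rintro k ⟨e, he, he0, hek⟩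
  by_contra! hk
  have h1 := crossProduct_eq_zero hf hsq he ha hek ham (by omega)
  have h2 := crossProduct_eq_zero hf hsq he hb hek hbn (by omega)
  -- `a` and `b` are both parallel to `e ≠ 0`, hence to each other
  obtain ⟨l, hl⟩ := Function.ne_iff.1 he0
  have h3 : e l • a = a l • e := by
    rw [cross_apply] at h1
    have p0 := congrFun h1 0
    have p1 := congrFun h1 1
    have p2 := congrFun h1 2
    simp only [Matrix.cons_val, Pi.zero_apply] at p0 p1 p2
    funext i
    simp only [Pi.smul_apply, smul_eq_mul]
    match l, i with
    | 0, 0 | 1, 1 | 2, 2 => exact mul_comm _ _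
    | 0, 1 => linear_combination p2
    | 0, 2 => linear_combination -p1
    | 1, 2 => linear_combination p0
    | 1, 0 => linear_combination -p2
    | 2, 0 => linear_combination p1
    | 2, 1 => linear_combination -p0
  have h4 : e l • crossProduct a b = 0 := by
    rw [← LinearMap.map_smul₂, h3, LinearMap.map_smul₂, h2, smul_zero]
  exact hcross ((smul_eq_zero.1 h4).resolve_left hl)

/-- The converse of `eval_smul_of_isHomogeneous`. -/
lemma isHomogeneous_of_eval_smul {f : S} {n : ℕ}
    (h : ∀ (t : ℂ) (v : Fin 3 → ℂ), eval (t • v) f = t ^ n * eval v f) : f.IsHomogeneous n := by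
  -- it suffices to compare the coefficients of `f (2 v) = 2 ^ n f v`
  have heval : ∀ (g : S) (v : Fin 3 → ℂ),
      eval v (aeval (fun i => C (2 : ℂ) * X i : Fin 3 → S) g) = eval ((2 : ℂ) • v) g := by
    intro g v
    induction g using MvPolynomial.induction_on with
    | C a => simp
    | add p q hp hq => rw [map_add, map_add, hp, hq, map_add]
    | mul_X p i hp => rw [map_mul, map_mul, hp]; simp
  have hcoeff : ∀ (g : S) (m : Fin 3 →₀ ℕ),
      coeff m (aeval (fun i => C (2 : ℂ) * X i : Fin 3 → S) g) = 2 ^ m.degree * coeff m g := by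
    intro g m
    induction g using MvPolynomial.induction_on' with
    | monomial u a =>
      have : aeval (fun i => C (2 : ℂ) * X i : Fin 3 → S) (monomial u a) =
          monomial u (2 ^ u.degree * a) := by
        refine MvPolynomial.funext fun v => ?_
        rw [heval, eval_monomial, eval_monomial]
        simp only [Pi.smul_apply, smul_eq_mul, mul_pow, Finsupp.prod_mul]
        rw [Finsupp.degree_apply, ← Finset.prod_pow_eq_pow_sum, Finsupp.prod]
        ring
      rw [this, coeff_monomial, coeff_monomial]
      split_ifs with hu
      · rw [hu]
      · rw [mul_zero]
    | add p q hp hq => rw [map_add, coeff_add, hp, hq, coeff_add]; ring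
  have h2 : aeval (fun i => C (2 : ℂ) * X i : Fin 3 → S) f = C (2 ^ n) * f := by
    refine MvPolynomial.funext fun v => ?_
    rw [map_mul, eval_C, ← h 2 v, heval]
  intro m hm
  have h3 := hcoeff f m
  rw [h2, coeff_C_mul] at h3
  have h4 := mul_right_cancel₀ hm h3
  have h5 : (2 : ℕ) ^ n = 2 ^ m.degree := by exact_mod_cast h4
  have h6 : Finsupp.weight 1 m = m.degree :=
    (DFunLike.congr_fun Finsupp.degree_eq_weight_one m).symm
  rw [h6]
  exact (Nat.pow_right_injective le_rfl h5).symm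

/-- The two triples, like those for the other arrangements below, are solutions of the linear
equations that define the Jacobian syzygies of the given degree. -/
lemma mdr_modelLine (h : Squarefree (modelCubic * modelConic * modelLine)) :
    mdr (modelCubic * modelConic * modelLine) = 2 := by
  refine mdr_eq_of_crossProduct (d := 6) (n := 3) (c := -1 / 2)
    ((modelCubic_isHomogeneous.mul modelConic_isHomogeneous).mul modelLine_isHomogeneous) h
    (a := ![-2 * X 0 ^ 2 - 3 * X 1 * X 2, 0, X 0 * X 1 + 4 * X 0 * X 2])
    (b := ![-16 * X 0 ^ 3 + 6 * X 0 * X 1 ^ 2 - 18 * X 0 * X 1 * X 2 - 24 * X 0 * X 2 ^ 2,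
      32 * X 0 ^ 2 * X 1 + 128 * X 0 ^ 2 * X 2 - 3 * X 1 ^ 3 + 96 * X 1 * X 2 ^ 2,
      6 * X 1 ^ 2 * X 2 - 48 * X 2 ^ 3])
    (fun i => isHomogeneous_of_eval_smul fun t v => by fin_cases i <;> simp <;> ring)
    (fun i => isHomogeneous_of_eval_smul fun t v => by fin_cases i <;> simp <;> ring)
    (by norm_num) (by norm_num) (by norm_num) fun i => MvPolynomial.funext fun v => ?_
  rw [cross_apply]
  simp only [pderiv_mul, pderiv_modelCubic_apply, pderiv_modelConic_apply, pderiv_modelLine_apply]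
  fin_cases i <;> simp [eval_modelCubic, eval_modelConic, eval_modelLine] <;> ring

lemma mdr_modelLinePos (h : Squarefree (modelCubic * modelConic * modelLinePos)) :
    mdr (modelCubic * modelConic * modelLinePos) = 2 := by
  refine mdr_eq_of_crossProduct (d := 6) (n := 3) (c := -4)
    ((modelCubic_isHomogeneous.mul modelConic_isHomogeneous).mul modelLinePos_isHomogeneous) h
    (a := ![11 * X 0 ^ 2 - 6 * X 0 * X 1 + 6 * X 0 * X 2 + 21 * X 1 * X 2, -32 * X 0 ^ 2 -
      3 * X 0 * X 1 + 3 * X 1 ^ 2 - 24 * X 1 * X 2, 8 * X 0 ^ 2 - 7 * X 0 * X 1 - 31 * X 0 * X 2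
      - 6 * X 1 * X 2 + 12 * X 2 ^ 2])
    (b := ![-24 * X 0 ^ 3 - 53 * X 0 ^ 2 * X 1 - 149 * X 0 ^ 2 * X 2 + 18 * X 0 * X 1 ^ 2 +
      12 * X 0 * X 1 * X 2 - 90 * X 0 * X 2 ^ 2 - 111 * X 1 ^ 2 * X 2 - 291 * X 1 * X 2 ^ 2,
      120 * X 0 ^ 2 * X 1 + 480 * X 0 ^ 2 * X 2 + 21 * X 0 * X 1 ^ 2 + 45 * X 0 * X 1 * X 2 -
      9 * X 1 ^ 3 + 39 * X 1 ^ 2 * X 2 + 360 * X 1 * X 2 ^ 2, 37 * X 0 * X 1 ^ 2 +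
      266 * X 0 * X 1 * X 2 + 433 * X 0 * X 2 ^ 2 + 18 * X 1 ^ 2 * X 2 + 66 * X 1 * X 2 ^ 2 -
      180 * X 2 ^ 3])
    (fun i => isHomogeneous_of_eval_smul fun t v => by fin_cases i <;> simp <;> ring)
    (fun i => isHomogeneous_of_eval_smul fun t v => by fin_cases i <;> simp <;> ring)
    (by norm_num) (by norm_num) (by norm_num) fun i => MvPolynomial.funext fun v => ?_
  rw [cross_apply]
  simp only [pderiv_mul, pderiv_modelCubic_apply, pderiv_modelConic_apply,
    pderiv_modelLinePos_apply]
  fin_cases i <;> simp [eval_modelCubic, eval_modelConic,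
    eval_modelLinePos] <;> ring

set_option maxHeartbeats 800000 in
lemma mdr_modelLine_modelLinePos
    (h : Squarefree (modelCubic * modelConic * modelLine * modelLinePos)) :
    mdr (modelCubic * modelConic * modelLine * modelLinePos) = 3 := by
  refine mdr_eq_of_crossProduct (d := 7) (n := 3) (c := 504)
    (((modelCubic_isHomogeneous.mul modelConic_isHomogeneous).mul modelLine_isHomogeneous).mul
      modelLinePos_isHomogeneous) h
    (a := ![-288 * X 0 ^ 3 - 540 * X 0 ^ 2 * X 1 - 1152 * X 0 ^ 2 * X 2 + 135 * X 0 * X 1 ^ 2 -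
      198 * X 0 * X 1 * X 2 - 360 * X 0 * X 2 ^ 2 - 777 * X 1 ^ 2 * X 2 - 1596 * X 1 * X 2 ^ 2,
      720 * X 0 ^ 2 * X 1 + 2688 * X 0 ^ 2 * X 2 - 22 * X 0 * X 1 ^ 2 - 88 * X 0 * X 1 * X 2 -
      54 * X 1 ^ 3 + 180 * X 1 ^ 2 * X 2 + 2160 * X 1 * X 2 ^ 2, 48 * X 0 ^ 2 * X 2 +
      259 * X 0 * X 1 ^ 2 + 1546 * X 0 * X 1 * X 2 + 2040 * X 0 * X 2 ^ 2 + 135 * X 1 ^ 2 * X 2 +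
      180 * X 1 * X 2 ^ 2 - 864 * X 2 ^ 3])
    (b := ![4032 * X 0 ^ 3 + 7884 * X 0 ^ 2 * X 1 + 17424 * X 0 ^ 2 * X 2 - 2025 * X 0 * X 1 ^ 2 +
      2538 * X 0 * X 1 * X 2 + 5400 * X 0 * X 2 ^ 2 + 11319 * X 1 ^ 2 * X 2 +
      24108 * X 1 * X 2 ^ 2, -10752 * X 0 ^ 2 * X 1 - 40320 * X 0 ^ 2 * X 2 + 338 * X 0 * X 1 ^ 2
      + 1352 * X 0 * X 1 * X 2 + 810 * X 1 ^ 3 - 2628 * X 1 ^ 2 * X 2 - 32400 * X 1 * X 2 ^ 2,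
      168 * X 0 ^ 2 * X 1 - 3773 * X 0 * X 1 ^ 2 - 22790 * X 0 * X 1 * X 2 -
      30792 * X 0 * X 2 ^ 2 - 2025 * X 1 ^ 2 * X 2 - 2628 * X 1 * X 2 ^ 2 + 12960 * X 2 ^ 3])
    (fun i => isHomogeneous_of_eval_smul fun t v => by fin_cases i <;> simp <;> ring)
    (fun i => isHomogeneous_of_eval_smul fun t v => by fin_cases i <;> simp <;> ring)
    (by norm_num) (by norm_num) (by norm_num) fun i => MvPolynomial.funext fun v => ?_
  rw [cross_apply]
  simp only [pderiv_mul, pderiv_modelCubic_apply, pderiv_modelConic_apply,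
    pderiv_modelLine_apply, pderiv_modelLinePos_apply]
  fin_cases i <;> simp [eval_modelCubic, eval_modelConic,
    eval_modelLine, eval_modelLinePos] <;> ring

lemma mdr_modelLinePos_modelLineNeg
    (h : Squarefree (modelCubic * modelConic * modelLinePos * modelLineNeg)) :
    mdr (modelCubic * modelConic * modelLinePos * modelLineNeg) = 3 := by
  refine mdr_eq_of_crossProduct (d := 7) (n := 3) (c := -147)
    (((modelCubic_isHomogeneous.mul modelConic_isHomogeneous).mul
      modelLinePos_isHomogeneous).mul modelLineNeg_isHomogeneous) h
    (a := ![-126 * X 0 ^ 3 - 90 * X 0 * X 1 ^ 2 - 210 * X 0 * X 1 * X 2 - 30 * X 0 * X 2 ^ 2,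
      -280 * X 0 ^ 2 * X 1 + 224 * X 0 ^ 2 * X 2 + 36 * X 1 ^ 3 - 252 * X 1 ^ 2 * X 2 +
      180 * X 1 * X 2 ^ 2, 259 * X 0 ^ 2 * X 1 + 700 * X 0 ^ 2 * X 2 - 90 * X 1 ^ 2 * X 2 +
      315 * X 1 * X 2 ^ 2 - 72 * X 2 ^ 3])
    (b := ![-261 * X 0 ^ 2 * X 1 + 216 * X 0 ^ 2 * X 2 - 294 * X 1 ^ 2 * X 2 + 147 * X 1 * X 2 ^ 2,
      -672 * X 0 ^ 3 + 124 * X 0 * X 1 ^ 2 - 512 * X 0 * X 1 * X 2, 168 * X 0 ^ 3 +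
      98 * X 0 * X 1 ^ 2 + 278 * X 0 * X 1 * X 2 + 48 * X 0 * X 2 ^ 2])
    (fun i => isHomogeneous_of_eval_smul fun t v => by fin_cases i <;> simp <;> ring)
    (fun i => isHomogeneous_of_eval_smul fun t v => by fin_cases i <;> simp <;> ring)
    (by norm_num) (by norm_num) (by norm_num) fun i => MvPolynomial.funext fun v => ?_
  rw [cross_apply]
  simp only [pderiv_mul, pderiv_modelCubic_apply, pderiv_modelConic_apply,
    pderiv_modelLinePos_apply, pderiv_modelLineNeg_apply]
  fin_cases i <;> simp [eval_modelCubic, eval_modelConic,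
    eval_modelLinePos, eval_modelLineNeg] <;> ring

/-! ### The normal form of a nodal cubic -/

lemma eq_C_of_isHomogeneous_zero {f : S} (hf : f.IsHomogeneous 0) : f = C (coeff 0 f) :=
  totalDegree_eq_zero_iff_eq_C.1 (Nat.le_zero.1 hf.totalDegree_le)

/-- By Euler's formula, a form of positive degree lies in the ideal of the coordinates, with forms
as coefficients. -/
lemma exists_eval_eq_sum {f : S} {n : ℕ} (hf : f.IsHomogeneous (n + 1)) :
    ∃ g : Fin 3 → S, (∀ i, (g i).IsHomogeneous n) ∧ ∀ v, eval v f = ∑ i, v i * eval v (g i) := by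
  refine ⟨fun i => C ((n + 1 : ℂ)⁻¹) * pderiv i f, fun i => (hf.pderiv (i := i)).C_mul _,
    fun v => ?_⟩
  have h := congrArg (eval v) hf.sum_X_mul_pderiv
  simp only [map_sum, map_mul, eval_X, nsmul_eq_mul, map_natCast] at h
  have hn : (n + 1 : ℂ) ≠ 0 := Nat.cast_add_one_ne_zero n
  have h2 : eval v f = (n + 1 : ℂ)⁻¹ * ∑ i, v i * eval v (pderiv i f) := by
    rw [h]; push_cast; field_simp
  rw [h2, Finset.mul_sum]
  exact Finset.sum_congr rfl fun i _ => by rw [map_mul, eval_C]; ring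

lemma exists_linear {f : S} (hf : f.IsHomogeneous 1) :
    ∃ a b c : ℂ, ∀ v, eval v f = a * v 0 + b * v 1 + c * v 2 := by
  obtain ⟨g, hg, h⟩ := exists_eval_eq_sum hf
  refine ⟨coeff 0 (g 0), coeff 0 (g 1), coeff 0 (g 2), fun v => ?_⟩
  rw [h, Fin.sum_univ_three, eq_C_of_isHomogeneous_zero (hg 0), eq_C_of_isHomogeneous_zero (hg 1),
    eq_C_of_isHomogeneous_zero (hg 2)]
  simp
  ring

lemma exists_quadratic {f : S} (hf : f.IsHomogeneous 2) :
    ∃ a b c d e g : ℂ, ∀ v, eval v f = a * v 0 ^ 2 + b * v 1 ^ 2 + c * v 2 ^ 2 + d * v 0 * v 1 +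
      e * v 0 * v 2 + g * v 1 * v 2 := by
  obtain ⟨g, hg, h⟩ := exists_eval_eq_sum hf
  obtain ⟨a0, b0, c0, h0⟩ := exists_linear (hg 0)
  obtain ⟨a1, b1, c1, h1⟩ := exists_linear (hg 1)
  obtain ⟨a2, b2, c2, h2⟩ := exists_linear (hg 2)
  refine ⟨a0, b1, c2, b0 + a1, c0 + a2, c1 + b2, fun v => ?_⟩
  rw [h, Fin.sum_univ_three, h0, h1, h2]
  ring

lemma exists_cubic {f : S} (hf : f.IsHomogeneous 3) :
    ∃ a b c d e g h k l m : ℂ, ∀ v, eval v f = a * v 0 ^ 3 + b * v 0 ^ 2 * v 1 +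
      c * v 0 * v 1 ^ 2 + d * v 1 ^ 3 + v 2 * (e * v 0 ^ 2 + g * v 0 * v 1 + h * v 1 ^ 2) +
      v 2 ^ 2 * (k * v 0 + l * v 1) + m * v 2 ^ 3 := by
  obtain ⟨g, hg, h⟩ := exists_eval_eq_sum hf
  obtain ⟨a0, b0, c0, d0, e0, g0, h0⟩ := exists_quadratic (hg 0)
  obtain ⟨a1, b1, c1, d1, e1, g1, h1⟩ := exists_quadratic (hg 1)
  obtain ⟨a2, b2, c2, d2, e2, g2, h2⟩ := exists_quadratic (hg 2)
  refine ⟨a0, d0 + a1, b0 + d1, b1, e0 + a2, g0 + e1 + d2, g1 + b2, c0 + e2, c1 + g2, c2,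
    fun v => ?_⟩
  rw [h, Fin.sum_univ_three, h0, h1, h2]
  ring

/-- A nodal cubic with node `(0 : 0 : 1)` has an equation `z q(x, y) + c(x, y)`, where the quadratic
form `q` has nonzero discriminant. -/
lemma exists_of_node {f : S} (hf : f.IsHomogeneous 3) (h0 : eval ![0, 0, 1] f = 0)
    (h1 : ∀ i, eval ![0, 0, 1] (pderiv i f) = 0)
    (h2 : ((hessian f).map (eval ![0, 0, 1])).rank = 2) :
    ∃ a b c d e g h : ℂ, g ^ 2 - 4 * e * h ≠ 0 ∧ ∀ v, eval v f = a * v 0 ^ 3 + b * v 0 ^ 2 * v 1 +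
      c * v 0 * v 1 ^ 2 + d * v 1 ^ 3 + v 2 * (e * v 0 ^ 2 + g * v 0 * v 1 + h * v 1 ^ 2) := by
  obtain ⟨a, b, c, d, e, g, h, k, l, m, hv⟩ := exists_cubic hf
  have hfe : f = C a * X 0 ^ 3 + C b * X 0 ^ 2 * X 1 + C c * X 0 * X 1 ^ 2 + C d * X 1 ^ 3 +
      X 2 * (C e * X 0 ^ 2 + C g * X 0 * X 1 + C h * X 1 ^ 2) +
      X 2 ^ 2 * (C k * X 0 + C l * X 1) + C m * X 2 ^ 3 :=
    MvPolynomial.funext fun v => by rw [hv]; simp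
  have hm : m = 0 := by rw [hv] at h0; simpa using h0
  have hk : k = 0 := by
    have := h1 0
    rw [hfe] at this
    simpa [pderiv_X] using this
  have hl : l = 0 := by
    have := h1 1
    rw [hfe] at this
    simpa [pderiv_X] using this
  subst hm hk hl
  refine ⟨a, b, c, d, e, g, h, fun hdisc => ?_, fun v => by rw [hv]; ring⟩
  have hH : (hessian f).map (eval ![0, 0, 1]) = !![2 * e, g, 0; g, 2 * h, 0; 0, 0, 0] := by
    ext i j
    rw [Matrix.map_apply, hessian, Matrix.of_apply, hfe]
    fin_cases i <;> fin_cases j <;> simp [pderiv_X] <;> ring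
  -- a symmetric matrix of rank at most one is a multiple of `w wᵀ`
  have hr : (!![2 * e, g, 0; g, 2 * h, 0; 0, 0, 0] : Matrix (Fin 3) (Fin 3) ℂ).rank ≤ 1 := by
    by_cases he : e = 0
    · have hg : g = 0 := by simpa [he] using hdisc
      have : (!![2 * e, g, 0; g, 2 * h, 0; 0, 0, 0] : Matrix (Fin 3) (Fin 3) ℂ) =
          Matrix.vecMulVec ![0, 2 * h, 0] ![0, 1, 0] := by
        ext i j; fin_cases i <;> fin_cases j <;> simp [Matrix.vecMulVec_apply, he, hg]
      rw [this]
      exact Matrix.rank_vecMulVec_le _ _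
    · have : (!![2 * e, g, 0; g, 2 * h, 0; 0, 0, 0] : Matrix (Fin 3) (Fin 3) ℂ) =
          Matrix.vecMulVec ![2 * e, g, 0] ![1, g / (2 * e), 0] := by
        ext i j
        fin_cases i <;> fin_cases j <;> simp [Matrix.vecMulVec_apply] <;> field_simp
        linear_combination -hdisc
      rw [this]
      exact Matrix.rank_vecMulVec_le _ _
  rw [hH] at h2
  omega

lemma hessian_pullback (A : (Fin 3 → ℂ) ≃ₗ[ℂ] (Fin 3 → ℂ)) (f : S) (v : Fin 3 → ℂ) :
    (hessian (pullback A f)).map (eval v) =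
      (LinearMap.toMatrix' (A : (Fin 3 → ℂ) →ₗ[ℂ] (Fin 3 → ℂ))).transpose *
        (hessian f).map (eval (A v)) * LinearMap.toMatrix' (A : (Fin 3 → ℂ) →ₗ[ℂ] (Fin 3 → ℂ)) := by
  ext i j
  simp only [Matrix.map_apply, hessian, Matrix.of_apply, pderiv_pullback, map_sum, pderiv_C_mul,
    Matrix.mul_apply, Matrix.transpose_apply, LinearMap.toMatrix'_apply, eval_pullback, map_mul,
    eval_C, Finset.sum_mul, Finset.mul_sum]
  refine Finset.sum_congr rfl fun k _ => Finset.sum_congr rfl fun l _ => ?_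
  simp
  ring

/-- The normal form of a nodal cubic. -/
def nodalCubic : S := X 0 ^ 3 + X 1 ^ 3 - X 0 * X 1 * X 2

lemma eval_nodalCubic (v : Fin 3 → ℂ) :
    eval v nodalCubic = v 0 ^ 3 + v 1 ^ 3 - v 0 * v 1 * v 2 := by simp [nodalCubic]

lemma not_irreducible_mul {f g : S} (hf : eval 0 f = 0) (hg : eval 0 g = 0) :
    ¬ Irreducible (f * g) := by
  intro h
  rcases h.isUnit_or_isUnit rfl with h | h
  · exact (h.map (eval (0 : Fin 3 → ℂ))).ne_zero hf
  · exact (h.map (eval (0 : Fin 3 → ℂ))).ne_zero hg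

lemma exists_pullback_of_pullback {f : S} (A : (Fin 3 → ℂ) ≃ₗ[ℂ] (Fin 3 → ℂ))
    (h : ∃ B, pullback B (pullback A f) = nodalCubic) : ∃ B, pullback B f = nodalCubic := by
  obtain ⟨B, hB⟩ := h
  exact ⟨B.trans A, by rw [pullback_trans, hB]⟩

/-- Here the tangents at the node `(0 : 0 : 1)` are the coordinate axes `x = 0` and `y = 0`. -/
lemma exists_pullback_eq_of_eval {f : S} (hirr : Irreducible f) {a b c d : ℂ}
    (h : ∀ v, eval v f = a * v 0 ^ 3 + b * v 0 ^ 2 * v 1 +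
      c * v 0 * v 1 ^ 2 + d * v 1 ^ 3 - v 0 * v 1 * v 2) : ∃ B, pullback B f = nodalCubic := by
  have ha : a ≠ 0 := by
    rintro rfl
    have : f = X 1 * (C b * X 0 ^ 2 + C c * X 0 * X 1 + C d * X 1 ^ 2 - X 0 * X 2) :=
      MvPolynomial.funext fun v => by rw [h]; simp; ring
    exact not_irreducible_mul (by simp) (by simp) (this ▸ hirr)
  have hd : d ≠ 0 := by
    rintro rfl
    have : f = X 0 * (C a * X 0 ^ 2 + C b * X 0 * X 1 + C c * X 1 ^ 2 - X 1 * X 2) :=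
      MvPolynomial.funext fun v => by rw [h]; simp; ring
    exact not_irreducible_mul (by simp) (by simp) (this ▸ hirr)
  obtain ⟨s, hs⟩ := IsAlgClosed.exists_pow_nat_eq a⁻¹ three_pos
  obtain ⟨t, ht⟩ := IsAlgClosed.exists_pow_nat_eq d⁻¹ three_pos
  have hs0 : s ≠ 0 := by rintro rfl; simp [eq_comm, ha] at hs
  have ht0 : t ≠ 0 := by rintro rfl; simp [eq_comm, hd] at ht
  obtain ⟨w, e3⟩ : ∃ w, s * t * w = 1 := ⟨_, mul_inv_cancel₀ (mul_ne_zero hs0 ht0)⟩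
  refine ⟨linAut !![s, 0, 0; 0, t, 0; b * s, c * t, w] ?_,
    MvPolynomial.funext fun v => ?_⟩
  · rw [Matrix.det_fin_three]
    simpa [hs0, ht0] using right_ne_zero_of_mul (e3 ▸ one_ne_zero)
  · rw [eval_pullback, h, eval_nodalCubic]
    have e1 : a * s ^ 3 = 1 := by rw [hs]; field_simp
    have e2 : d * t ^ 3 = 1 := by rw [ht]; field_simp
    simp [Matrix.mulVec, dotProduct, Fin.sum_univ_three]
    linear_combination v 0 ^ 3 * e1 + v 1 ^ 3 * e2 - v 0 * v 1 * v 2 * e3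

lemma exists_pullback_eq_of_disc {f : S} (hirr : Irreducible f) {a b c d e g h : ℂ}
    (hdisc : g ^ 2 - 4 * e * h ≠ 0) (hf : ∀ v, eval v f = a * v 0 ^ 3 + b * v 0 ^ 2 * v 1 +
      c * v 0 * v 1 ^ 2 + d * v 1 ^ 3 + v 2 * (e * v 0 ^ 2 + g * v 0 * v 1 + h * v 1 ^ 2)) :
    ∃ B, pullback B f = nodalCubic := by
  -- the quadratic form splits into two independent linear factors
  obtain ⟨p, q, r, s, hdet, h1, h2, h3⟩ : ∃ p q r s : ℂ, p * s - q * r ≠ 0 ∧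
      e * p ^ 2 + g * p * r + h * r ^ 2 = 0 ∧ e * q ^ 2 + g * q * s + h * s ^ 2 = 0 ∧
      2 * e * p * q + g * (p * s + q * r) + 2 * h * r * s = -1 := by
    by_cases he : e = 0
    · subst he
      have hg : g ≠ 0 := by rintro rfl; simp at hdisc
      refine ⟨1, h / g ^ 2, 0, -1 / g, ?_, ?_, ?_, ?_⟩
      · simpa using hg
      · ring
      · field_simp; ring
      · field_simp; ring
    · obtain ⟨D, hD⟩ := IsAlgClosed.exists_pow_nat_eq (g ^ 2 - 4 * e * h) two_pos
      have hD0 : D ≠ 0 := by rintro rfl; exact hdisc (by rw [← hD]; simp)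
      have hh : h = (g ^ 2 - D ^ 2) / (4 * e) := by rw [hD]; field_simp; ring
      subst hh
      refine ⟨-g + D, (-g - D) / (4 * e * D ^ 2), 2 * e, 2 * e / (4 * e * D ^ 2), ?_, ?_, ?_, ?_⟩
      · have : (-g + D) * (2 * e / (4 * e * D ^ 2)) - (-g - D) / (4 * e * D ^ 2) * (2 * e) =
            1 / D := by
          field_simp; ring
        rw [this]
        exact one_div_ne_zero hD0
      · field_simp; ring
      · field_simp; ring
      · field_simp; ring
  refine exists_pullback_of_pullback (linAut !![p, q, 0; r, s, 0; 0, 0, 1] ?_)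
    (exists_pullback_eq_of_eval ((irreducible_pullback_iff _).2 hirr)
      (a := a * p ^ 3 + b * p ^ 2 * r + c * p * r ^ 2 + d * r ^ 3)
      (b := 3 * a * p ^ 2 * q + b * (p ^ 2 * s + 2 * p * q * r) + c * (2 * p * r * s + q * r ^ 2) +
        3 * d * r ^ 2 * s)
      (c := 3 * a * p * q ^ 2 + b * (q ^ 2 * r + 2 * p * q * s) + c * (2 * q * r * s + p * s ^ 2) +
        3 * d * r * s ^ 2)
      (d := a * q ^ 3 + b * q ^ 2 * s + c * q * s ^ 2 + d * s ^ 3) fun v => ?_)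
  · rw [Matrix.det_fin_three]
    simpa using hdet
  · rw [eval_pullback, hf]
    simp [Matrix.mulVec, dotProduct, Fin.sum_univ_three]
    linear_combination v 2 * v 0 ^ 2 * h1 + v 2 * v 1 ^ 2 * h2 + v 0 * v 1 * v 2 * h3

lemma IsNodalCubic.exists_pullback_eq {f : S} (hf : IsNodalCubic f) :
    ∃ B, pullback B f = nodalCubic := by
  obtain ⟨hhom, hirr, p, ⟨h0, h1⟩, h2⟩ := hf
  obtain ⟨A, hA⟩ := SeparatingDual.exists_continuousLinearEquiv_apply_eq (R := ℂ)
    (vec_ne_zero (v := ![0, 0, 1]) 2 (by simp)) p.rep_nonzero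
  set B : (Fin 3 → ℂ) ≃ₗ[ℂ] (Fin 3 → ℂ) := A.toLinearEquiv
  have hB : B ![0, 0, 1] = p.rep := hA
  have hdet : IsUnit (LinearMap.toMatrix' (B : (Fin 3 → ℂ) →ₗ[ℂ] (Fin 3 → ℂ))).det := by
    rw [LinearMap.det_toMatrix']
    exact LinearEquiv.isUnit_det' B
  obtain ⟨a, b, c, d, e, g, h, hdisc, hv⟩ := exists_of_node (hhom.pullback B)
    (by rw [eval_pullback, hB]; exact h0)
    (fun i => by
      rw [pderiv_pullback, map_sum]
      exact Finset.sum_eq_zero fun j _ => by rw [map_mul, eval_pullback, hB, h1, mul_zero])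
    (by rw [hessian_pullback, hB, Matrix.rank_mul_eq_left_of_isUnit_det _ _ hdet,
          Matrix.rank_mul_eq_right_of_isUnit_det _ _ (by rwa [Matrix.det_transpose]), h2])
  exact exists_pullback_of_pullback B
    (exists_pullback_eq_of_disc ((irreducible_pullback_iff B).2 hirr) hdisc hv)

/-! ### Contact with the normal form of the nodal cubic -/

/-- The parametrization `t ↦ (t : t² : 1 + t³)` of `nodalCubic`, the smooth points of which are the
images of the nonzero parameters. -/
def nodalParam {R : Type*} [CommRing R] (t : R) : Fin 3 → R := ![t, t ^ 2, 1 + t ^ 3]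

lemma nodalParam_ne_zero {t : ℂ} (ht : t ≠ 0) : nodalParam t ≠ 0 :=
  vec_ne_zero 0 (by simpa [nodalParam] using ht)

lemma pderiv_nodalCubic (i : Fin 3) : pderiv i nodalCubic =
    (![3 * X 0 ^ 2 - X 1 * X 2, 3 * X 1 ^ 2 - X 0 * X 2, - (X 0 * X 1)] : Fin 3 → S) i := by
  fin_cases i <;> simp [nodalCubic, pderiv_X] <;> ring

lemma IsSmoothPoint.exists_nodalParam {p : P2} (hp : IsSmoothPoint nodalCubic p) :
    ∃ t, ∃ ht : t ≠ 0, p = Projectivization.mk ℂ (nodalParam t) (nodalParam_ne_zero ht) := by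
  obtain ⟨h0, i, hi⟩ := hp
  rw [LiesOn, eval_nodalCubic] at h0
  have hx : p.rep 0 ≠ 0 := by
    intro hx
    have hy : p.rep 1 = 0 := by simpa [hx] using h0
    rw [pderiv_nodalCubic] at hi
    fin_cases i <;> simp [hx, hy] at hi
  have hy : p.rep 1 ≠ 0 := by
    intro hy
    exact hx (by simpa [hy] using h0)
  refine ⟨p.rep 1 / p.rep 0, div_ne_zero hy hx,
    eq_mk_of_rep_eq _ (t := p.rep 0 ^ 2 / p.rep 1) ?_⟩
  ext i
  fin_cases i <;> simp [nodalParam] <;> field_simp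
  linear_combination -h0

/-- On the complement of `x y = 0` in the cone over the nodal cubic, the coordinates are
proportional to `nodalParam (y / x)`, with factor `x² / y`. -/
lemma map_eq_of_map_nodalCubic {Q : Type*} [CommRing Q] (φ : S →+* Q) {x' y' : Q}
    (hx : φ (X 0) * x' = 1) (hy : φ (X 1) * y' = 1) (hE : φ nodalCubic = 0) {G : S} {d : ℕ}
    (hG : G.IsHomogeneous d) :
    φ G = (φ (X 0) ^ 2 * y') ^ d *
      (aeval (nodalParam Polynomial.X) G : Polynomial ℂ).eval₂ (φ.comp C) (φ (X 1) * x') := by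
  let : Algebra ℂ Q := (φ.comp C).toAlgebra
  have hE' : φ (X 0) ^ 3 + φ (X 1) ^ 3 - φ (X 0) * φ (X 1) * φ (X 2) = 0 := by
    simpa [nodalCubic] using hE
  have hX : ∀ i, φ (X i) = φ (X 0) ^ 2 * y' *
      Polynomial.aeval (φ (X 1) * x') (nodalParam (Polynomial.X : Polynomial ℂ) i) := by
    intro i
    match i with
    | 0 =>
      simp only [nodalParam, Matrix.cons_val, Polynomial.aeval_X]
      linear_combination -φ (X 0) * (φ (X 1) * y') * hx - φ (X 0) * hy
    | 1 =>
      simp only [nodalParam, Matrix.cons_val, Polynomial.aeval_X, map_pow]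
      linear_combination -φ (X 1) * (φ (X 0) * x' + 1) * (φ (X 1) * y') * hx - φ (X 1) * hy
    | 2 =>
      simp only [nodalParam, Matrix.cons_val, Polynomial.aeval_X, map_pow, map_add, map_one]
      linear_combination -(x' * y') * hE' +
        (-φ (X 2) * (φ (X 1) * y') + φ (X 0) ^ 2 * y' -
          φ (X 1) ^ 2 * x' * (φ (X 0) * x' + 1) * (φ (X 1) * y')) * hx +
        (-φ (X 2) + φ (X 1) ^ 2 * x' - φ (X 1) ^ 2 * x') * hy
  have hΦ : ∀ g, φ g = aeval (fun i => φ (X 0) ^ 2 * y' *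
      Polynomial.aeval (φ (X 1) * x') (nodalParam (Polynomial.X : Polynomial ℂ) i)) g := by
    intro g
    induction g using MvPolynomial.induction_on with
    | C a => rw [algHom_C]; rfl
    | add f g hf hg => rw [map_add, hf, hg, map_add]
    | mul_X f i hf => rw [map_mul, map_mul, hf, aeval_X, ← hX]
  rw [hΦ G, aeval_mul_of_isHomogeneous hG, ← MvPolynomial.comp_aeval_apply]
  rfl

/-- The contact of a curve with the nodal cubic at a smooth point is at most the order of vanishing
of its equation along the parametrization: in the local ring, modulo the equations, the coordinates
are proportional to `nodalParam (y / x)`, so `(y / x - t) ^ k` vanishes if `k` is that order. -/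
lemma pow_dvd_of_le_intersectionMultiplicity {G : S} {d n : ℕ} (hG : G.IsHomogeneous d) {t : ℂ}
    (ht : t ≠ 0) (h : (n : ℕ∞) ≤ intersectionMultiplicity nodalCubic G
      (Projectivization.mk ℂ (nodalParam t) (nodalParam_ne_zero ht))) :
    (Polynomial.X - Polynomial.C t) ^ n ∣ aeval (nodalParam Polynomial.X) G := by
  by_cases hH : aeval (nodalParam (Polynomial.X : Polynomial ℂ)) G = 0
  · rw [hH]; exact dvd_zero _
  obtain ⟨H, hGH, hHt⟩ := Polynomial.exists_eq_pow_rootMultiplicity_mul_and_not_dvd _ hH t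
  set k := Polynomial.rootMultiplicity t (aeval (nodalParam (Polynomial.X : Polynomial ℂ)) G)
  suffices hnk : n ≤ k by rw [hGH]; exact (pow_dvd_pow _ hnk).mul_right _
  set p := Projectivization.mk ℂ (nodalParam t) (nodalParam_ne_zero ht)
  set ψ := algebraMap S (LocalRingAt p)
  have hX0 : (X 0 : S) ∉ pointIdeal p := notMem_pointIdeal _ (by simpa [nodalParam] using ht)
  have hX1 : (X 1 : S) ∉ pointIdeal p := notMem_pointIdeal _ (by simpa [nodalParam] using ht)
  obtain ⟨x', hx'⟩ := (isUnit_algebraMap hX0).exists_right_inv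
  obtain ⟨y', hy'⟩ := (isUnit_algebraMap hX1).exists_right_inv
  set x := ψ (X 0)
  set y := ψ (X 1)
  set z := ψ (X 2)
  set I := localIdeal (Ideal.span {nodalCubic, G}) p
  have hE : x ^ 3 + y ^ 3 - x * y * z ∈ I := by
    have : ψ nodalCubic ∈ I := Ideal.mem_map_of_mem _ (Ideal.subset_span (by simp))
    simpa [nodalCubic] using this
  have hGI : ψ G ∈ I := Ideal.mem_map_of_mem _ (Ideal.subset_span (by simp))
  set w := y * x' - algebraMap ℂ (LocalRingAt p) t with hw
  have hz : z - (x ^ 2 * y' + y ^ 2 * x') ∈ I := by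
    have := I.mul_mem_left (-(x' * y')) hE
    convert this using 1
    linear_combination (-z * y * y' + x ^ 2 * y') * hx' + (-z + y ^ 2 * x') * hy'
  have hψC : ∀ a, ψ (C a) = algebraMap ℂ (LocalRingAt p) a := fun a =>
    (IsScalarTower.algebraMap_apply ℂ S (LocalRingAt p) a).symm
  have hl : X 1 - C t * X 0 ∈ pointIdeal p :=
    (mem_pointIdeal_mk_iff _).2 fun s => by simp [nodalParam]; ring
  have hl' : X 2 - C ((1 + t ^ 3) / t) * X 0 ∈ pointIdeal p :=
    (mem_pointIdeal_mk_iff _).2 fun s => by simp [nodalParam]; field_simp; ring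
  have hspan : pointIdeal p = Ideal.span {X 1 - C t * X 0, X 2 - C ((1 + t ^ 3) / t) * X 0} := by
    refine pointIdeal_eq_span (n := X 0) ![1, t, (1 + t ^ 3) / t] hl hl' fun i => ?_
    fin_cases i
    · simp
    · exact Ideal.subset_span (by simp)
    · exact Ideal.subset_span (by simp)
  have hlw : ψ (X 1 - C t * X 0) = x * w := by
    rw [map_sub, map_mul, hψC]
    linear_combination -y * hx'
  have hwm : w ∈ IsLocalRing.maximalIdeal (LocalRingAt p) := by
    rw [maximalIdeal_localRingAt]
    refine ((localIdeal (pointIdeal p) p).unit_mul_mem_iff_mem (isUnit_algebraMap hX0)).1 ?_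
    rw [← hlw]
    exact Ideal.mem_map_of_mem _ hl
  have hm : IsLocalRing.maximalIdeal (LocalRingAt p) ≤ I ⊔ Ideal.span {w} := by
    have hwI : w ∈ I ⊔ Ideal.span {w} := Ideal.mem_sup_right (Ideal.mem_span_singleton_self w)
    refine maximalIdeal_le_of_pointIdeal_eq_span hspan ?_ ?_
    · rw [hlw]
      exact Ideal.mul_mem_left _ _ hwI
    · have ha : algebraMap ℂ (LocalRingAt p) t * algebraMap ℂ (LocalRingAt p) t⁻¹ = 1 := by
        rw [← map_mul, mul_inv_cancel₀ ht, map_one]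
      have hC : ψ (C ((1 + t ^ 3) / t)) = algebraMap ℂ (LocalRingAt p) t⁻¹ +
          algebraMap ℂ (LocalRingAt p) t ^ 2 := by
        rw [hψC, ← map_pow, ← map_add]
        congr 1
        field_simp
      have h1 := Ideal.add_mem _ ((le_sup_left : I ≤ I ⊔ Ideal.span {w}) hz)
        (Ideal.mul_mem_left _ (x * (-(x * y' * algebraMap ℂ (LocalRingAt p) t⁻¹) +
          (y * x' + algebraMap ℂ (LocalRingAt p) t))) hwI)
      convert h1 using 1
      rw [map_sub, map_mul, hC, hw]
      generalize algebraMap ℂ (LocalRingAt p) t = a at ha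
      generalize algebraMap ℂ (LocalRingAt p) t⁻¹ = a' at ha
      change z - (a' + a ^ 2) * x = _
      linear_combination (a' * x * (y * y') - y ^ 2 * x') * hx' + a' * x * hy' - x ^ 2 * y' * ha
  have hwk : w ^ k ∈ I := by
    have hφE : (Ideal.Quotient.mk I).comp ψ nodalCubic = 0 := Ideal.Quotient.eq_zero_iff_mem.2
      (Ideal.mem_map_of_mem _ (Ideal.subset_span (by simp)))
    have h1 := map_eq_of_map_nodalCubic ((Ideal.Quotient.mk I).comp ψ)
      (x' := Ideal.Quotient.mk I x') (y' := Ideal.Quotient.mk I y')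
      (by rw [RingHom.comp_apply, ← RingHom.map_mul, hx', RingHom.map_one])
      (by rw [RingHom.comp_apply, ← RingHom.map_mul, hy', RingHom.map_one]) hφE hG
    rw [RingHom.comp_apply, Ideal.Quotient.eq_zero_iff_mem.2 hGI, RingHom.comp_apply,
      RingHom.comp_apply, ← RingHom.map_pow, ← RingHom.map_mul, ← RingHom.map_mul,
      ← RingHom.map_pow, RingHom.comp_assoc, ← Polynomial.hom_eval₂, ← RingHom.map_mul, eq_comm,
      Ideal.Quotient.eq_zero_iff_mem, hGH, Polynomial.eval₂_mul, Polynomial.eval₂_pow,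
      Polynomial.eval₂_sub, Polynomial.eval₂_X, Polynomial.eval₂_C, RingHom.comp_apply, hψC] at h1
    have hu : IsUnit (x ^ 2 * y') :=
      ((isUnit_algebraMap hX0).pow 2).mul (IsUnit.of_mul_eq_one y (by rw [mul_comm, hy']))
    rw [I.unit_mul_mem_iff_mem (hu.pow d)] at h1
    have hHu : IsUnit (H.eval₂ (ψ.comp C) (y * x')) := by
      obtain ⟨H', hH'⟩ := Polynomial.X_sub_C_dvd_sub_C_eval (a := t) (p := H)
      have h2 : H = Polynomial.C (H.eval t) + (Polynomial.X - Polynomial.C t) * H' := by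
        rw [← hH']; ring
      rw [h2, Polynomial.eval₂_add, Polynomial.eval₂_mul, Polynomial.eval₂_sub, Polynomial.eval₂_C,
        Polynomial.eval₂_X, Polynomial.eval₂_C, RingHom.comp_apply _ _ t, hψC]
      refine isUnit_add_of_mem_maximalIdeal ?_ (Ideal.mul_mem_right _ _ hwm)
      refine (IsUnit.mk0 _ fun h0 => hHt ?_).map (ψ.comp C)
      exact Polynomial.dvd_iff_isRoot.2 h0
    exact (I.mul_unit_mem_iff_mem hHu).1 h1
  have := h.trans (length_quotient_le_of_pow_mem k hm hwk)
  exact_mod_cast this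

/-! ### Inflectional lines and hyperosculating conics of the normal form -/

lemma eq_C_mul_pow_of_dvd {P : Polynomial ℂ} {n : ℕ} {t : ℂ} (hP : P.natDegree ≤ n)
    (h : (Polynomial.X - Polynomial.C t) ^ n ∣ P) : ∃ k, ∀ s, P.eval s = k * (s - t) ^ n := by
  refine ⟨P.leadingCoeff, fun s => ?_⟩
  have hm := (Polynomial.monic_X_sub_C t).pow n
  have h1 := Polynomial.eq_leadingCoeff_mul_of_monic_of_dvd_of_natDegree_le hm h
    (by rwa [Polynomial.natDegree_pow, Polynomial.natDegree_X_sub_C, mul_one])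
  conv_lhs => rw [h1]
  simp

lemma exists_of_isInflectionalLine_nodalCubic {l : S} (hl : IsInflectionalLine nodalCubic l) :
    ∃ s c : ℂ, s ^ 3 = -1 ∧ c ≠ 0 ∧
      ∀ v, eval v l = c * (3 * s ^ 2 * v 0 - 3 * s * v 1 + v 2) := by
  obtain ⟨p, ⟨hp, hι⟩, hassoc⟩ := hl
  obtain ⟨k, hk, hl⟩ := exists_C_mul_of_associated hassoc.symm
  have h3 : ((3 : ℕ) : ℕ∞) ≤
      intersectionMultiplicity nodalCubic (tangentLine nodalCubic p) p := by
    rw [inflectionOrder, tsub_pos_iff_lt] at hι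
    exact Order.add_one_le_of_lt hι
  obtain ⟨i, hi⟩ := hp.2
  obtain ⟨t, ht, hpt⟩ := hp.exists_nodalParam
  set a := eval p.rep (pderiv 0 nodalCubic) with ha
  set b := eval p.rep (pderiv 1 nodalCubic) with hb
  set c := eval p.rep (pderiv 2 nodalCubic) with hc
  have hT : tangentLine nodalCubic p = C a * X 0 + C b * X 1 + C c * X 2 := by
    rw [tangentLine, Fin.sum_univ_three]
  have hhom : (tangentLine nodalCubic p).IsHomogeneous 1 :=
    IsHomogeneous.sum _ _ _ fun i _ => (isHomogeneous_X ℂ i).C_mul _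
  have hdvd : (Polynomial.X - Polynomial.C t) ^ 3 ∣
      aeval (nodalParam Polynomial.X) (tangentLine nodalCubic p) :=
    pow_dvd_of_le_intersectionMultiplicity hhom ht (by rwa [← hpt])
  have hγ : aeval (nodalParam Polynomial.X) (tangentLine nodalCubic p) =
      Polynomial.C a * Polynomial.X + Polynomial.C b * Polynomial.X ^ 2 +
        Polynomial.C c * (1 + Polynomial.X ^ 3) := by
    rw [hT]
    simp [nodalParam]
  rw [hγ] at hdvd
  obtain ⟨m, hm⟩ := eq_C_mul_pow_of_dvd (by compute_degree) hdvd
  simp only [Polynomial.eval_add, Polynomial.eval_mul, Polynomial.eval_C, Polynomial.eval_X,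
    Polynomial.eval_pow, Polynomial.eval_one] at hm
  -- comparison of the coefficients of `1, s, s², s³`, by interpolation at `0, 1, -1, 2`
  have e0 : c = -t ^ 3 * m := by linear_combination hm 0
  have e1 : a = 3 * t ^ 2 * m := by
    linear_combination -1/2 * hm 0 + hm 1 - 1/3 * hm (-1) - 1/6 * hm 2
  have e2 : b = -3 * t * m := by
    linear_combination - hm 0 + 1/2 * hm 1 + 1/2 * hm (-1)
  have e3 : c = m := by
    linear_combination 1/2 * hm 0 - 1/2 * hm 1 - 1/6 * hm (-1) + 1/6 * hm 2
  have hm0 : m ≠ 0 := by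
    rintro rfl
    fin_cases i
    · exact hi (e1.trans (by ring))
    · exact hi (e2.trans (by ring))
    · exact hi e3
  refine ⟨t, k * m, ?_, mul_ne_zero hk hm0, fun v => ?_⟩
  · have : m * (t ^ 3 + 1) = 0 := by linear_combination e0 - e3
    exact eq_neg_of_add_eq_zero_left ((mul_eq_zero.1 this).resolve_left hm0)
  · rw [hl, hT, e1, e2, e3]
    simp
    ring

lemma exists_of_isHyperosculatingConic_nodalCubic {q : S}
    (hq : IsHyperosculatingConic nodalCubic q) :
    ∃ t k : ℂ, t ^ 3 = 1 ∧ k ≠ 0 ∧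
      ∀ v, eval v q = k * (21 * t * v 0 ^ 2 + 21 * t ^ 2 * v 1 ^ 2 + v 2 ^ 2 - 22 * v 0 * v 1 -
        6 * t ^ 2 * v 0 * v 2 - 6 * t * v 1 * v 2) := by
  obtain ⟨hhom, hirr, p, hp, h6⟩ := hq
  obtain ⟨t, ht, hpt⟩ := hp.exists_nodalParam
  obtain ⟨a, b, c, d, e, g, hv⟩ := exists_quadratic hhom
  have hqe : q = C a * X 0 ^ 2 + C b * X 1 ^ 2 + C c * X 2 ^ 2 + C d * X 0 * X 1 + C e * X 0 * X 2 +
      C g * X 1 * X 2 := MvPolynomial.funext fun v => by rw [hv]; simp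
  have hdvd : (Polynomial.X - Polynomial.C t) ^ 6 ∣ aeval (nodalParam Polynomial.X) q :=
    pow_dvd_of_le_intersectionMultiplicity hhom ht (by rwa [← hpt])
  have hγ : aeval (nodalParam Polynomial.X) q =
      Polynomial.C a * Polynomial.X ^ 2 + Polynomial.C b * (Polynomial.X ^ 2) ^ 2 +
        Polynomial.C c * (1 + Polynomial.X ^ 3) ^ 2 +
        Polynomial.C d * Polynomial.X * Polynomial.X ^ 2 +
        Polynomial.C e * Polynomial.X * (1 + Polynomial.X ^ 3) +
        Polynomial.C g * Polynomial.X ^ 2 * (1 + Polynomial.X ^ 3) := by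
    rw [hqe]
    simp [nodalParam]
  rw [hγ] at hdvd
  obtain ⟨m, hm⟩ := eq_C_mul_pow_of_dvd (by compute_degree) hdvd
  simp only [Polynomial.eval_add, Polynomial.eval_mul, Polynomial.eval_C, Polynomial.eval_X,
    Polynomial.eval_pow, Polynomial.eval_one] at hm
  -- comparison of the coefficients of `1, …, s⁶`, by interpolation at `0, ±1, ±2, ±3`
  have e0 : c = t ^ 6 * m := by linear_combination hm 0
  have e1 : e = -6 * t ^ 5 * m := by
    linear_combination 3/4*hm 1 - 3/4*hm (-1) - 3/20*hm 2 + 3/20*hm (-2) + 1/60*hm 3 - 1/60*hm (-3)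
  have e2 : a + g = 15 * t ^ 4 * m := by
    linear_combination -49/36*hm 0 + 3/4*hm 1 + 3/4*hm (-1) - 3/40*hm 2 - 3/40*hm (-2) +
      1/180*hm 3 + 1/180*hm (-3)
  have e3 : 2 * c + d = -20 * t ^ 3 * m := by
    linear_combination -13/48*hm 1 + 13/48*hm (-1) + 1/6*hm 2 - 1/6*hm (-2) - 1/48*hm 3 +
      1/48*hm (-3)
  have e4 : b + e = 15 * t ^ 2 * m := by
    linear_combination 7/18*hm 0 - 13/48*hm 1 - 13/48*hm (-1) + 1/12*hm 2 + 1/12*hm (-2) -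
      1/144*hm 3 - 1/144*hm (-3)
  have e5 : g = -6 * t * m := by
    linear_combination 1/48*hm 1 - 1/48*hm (-1) - 1/60*hm 2 + 1/60*hm (-2) + 1/240*hm 3 -
      1/240*hm (-3)
  have e6 : c = m := by
    linear_combination -1/36*hm 0 + 1/48*hm 1 + 1/48*hm (-1) - 1/120*hm 2 - 1/120*hm (-2) +
      1/720*hm 3 + 1/720*hm (-3)
  have hm0 : m ≠ 0 := by
    rintro rfl
    refine hirr.ne_zero (MvPolynomial.funext fun v => ?_)
    rw [hv]
    have ha : a = 0 := by linear_combination e2 - e5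
    have hb : b = 0 := by linear_combination e4 - e1
    have hd : d = 0 := by linear_combination e3 - 2 * e6
    have he : e = 0 := by linear_combination e1
    have hg : g = 0 := by linear_combination e5
    rw [ha, hb, hd, he, hg, e6]
    simp
  have h6 : (t ^ 3 - 1) * (t ^ 3 + 1) = 0 := by
    have : m * ((t ^ 3 - 1) * (t ^ 3 + 1)) = 0 := by linear_combination e6 - e0
    exact (mul_eq_zero.1 this).resolve_left hm0
  have hg := e5
  have hd : d = -20 * t ^ 3 * m - 2 * m := by linear_combination e3 - 2 * e6
  rcases mul_eq_zero.1 h6 with h | h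
  · refine ⟨t, m, sub_eq_zero.1 h, hm0, fun v => ?_⟩
    have he : e = -6 * t ^ 2 * m := by linear_combination e1 - 6 * t ^ 2 * m * h
    have ha : a = 21 * t * m := by linear_combination e2 - e5 + 15 * t * m * h
    have hb : b = 21 * t ^ 2 * m := by linear_combination e4 - he
    rw [hv, ha, hb, e6, hd, he, hg]
    linear_combination -20 * m * v 0 * v 1 * h
  · -- a conic with sixfold contact at an inflection point is the double inflectional line
    exfalso
    have he : e = 6 * t ^ 2 * m := by linear_combination e1 - 6 * t ^ 2 * m * h
    have ha : a = -9 * t * m := by linear_combination e2 - e5 + 15 * t * m * h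
    have hb : b = 9 * t ^ 2 * m := by linear_combination e4 - he
    have : q = (C m * (C (3 * t ^ 2) * X 0 - C (3 * t) * X 1 + X 2)) *
        (C (3 * t ^ 2) * X 0 - C (3 * t) * X 1 + X 2) := MvPolynomial.funext fun v => by
      rw [hv, ha, hb, e6, hd, he, hg]
      simp
      linear_combination (-2 * m * v 0 * v 1 - 9 * m * t * v 0 ^ 2) * h
    rw [this] at hirr
    exact not_irreducible_mul (by simp) (by simp) hirr

/-! ### Reduction to the model arrangements -/

lemma det_nodalFrame {t r : ℂ} (ht : t ^ 3 = 1) (hr : r ^ 2 = -3) :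
    (!![-t * r / 6, 0, t / 2; t ^ 2 * r / 6, 0, t ^ 2 / 2; 0, 1, 1] :
      Matrix (Fin 3) (Fin 3) ℂ).det ≠ 0 := by
  have hr0 : r ≠ 0 := by rintro rfl; norm_num at hr
  have : (!![-t * r / 6, 0, t / 2; t ^ 2 * r / 6, 0, t ^ 2 / 2; 0, 1, 1] :
      Matrix (Fin 3) (Fin 3) ℂ).det = t ^ 3 * r / 6 := by
    rw [Matrix.det_fin_three]
    simp only [Matrix.of_apply, Matrix.cons_val]
    ring
  rw [this, ht]
  simpa using hr0

/-- Coordinates adapted to the hyperosculating conic with parameter `t`, `t ^ 3 = 1`. A square root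
`r` of `-3` orders the two inflectional lines that do not correspond to the parameter `-t`. -/
def nodalFrame {t r : ℂ} (ht : t ^ 3 = 1) (hr : r ^ 2 = -3) : (Fin 3 → ℂ) ≃ₗ[ℂ] (Fin 3 → ℂ) :=
  linAut !![-t * r / 6, 0, t / 2; t ^ 2 * r / 6, 0, t ^ 2 / 2; 0, 1, 1] (det_nodalFrame ht hr)

section Frame

variable {t r : ℂ} (ht : t ^ 3 = 1) (hr : r ^ 2 = -3)

lemma nodalFrame_apply (v : Fin 3 → ℂ) : nodalFrame ht hr v =
    ![t * (v 2 / 2 - r * v 0 / 6), t ^ 2 * (v 2 / 2 + r * v 0 / 6), v 1 + v 2] := by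
  rw [nodalFrame, linAut_apply]
  ext i
  fin_cases i <;> simp [Matrix.mulVec, dotProduct, Fin.sum_univ_three] <;> ring

lemma pullback_nodalFrame_nodalCubic :
    pullback (nodalFrame ht hr) nodalCubic = C (-1 / 12) * modelCubic := by
  refine MvPolynomial.funext fun v => ?_
  rw [eval_pullback, eval_nodalCubic, nodalFrame_apply, map_mul, eval_modelCubic, eval_C]
  simp only [Matrix.cons_val]
  linear_combination ((v 2 / 2 - r * v 0 / 6) ^ 3 + (t ^ 3 + 1) * (v 2 / 2 + r * v 0 / 6) ^ 3 -
    (v 2 / 2 - r * v 0 / 6) * (v 2 / 2 + r * v 0 / 6) * (v 1 + v 2)) * ht +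
    (v 2 * v 0 ^ 2 / 12 + v 0 ^ 2 * (v 1 + v 2) / 36) * hr

lemma pullback_nodalFrame_conic {q : S} {k : ℂ} (hq : ∀ v, eval v q = k * (21 * t * v 0 ^ 2 +
      21 * t ^ 2 * v 1 ^ 2 + v 2 ^ 2 - 22 * v 0 * v 1 - 6 * t ^ 2 * v 0 * v 2 -
        6 * t * v 1 * v 2)) :
    pullback (nodalFrame ht hr) q = C (-k / 3) * modelConic := by
  refine MvPolynomial.funext fun v => ?_
  rw [eval_pullback, hq, nodalFrame_apply, map_mul, eval_modelConic, eval_C]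
  simp only [Matrix.cons_val]
  linear_combination k * (21 * (v 2 / 2 - r * v 0 / 6) ^ 2 +
    21 * (t ^ 3 + 1) * (v 2 / 2 + r * v 0 / 6) ^ 2 -
    22 * (v 2 / 2 - r * v 0 / 6) * (v 2 / 2 + r * v 0 / 6) - 6 * v 2 * (v 1 + v 2)) * ht +
    k * (16 / 9 * v 0 ^ 2) * hr

lemma pullback_nodalFrame_line {l : S} {s c : ℂ}
    (hl : ∀ v, eval v l = c * (3 * s ^ 2 * v 0 - 3 * s * v 1 + v 2)) (hs : s = -t) :
    pullback (nodalFrame ht hr) l = C c * modelLine := by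
  subst hs
  refine MvPolynomial.funext fun v => ?_
  rw [eval_pullback, hl, nodalFrame_apply, map_mul, eval_modelLine, eval_C]
  simp only [Matrix.cons_val]
  linear_combination 3 * c * v 2 * ht

lemma pullback_nodalFrame_linePos {l : S} {s c : ℂ}
    (hl : ∀ v, eval v l = c * (3 * s ^ 2 * v 0 - 3 * s * v 1 + v 2)) (hs : 2 * s = t * (1 + r)) :
    pullback (nodalFrame ht hr) l = C (c / 2) * modelLinePos := by
  obtain rfl : s = t * (1 + r) / 2 := by linear_combination hs / 2
  refine MvPolynomial.funext fun v => ?_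
  rw [eval_pullback, hl, nodalFrame_apply, map_mul, eval_modelLinePos, eval_C]
  simp only [Matrix.cons_val]
  linear_combination c * (3 * (1 + r) ^ 2 / 4 * (v 2 / 2 - r * v 0 / 6) -
    3 * (1 + r) / 2 * (v 2 / 2 + r * v 0 / 6)) * ht +
    c * (3 * v 2 / 8 - v 0 / 2 - r * v 0 / 8) * hr

lemma pullback_nodalFrame_lineNeg {l : S} {s c : ℂ}
    (hl : ∀ v, eval v l = c * (3 * s ^ 2 * v 0 - 3 * s * v 1 + v 2)) (hs : 2 * s = t * (1 - r)) :
    pullback (nodalFrame ht hr) l = C (c / 2) * modelLineNeg := by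
  obtain rfl : s = t * (1 - r) / 2 := by linear_combination hs / 2
  refine MvPolynomial.funext fun v => ?_
  rw [eval_pullback, hl, nodalFrame_apply, map_mul, eval_modelLineNeg, eval_C]
  simp only [Matrix.cons_val]
  linear_combination c * (3 * (1 - r) ^ 2 / 4 * (v 2 / 2 - r * v 0 / 6) -
    3 * (1 - r) / 2 * (v 2 / 2 + r * v 0 / 6)) * ht +
    c * (3 * v 2 / 8 + v 0 / 2 - r * v 0 / 8) * hr

end Frame

lemma eq_neg_or_exists_sqrt {s t : ℂ} (ht : t ^ 3 = 1) (hs : s ^ 3 = -1) :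
    s = -t ∨ ∃ r, r ^ 2 = -3 ∧ 2 * s = t * (1 + r) := by
  have h : (s + t) * (s ^ 2 - s * t + t ^ 2) = 0 := by linear_combination hs + ht
  rcases mul_eq_zero.1 h with h | h
  · exact Or.inl (eq_neg_of_add_eq_zero_left h)
  · refine Or.inr ⟨(2 * s - t) * t ^ 2, ?_, ?_⟩
    · linear_combination 4 * t ^ 4 * h - 3 * (t ^ 3 + 1) * ht
    · linear_combination -(2 * s - t) * ht

lemma exists_pullback_eq_model_of_line {E Q L : S} (hE : IsNodalCubic E)
    (hQ : IsHyperosculatingConic E Q) (hL : IsInflectionalLine E L) :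
    ∃ B : (Fin 3 → ℂ) ≃ₗ[ℂ] (Fin 3 → ℂ), ∃ c : ℂ, c ≠ 0 ∧
      (pullback B (E * Q * L) = C c * (modelCubic * modelConic * modelLine) ∨
        pullback B (E * Q * L) = C c * (modelCubic * modelConic * modelLinePos)) := by
  obtain ⟨A, hA⟩ := hE.exists_pullback_eq
  have hQ' := hQ.pullback A hE.isHomogeneous
  have hL' := hL.pullback A hE.isHomogeneous
  rw [hA] at hQ' hL'
  obtain ⟨t, k, ht, hk, hq⟩ := exists_of_isHyperosculatingConic_nodalCubic hQ'
  obtain ⟨s, c, hs, hc, hl⟩ := exists_of_isInflectionalLine_nodalCubic hL'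
  rcases eq_neg_or_exists_sqrt ht hs with h | ⟨r, hr, h⟩
  · obtain ⟨r, hr⟩ := IsAlgClosed.exists_pow_nat_eq (-3 : ℂ) two_pos
    refine ⟨(nodalFrame ht hr).trans A, -1 / 12 * (-k / 3) * c, by simp [hk, hc], Or.inl ?_⟩
    rw [pullback_trans, map_mul, map_mul, map_mul, map_mul, hA,
      pullback_nodalFrame_nodalCubic, pullback_nodalFrame_conic ht hr hq,
      pullback_nodalFrame_line ht hr hl h]
    simp only [C_mul]
    ring
  · refine ⟨(nodalFrame ht hr).trans A, -1 / 12 * (-k / 3) * (c / 2), by simp [hk, hc], Or.inr ?_⟩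
    rw [pullback_trans, map_mul, map_mul, map_mul, map_mul, hA,
      pullback_nodalFrame_nodalCubic, pullback_nodalFrame_conic ht hr hq,
      pullback_nodalFrame_linePos ht hr hl h]
    simp only [C_mul]
    ring

lemma exists_pullback_eq_model_of_lines {E Q L L' : S} (hE : IsNodalCubic E)
    (hQ : IsHyperosculatingConic E Q) (hL : IsInflectionalLine E L)
    (hL' : IsInflectionalLine E L') (hne : ¬ Associated L L') :
    ∃ B : (Fin 3 → ℂ) ≃ₗ[ℂ] (Fin 3 → ℂ), ∃ c : ℂ, c ≠ 0 ∧
      (pullback B (E * Q * L * L') = C c * (modelCubic * modelConic * modelLine * modelLinePos) ∨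
        pullback B (E * Q * L * L') =
          C c * (modelCubic * modelConic * modelLinePos * modelLineNeg)) := by
  obtain ⟨A, hA⟩ := hE.exists_pullback_eq
  have hQ1 := hQ.pullback A hE.isHomogeneous
  have hL1 := hL.pullback A hE.isHomogeneous
  have hL1' := hL'.pullback A hE.isHomogeneous
  rw [hA] at hQ1 hL1 hL1'
  obtain ⟨t, k, ht, hk, hq⟩ := exists_of_isHyperosculatingConic_nodalCubic hQ1
  obtain ⟨s, c, hs, hc, hl⟩ := exists_of_isInflectionalLine_nodalCubic hL1
  obtain ⟨s', c', hs', hc', hl'⟩ := exists_of_isInflectionalLine_nodalCubic hL1'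
  have hss : s ≠ s' := by
    rintro rfl
    refine hne ?_
    have : pullback A L' = C (c' / c) * pullback A L := MvPolynomial.funext fun v => by
      rw [map_mul, hl, hl', eval_C]
      field_simp
    have h2 : L' = C (c' / c) * L := by
      apply (pullback A).injective
      rw [this, map_mul, pullback_C]
    rw [h2]
    exact associated_C_mul (div_ne_zero hc' hc) L
  rcases eq_neg_or_exists_sqrt ht hs with h | ⟨r, hr, h⟩ <;>
    rcases eq_neg_or_exists_sqrt ht hs' with h' | ⟨r', hr', h'⟩
  · exact absurd (h.trans h'.symm) hss
  · refine ⟨(nodalFrame ht hr').trans A, -1 / 12 * (-k / 3) * c * (c' / 2),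
      by simp [hk, hc, hc'], Or.inl ?_⟩
    rw [pullback_trans, map_mul, map_mul, map_mul, map_mul, map_mul, map_mul, hA,
      pullback_nodalFrame_nodalCubic, pullback_nodalFrame_conic ht hr' hq,
      pullback_nodalFrame_line ht hr' hl h, pullback_nodalFrame_linePos ht hr' hl' h']
    simp only [C_mul]
    ring
  · refine ⟨(nodalFrame ht hr).trans A, -1 / 12 * (-k / 3) * (c / 2) * c',
      by simp [hk, hc, hc'], Or.inl ?_⟩
    rw [pullback_trans, map_mul, map_mul, map_mul, map_mul, map_mul, map_mul, hA,
      pullback_nodalFrame_nodalCubic, pullback_nodalFrame_conic ht hr hq,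
      pullback_nodalFrame_linePos ht hr hl h, pullback_nodalFrame_line ht hr hl' h']
    simp only [C_mul]
    ring
  · have hrr : r' = -r := by
      refine (sq_eq_sq_iff_eq_or_eq_neg.1 (hr'.trans hr.symm)).resolve_left fun hc => hss ?_
      subst hc
      linear_combination h / 2 - h' / 2
    rw [hrr, ← sub_eq_add_neg] at h'
    refine ⟨(nodalFrame ht hr).trans A, -1 / 12 * (-k / 3) * (c / 2) * (c' / 2),
      by simp [hk, hc, hc'], Or.inr ?_⟩
    rw [pullback_trans, map_mul, map_mul, map_mul, map_mul, map_mul, map_mul, hA,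
      pullback_nodalFrame_nodalCubic, pullback_nodalFrame_conic ht hr hq,
      pullback_nodalFrame_linePos ht hr hl h, pullback_nodalFrame_lineNeg ht hr hl' h']
    simp only [C_mul]
    ring

/-! ### Freeness -/

lemma IsInflectionalLine.isHomogeneous {f l : S} (h : IsInflectionalLine f l) :
    l.IsHomogeneous 1 := by
  obtain ⟨p, _, hl⟩ := h
  obtain ⟨k, -, rfl⟩ := exists_C_mul_of_associated hl.symm
  exact (IsHomogeneous.sum _ _ _ fun i _ => (isHomogeneous_X ℂ i).C_mul _).C_mul k

lemma IsInflectionalLine.irreducible {f l : S} (h : IsInflectionalLine f l) : Irreducible l := by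
  have hl0 : l ≠ 0 := by
    rintro rfl
    obtain ⟨p, ⟨⟨_, i, hi⟩, _⟩, hl⟩ := h
    have h0 := congrArg (eval (Pi.single i 1)) (hl.eq_zero_iff.1 rfl)
    refine hi ?_
    simpa [tangentLine, Pi.single_apply] using h0
  refine irreducible_of_totalDegree_eq_one (h.isHomogeneous.totalDegree hl0) fun x hx => ?_
  obtain ⟨m, hm⟩ := ne_zero_iff.1 hl0
  exact IsUnit.mk0 x (ne_zero_of_dvd_ne_zero hm (hx m))

lemma not_associated_of_isHomogeneous {f g : S} {m n : ℕ} (hf : f.IsHomogeneous m)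
    (hg : g.IsHomogeneous n) (hg0 : g ≠ 0) (h : m ≠ n) : ¬ Associated f g := by
  intro hfg
  obtain ⟨c, -, rfl⟩ := exists_C_mul_of_associated hfg
  exact h ((hf.C_mul c).inj_right hg hg0)

lemma isRelPrime_of_not_associated {f g : S} (hf : Irreducible f) (hg : Irreducible g)
    (h : ¬ Associated f g) : IsRelPrime f g :=
  (hf.isRelPrime_iff_not_dvd).2 fun hd => h (hf.associated_of_dvd hg hd)

/-- Freeness and the exponents can be read off from a projectively equivalent curve. -/
lemma isFree_of_pullback_eq {f g : S} {d m : ℕ} (hf : f.IsHomogeneous d) (hsq : Squarefree f)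
    {B : (Fin 3 → ℂ) ≃ₗ[ℂ] (Fin 3 → ℂ)} {c : ℂ} (hc : c ≠ 0) (h : pullback B f = C c * g)
    (hm : Squarefree g → mdr g = m) (hmd : 2 * m + 1 ≤ d)
    (hτ : totalTjurinaNumber g = (((d - 1) ^ 2 - m * (d - 1 - m) : ℕ) : ℕ∞)) :
    IsFree f d ∧ exponents f d = (m, d - 1 - m) := by
  have hg : Squarefree g := by
    intro x hx
    have h1 : x * x ∣ pullback B f := h ▸ hx.mul_left _
    have h2 := map_dvd (pullback B).symm h1
    rw [map_mul, AlgEquiv.symm_apply_apply] at h2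
    simpa using (hsq _ h2).map (pullback B)
  have hmf : mdr f = m := by rw [← mdr_pullback B, h, mdr_C_mul hc, hm hg]
  have hτf : totalTjurinaNumber f = totalTjurinaNumber g := by
    rw [← totalTjurinaNumber_pullback B hf, h, totalTjurinaNumber_C_mul hc]
  exact ⟨⟨hf, hsq, by rwa [hmf], by rw [hτf, hτ, hmf]⟩, by rw [exponents, hmf]⟩

lemma squarefree_mul_line {E Q L : S} (hE : IsNodalCubic E) (hQ : IsHyperosculatingConic E Q)
    (hL : IsInflectionalLine E L) : Squarefree (E * Q * L) := by
  have hEQ := isRelPrime_of_not_associated hE.irreducible hQ.irreducible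
    (not_associated_of_isHomogeneous hE.isHomogeneous hQ.isHomogeneous hQ.irreducible.ne_zero
      (by norm_num))
  have hEL := isRelPrime_of_not_associated hE.irreducible hL.irreducible
    (not_associated_of_isHomogeneous hE.isHomogeneous hL.isHomogeneous hL.irreducible.ne_zero
      (by norm_num))
  have hQL := isRelPrime_of_not_associated hQ.irreducible hL.irreducible
    (not_associated_of_isHomogeneous hQ.isHomogeneous hL.isHomogeneous hL.irreducible.ne_zero
      (by norm_num))
  exact squarefree_mul_iff.2 ⟨hEL.mul_left hQL, squarefree_mul_iff.2 ⟨hEQ,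
    hE.irreducible.squarefree, hQ.irreducible.squarefree⟩, hL.irreducible.squarefree⟩

lemma squarefree_mul_lines {E Q L L' : S} (hE : IsNodalCubic E) (hQ : IsHyperosculatingConic E Q)
    (hL : IsInflectionalLine E L) (hL' : IsInflectionalLine E L') (hne : ¬ Associated L L') :
    Squarefree (E * Q * L * L') := by
  have hEL := isRelPrime_of_not_associated hE.irreducible hL'.irreducible
    (not_associated_of_isHomogeneous hE.isHomogeneous hL'.isHomogeneous hL'.irreducible.ne_zero
      (by norm_num))
  have hQL := isRelPrime_of_not_associated hQ.irreducible hL'.irreducible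
    (not_associated_of_isHomogeneous hQ.isHomogeneous hL'.isHomogeneous hL'.irreducible.ne_zero
      (by norm_num))
  have hLL := isRelPrime_of_not_associated hL.irreducible hL'.irreducible hne
  exact squarefree_mul_iff.2 ⟨(hEL.mul_left hQL).mul_left hLL, squarefree_mul_line hE hQ hL,
    hL'.irreducible.squarefree⟩

end PlaneCurve

end

theorem theorem3p1 (E Q L₁ : PlaneCurve.S)
    (hE : PlaneCurve.IsNodalCubic E)
    (hQ : PlaneCurve.IsHyperosculatingConic E Q)
    (hL₁ : PlaneCurve.IsInflectionalLine E L₁) :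
    (PlaneCurve.IsFree (E * Q * L₁) 6 ∧ PlaneCurve.exponents (E * Q * L₁) 6 = (2, 3)) ∧
    (∀ L₂ : PlaneCurve.S, PlaneCurve.IsInflectionalLine E L₂ → ¬ Associated L₁ L₂ →
      PlaneCurve.IsFree (E * Q * L₁ * L₂) 7 ∧
        PlaneCurve.exponents (E * Q * L₁ * L₂) 7 = (3, 3)) := by
  have hd := (hE.isHomogeneous.mul hQ.isHomogeneous).mul hL₁.isHomogeneous
  refine ⟨?_, fun L₂ hL₂ hne => ?_⟩
  · have hsq := PlaneCurve.squarefree_mul_line hE hQ hL₁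
    obtain ⟨B, c, hc, h | h⟩ := PlaneCurve.exists_pullback_eq_model_of_line hE hQ hL₁
    · exact PlaneCurve.isFree_of_pullback_eq hd hsq hc h PlaneCurve.mdr_modelLine (by norm_num)
        PlaneCurve.totalTjurinaNumber_modelLine.2
    · exact PlaneCurve.isFree_of_pullback_eq hd hsq hc h PlaneCurve.mdr_modelLinePos (by norm_num)
        PlaneCurve.totalTjurinaNumber_modelLinePos.2
  · have hsq := PlaneCurve.squarefree_mul_lines hE hQ hL₁ hL₂ hne
    obtain ⟨B, c, hc, h | h⟩ := PlaneCurve.exists_pullback_eq_model_of_lines hE hQ hL₁ hL₂ hne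
    · exact PlaneCurve.isFree_of_pullback_eq (hd.mul hL₂.isHomogeneous) hsq hc h
        PlaneCurve.mdr_modelLine_modelLinePos (by norm_num)
        PlaneCurve.totalTjurinaNumber_modelLine_modelLinePos
    · exact PlaneCurve.isFree_of_pullback_eq (hd.mul hL₂.isHomogeneous) hsq hc h
        PlaneCurve.mdr_modelLinePos_modelLineNeg (by norm_num)
        PlaneCurve.totalTjurinaNumber_modelLinePos_modelLineNeg
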